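/- **Theorem 3.2.** Let $r\ge 3$ be an integer, $A=\sqrt{-1}\,e^{-2\pi i/4r}$ and $\delta=-A^2-A^{-2}=2\cos(\pi/r)$. *The modular functor $\mathbf{CSr}$ on punctured disks.* Let $\mathcal S_N$ be the Kauffman bracket skein space of a disk with $N$ boundary points: the complex vector space with basis the crossingless perfect matchings of the $N$ points, with the Hermitian form $\langle s,t\rangle_h=\delta^{\ell(s,t)}$ on basis elements (linear in $s$, conjugate linear in $t$), where $\ell(s,t)$ is the number of loops formed by gluing the disk with $s$ to the mirror image of the disk with $t$. Let $U_j$ act on $\mathcal S_N$ by gluing on the diagram $\cup\cap$ at the points $j,j+1$, each closed loop being replaced by $\delta$. For $0\le m\le r-2$ let $V(D_n^m)$, the state space of the disk with $n$ interior punctures labelled $1$ and boundary labelled $m$, be the image in $\mathcal S_{n+m}$ of the $m$-th Jones–Wenzl idempotent placed on the last $m$ points, modulo the radical of $\langle\,,\rangle_h$. Fix a handedness of half twists, i.e. $a\in\{A,A^{-1}\}$; the half twist $\sigma_j$ acts by gluing on a crossing, i.e. by $a\,\mathrm{id}+a^{-1}U_j$. Denote the resulting action by $\rho_r$: for $m\ne1$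 the mapping class group of $D_n^m$ is the braid group $B_n=\langle\sigma_1,\dots,\sigma_{n-1}\rangle$; for $m=1$ it is the mapping class group $\mathcal M(0,n+1)$ of the $(n+1)$-punctured sphere, generated by $\sigma_1,\dots,\sigma_n$ subject to the braid relations and $\sigma_1\cdots\sigma_n\sigma_n\cdots\sigma_1=1=(\sigma_1\cdots\sigma_n)^{n+1}$, acting projectively (up to phase). *The Jones sectors.* Let $q=a^4$ (so $q=e^{2\pi i/r}$ for $a=A^{-1}$ and $q=A^4=e^{-2\pi i/r}$ for $a=A$) and $[k]=\sin(k\pi/r)/\sin(\pi/r)$. For a Young diagram $\lambda=[\lambda_1,\lambda_2]$ with $n$ boxes and $\lambda_1-\lambda_2\le r-2$, let $T_\lambda^{(2,r)}$ be the set of standard tableaux of shape $\lambda$ such that for each $k\le n$ the boxes with entries $\le k$ form a diagram $[\nu_1,\nu_2]$ with $\nu_1-\nu_2\le r-2$. The sector $\rho_{\lambda,\beta,n}$ (where $\beta=[2]^2$) is the unitary representation of $B_n$ on the Hilbert space with orthonormal basis $\{v_t:t\in T_\lambda^{(2,r)}\}$ given by $\sigma_i\mapsto q-(1+q)e_i$,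 where $e_iv_t=\alpha v_t+\sqrt{\alpha(1-\alpha)}\,v_{g_i(t)}$, $\alpha=\frac{[d+1]}{[2][d]}$, $d=c_1-c_2-(r_1-r_2)$, the entries $i$ and $i+1$ of $t$ are in row and column $(r_1,c_1)$ and $(r_2,c_2)$, and $g_i(t)$ is $t$ with $i$ and $i+1$ exchanged (the second term is omitted if $g_i(t)\notin T_\lambda^{(2,r)}$). Then all these representations are well defined, $\rho_r$ preserves $\langle\,,\rangle_h$, and: (1) If $0\le m\le\min(r-2,n)$, $m\neq1$ and $m+n$ is even, then $\rho_r:B_n\to \mathbf U(V(D_n^m))$ is unitarily equivalent, up to phase, to $\rho_{\lambda,\beta,n}$ for $\lambda=[\frac{m+n}{2},\frac{n-m}{2}]$: there are a linear isomorphism $S$ carrying $\langle\,,\rangle_h$ to the standard inner product (so $\langle\,,\rangle_h$ is positive definite on $V(D_n^m)$) and a homomorphism $\chi:B_n\to U(1)$ with $S\rho_r(b)S^{-1}=\chi(b)\rho_{\lambda,\beta,n}(b)$ for all $b\in B_n$. (2) If $n$ is odd and $m=1$, then the composition of the projective representation $\rho_r$ of $\mathcal M(0,n+1)$ with the natural map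 $\iota:B_n\to\mathcal M(0,n+1)$, $\sigma_i\mapsto\sigma_i$, is unitarily equivalent, up to phase, to $\rho_{\lambda,\beta,n}$ for $\lambda=[\frac{n+1}{2},\frac{n-1}{2}]$: there is a linear isomorphism $S$ carrying $\langle\,,\rangle_h$ to the standard inner product such that, for every $b\in B_n$ and every unitary $u$ representing $\rho_r(\iota(b))$, $SuS^{-1}=z\,\rho_{\lambda,\beta,n}(b)$ for some $z\in U(1)$. -/

import Mathlib

open scoped ComplexConjugate

noncomputable section

namespace CSJones

/-! ### Braid groups and mapping class groups of punctured spheres -/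

/-- Relations of Artin's braid group, as words in generators `σ_0, …, σ_{k-1}`. -/
def braidRels (k : ℕ) : Set (FreeGroup (Fin k)) :=
  {w | ∃ i j : Fin k, (i : ℕ) + 1 < j ∧
      w = FreeGroup.of i * FreeGroup.of j * (FreeGroup.of i)⁻¹ * (FreeGroup.of j)⁻¹} ∪
  {w | ∃ i j : Fin k, (i : ℕ) + 1 = j ∧
      w = (FreeGroup.of i * FreeGroup.of j * FreeGroup.of i) *
        (FreeGroup.of j * FreeGroup.of i * FreeGroup.of j)⁻¹}

/-- The braid group `B_n` on `n` strands, generators `σ_0, …, σ_{n-2}`. -/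
abbrev BraidGroup (n : ℕ) : Type := PresentedGroup (braidRels (n - 1))

/-- The word `σ_0 σ_1 ⋯ σ_{k-1}`. -/
def coxeterWord (k : ℕ) : FreeGroup (Fin k) :=
  (List.ofFn fun i : Fin k => FreeGroup.of i).prod

/-- The word `σ_{k-1} ⋯ σ_1 σ_0`. -/
def coxeterWordRev (k : ℕ) : FreeGroup (Fin k) :=
  (List.ofFn fun i : Fin k => FreeGroup.of i).reverse.prod

/-- Relations of the mapping class group of the sphere with `k + 1` punctures:
the braid relations, `σ_0 ⋯ σ_{k-1} σ_{k-1} ⋯ σ_0 = 1` and `(σ_0 ⋯ σ_{k-1}) ^ (k + 1) = 1`. -/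
def sphereRels (k : ℕ) : Set (FreeGroup (Fin k)) :=
  braidRels k ∪ {coxeterWord k * coxeterWordRev k, coxeterWord k ^ (k + 1)}

/-- The mapping class group `M(0, N)` of the sphere with `N` (unordered) punctures. -/
abbrev SphereMCG (N : ℕ) : Type := PresentedGroup (sphereRels (N - 1))

/-- The images of the standard generators of `B_n` in `M(0, n + 1)`. -/
def inclGen (n : ℕ) (i : Fin (n - 1)) : SphereMCG (n + 1) :=
  PresentedGroup.of ⟨i, by omega⟩

theorem inclGen_rels (n : ℕ) : ∀ w ∈ braidRels (n - 1), FreeGroup.lift (inclGen n) w = 1 := by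
  have key : ∀ w ∈ braidRels n, PresentedGroup.mk (sphereRels (n + 1 - 1)) w = 1 := by
    intro w hw
    exact PresentedGroup.one_of_mem (Or.inl hw)
  rintro w (⟨i, j, hij, rfl⟩ | ⟨i, j, hij, rfl⟩)
  · have := key _ (Or.inl ⟨⟨i, by omega⟩, ⟨j, by omega⟩, hij, rfl⟩)
    simpa [inclGen, PresentedGroup.of] using this
  · have := key _ (Or.inr ⟨⟨i, by omega⟩, ⟨j, by omega⟩, hij, rfl⟩)
    simpa [inclGen, PresentedGroup.of] using this

/-- The natural map `ι : B_n → M(0, n + 1)`, `σ_i ↦ σ_i`, where the boundary of the disk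
becomes the last puncture. -/
def braidToSphere (n : ℕ) : BraidGroup n →* SphereMCG (n + 1) :=
  PresentedGroup.toGroup (inclGen_rels n)

/-! ### The Kauffman bracket skein space of a disk with boundary points -/

/-- `A = √-1 · exp (-2πi / 4r)`. -/
def kauffmanA (r : ℕ) : ℂ :=
  Complex.I * Complex.exp (-(2 * Real.pi * Complex.I) / (4 * r))

/-- The value `-A² - A⁻²` of a closed loop. -/
def loopValue (r : ℕ) : ℂ := -(kauffmanA r) ^ 2 - ((kauffmanA r)⁻¹) ^ 2

theorem conj_kauffmanA (r : ℕ) : conj (kauffmanA r) = (kauffmanA r)⁻¹ := by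
  have h : ((2 * Real.pi * Complex.I) / (4 * r) : ℂ)
      = ((2 * Real.pi / (4 * r) : ℝ) : ℂ) * Complex.I := by push_cast; ring
  rw [kauffmanA, neg_div, h, map_mul, ← Complex.exp_conj, mul_inv, Complex.inv_I,
    ← Complex.exp_neg, map_neg, map_mul, Complex.conj_ofReal, Complex.conj_I]
  ring_nf

theorem conj_loopValue (r : ℕ) : conj (loopValue r) = loopValue r := by
  simp only [loopValue, map_sub, map_neg, map_pow, map_inv₀, conj_kauffmanA, inv_inv]
  ring

/-- A crossingless perfect matching of `N` points on the boundary of a disk, that is, a simple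
tangle diagram without closed loops, up to isotopy. `partner x` is the other end of the arc
at `x`. -/
@[ext]
structure PlanarMatching (N : ℕ) where
  partner : Equiv.Perm (Fin N)
  invol : ∀ x, partner (partner x) = x
  noFix : ∀ x, partner x ≠ x
  planar : ∀ x y, ¬ (x < y ∧ y < partner x ∧ partner x < partner y)

instance (N : ℕ) : Finite (PlanarMatching N) :=
  Finite.of_injective PlanarMatching.partner fun _ _ h => PlanarMatching.ext h

instance (N : ℕ) : Fintype (PlanarMatching N) := Fintype.ofFinite _

theorem glue_apply {N : ℕ} (p : Equiv.Perm (Fin N)) (invol : ∀ z, p (p z) = z)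
    (noFix : ∀ z, p z ≠ z) (x y : Fin N) (hxy : x ≠ y) (z : Fin N) :
    (Equiv.swap (p x) y * p * Equiv.swap (p x) y) z =
      if z = x then y else if z = y then x else if z = p x then p y else
        if z = p y then p x else p z := by
  have h1 := invol x
  have h2 := invol y
  have h3 := noFix x
  have h4 := noFix y
  have h5 : ∀ u v, p u = p v → u = v := fun u v h => p.injective h
  simp only [Equiv.Perm.mul_apply, Equiv.swap_apply_def]
  grind

theorem planar_glue {N : ℕ} (p : Equiv.Perm (Fin N)) (invol : ∀ z, p (p z) = z)
    (noFix : ∀ z, p z ≠ z) (planar : ∀ x y, ¬ (x < y ∧ y < p x ∧ p x < p y))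
    (x y : Fin N) (hxy : (x : ℕ) + 1 = y) (z w : Fin N) :
    ¬ (z < w ∧ w < (Equiv.swap (p x) y * p * Equiv.swap (p x) y) z ∧
      (Equiv.swap (p x) y * p * Equiv.swap (p x) y) z <
        (Equiv.swap (p x) y * p * Equiv.swap (p x) y) w) := by
  have hne : x ≠ y := by intro h; rw [h] at hxy; omega
  rw [glue_apply p invol noFix x y hne, glue_apply p invol noFix x y hne]
  have P : ∀ u v : Fin N, ¬ ((u : ℕ) < v ∧ (v : ℕ) < p u ∧ (p u : ℕ) < p v) ∧
      ¬ ((p u : ℕ) < v ∧ (v : ℕ) < u ∧ (u : ℕ) < p v) ∧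
      ¬ ((u : ℕ) < p v ∧ (p v : ℕ) < p u ∧ (p u : ℕ) < v) ∧
      ¬ ((p u : ℕ) < p v ∧ (p v : ℕ) < u ∧ (u : ℕ) < v) := by
    intro u v
    refine ⟨planar u v, ?_, ?_, ?_⟩
    · simpa [invol] using planar (p u) v
    · simpa [invol] using planar u (p v)
    · simpa [invol] using planar (p u) (p v)
  have ne : ∀ v, v ≠ x → v ≠ y → v ≠ p x → v ≠ p y →
      (v : ℕ) ≠ x ∧ (v : ℕ) ≠ y ∧ (p v : ℕ) ≠ x ∧ (p v : ℕ) ≠ y ∧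
      (v : ℕ) ≠ p x ∧ (v : ℕ) ≠ p y ∧ (p v : ℕ) ≠ p x ∧ (p v : ℕ) ≠ p y := by
    intro v h1 h2 h3 h4
    refine ⟨?_, ?_, ?_, ?_, ?_, ?_, ?_, ?_⟩ <;> intro h <;> have h' := Fin.ext h <;> grind
  have hxp : (p x : ℕ) ≠ x := fun h => noFix x (Fin.ext h)
  have hyp : (p y : ℕ) ≠ y := fun h => noFix y (Fin.ext h)
  rintro ⟨h1, h2, h3⟩
  simp only [Fin.lt_def] at h1 h2 h3
  by_cases zx : z = x
  · rw [if_pos zx] at h2; subst zx; omega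
  by_cases zy : z = y
  · rw [if_neg zx, if_pos zy] at h2; subst zy; omega
  rw [if_neg zx, if_neg zy] at h2 h3
  by_cases wx : w = x
  · rw [if_pos wx] at h3; subst wx; omega
  by_cases wy : w = y
  · rw [if_neg wx, if_pos wy] at h3; subst wy; omega
  rw [if_neg wx, if_neg wy] at h3
  have Q1 := And.intro (P x w) (P w x)
  have Q2 := And.intro (P y w) (P w y)
  have Q3 := And.intro (P z x) (P x z)
  have Q4 := And.intro (P z y) (P y z)
  by_cases za : z = p x
  · rw [if_pos za] at h2 h3
    by_cases wb : w = p y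
    · subst wb; omega
    · have wa : w ≠ p x := by intro h; rw [h, ← za] at h1; omega
      rw [if_neg wa, if_neg wb] at h3
      have := ne w wx wy wa wb
      rw [za] at h1
      clear Q3 Q4 P
      omega
  by_cases zb : z = p y
  · rw [if_neg za, if_pos zb] at h2 h3
    by_cases wa : w = p x
    · subst wa; omega
    · have wb : w ≠ p y := by intro h; rw [h, ← zb] at h1; omega
      rw [if_neg wa, if_neg wb] at h3
      have := ne w wx wy wa wb
      rw [zb] at h1
      clear Q3 Q4 P
      omega
  rw [if_neg za, if_neg zb] at h2 h3
  have nz := ne z zx zy za zb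
  by_cases wa : w = p x
  · rw [if_pos wa] at h3
    rw [wa] at h1 h2
    clear Q1 Q2 P
    omega
  by_cases wb : w = p y
  · rw [if_neg wa, if_pos wb] at h3
    rw [wb] at h1 h2
    clear Q1 Q2 P
    omega
  rw [if_neg wa, if_neg wb] at h3
  exact planar z w ⟨h1, h2, h3⟩

/-- Glue the diagram `∪∩` to a matching at two neighbouring points `x`, `y`: in the result `x`
is joined to `y`, and the former partners of `x` and `y` are joined to each other. -/
def glueArc {N : ℕ} (f : PlanarMatching N) (x y : Fin N) (h : (x : ℕ) + 1 = y) :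
    PlanarMatching N where
  partner := Equiv.swap (f.partner x) y * f.partner * Equiv.swap (f.partner x) y
  invol z := by simp [f.invol]
  noFix z hz := by
    apply f.noFix (Equiv.swap (f.partner x) y z)
    apply (Equiv.swap (f.partner x) y).injective
    simpa using hz
  planar := planar_glue f.partner f.invol f.noFix f.planar x y h

instance (N : ℕ) : DecidableEq (PlanarMatching N) := Classical.decEq _

/-- The skein space of a disk with `N` boundary points: crossings and closed loops being
removed by the Kauffman bracket relations, the crossingless matchings form a basis, and an
element is given by its coefficients. -/
abbrev Skein (N : ℕ) : Type := PlanarMatching N → ℂ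

/-- Stacking the Temperley-Lieb diagram `U_j` (`∪∩` at the points `j`, `j + 1`) on a skein;
a loop is created exactly if `j` and `j + 1` were already joined. -/
def cupCap (r N j : ℕ) : Skein N →ₗ[ℂ] Skein N :=
  if h : j + 1 < N then
    Fintype.linearCombination ℂ fun f : PlanarMatching N =>
      (if f.partner ⟨j, by omega⟩ = ⟨j + 1, h⟩ then loopValue r else 1) •
        Pi.single (glueArc f ⟨j, by omega⟩ ⟨j + 1, h⟩ rfl) (1 : ℂ)
  else 0

/-- Stacking a crossing between the strands `j` and `j + 1`, resolved by the Kauffman bracket: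
`a • (identity) + a⁻¹ • U_j`. For `a = A` and `a = A⁻¹` these are the two crossings. -/
def crossing (r N : ℕ) (a : ℂ) (j : ℕ) : Skein N →ₗ[ℂ] Skein N :=
  a • LinearMap.id + a⁻¹ • cupCap r N j

/-- `Δ_k`, the bracket of the closure of the `k`-th Jones-Wenzl idempotent. -/
def chebyshevDelta (r : ℕ) : ℕ → ℂ
  | 0 => 1
  | 1 => loopValue r
  | k + 2 => loopValue r * chebyshevDelta r (k + 1) - chebyshevDelta r k

/-- Stacking the `k`-th Jones-Wenzl idempotent on the strands `s, …, s + k - 1`: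
`p_{k+1} = p_k - (Δ_{k-1} / Δ_k) p_k U_k p_k`. -/
def jonesWenzl (r N s : ℕ) : ℕ → (Skein N →ₗ[ℂ] Skein N)
  | 0 => LinearMap.id
  | 1 => LinearMap.id
  | k + 2 => jonesWenzl r N s (k + 1) -
      (chebyshevDelta r k / chebyshevDelta r (k + 1)) •
        (jonesWenzl r N s (k + 1) ∘ₗ cupCap r N (s + k) ∘ₗ jonesWenzl r N s (k + 1))

/-- The number of closed loops obtained by gluing two disks along their boundaries. -/
def loops {N : ℕ} (f g : PlanarMatching N) : ℕ :=
  Nat.card (Quotient (Relation.EqvGen.setoid fun x y : Fin N =>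
    f.partner x = y ∨ g.partner x = y))

theorem loops_comm {N : ℕ} (f g : PlanarMatching N) : loops f g = loops g f := by
  unfold loops
  simp only [or_comm]

/-- The Hermitian form `⟨s, t⟩_h`: Kauffman bracket evaluation of `s` glued to the mirror image
of `t`, extended linearly in `s` and conjugate linearly in `t`. -/
def bracketForm (r : ℕ) {N : ℕ} (x y : Skein N) : ℂ :=
  ∑ f, ∑ g, x f * conj (y g) * loopValue r ^ loops f g

theorem bracketForm_add_left (r : ℕ) {N : ℕ} (x x' y : Skein N) :
    bracketForm r (x + x') y = bracketForm r x y + bracketForm r x' y := by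
  simp [bracketForm, add_mul, Finset.sum_add_distrib]

theorem bracketForm_smul_left (r : ℕ) {N : ℕ} (c : ℂ) (x y : Skein N) :
    bracketForm r (c • x) y = c * bracketForm r x y := by
  simp [bracketForm, Finset.mul_sum, mul_assoc]

theorem bracketForm_conj (r : ℕ) {N : ℕ} (x y : Skein N) :
    conj (bracketForm r x y) = bracketForm r y x := by
  unfold bracketForm
  rw [Finset.sum_comm]
  simp only [map_sum, map_mul, map_pow, conj_loopValue, Complex.conj_conj]
  refine Finset.sum_congr rfl fun g _ => Finset.sum_congr rfl fun f _ => ?_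
  rw [loops_comm, mul_comm (conj (x f))]

/-! ### The state space of the punctured disk and its unitary group -/

/-- Skeins in the disk with `n` points labelled `1` and one point labelled `m`, i.e. an
`m`-strand cable carrying the Jones-Wenzl idempotent. -/
def labelledSkein (r n m : ℕ) : Submodule ℂ (Skein (n + m)) :=
  LinearMap.range (jonesWenzl r (n + m) n m)

/-- The radical of the Hermitian form on `labelledSkein r n m`. -/
def radical (r n m : ℕ) : Submodule ℂ (labelledSkein r n m) where
  carrier := {x | ∀ y : labelledSkein r n m, bracketForm r (x : Skein (n + m)) y = 0}
  zero_mem' y := by simp [bracketForm]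
  add_mem' {x x'} hx hx' y := by
    rw [Submodule.coe_add, bracketForm_add_left, hx y, hx' y, add_zero]
  smul_mem' c x hx y := by
    rw [Submodule.coe_smul, bracketForm_smul_left, hx y, mul_zero]

/-- The state space `V(D_n^m)` of the disk with `n` interior punctures labelled `1` and boundary
labelled `m` in the modular functor `CSr`. -/
abbrev StateSpace (r n m : ℕ) : Type := labelledSkein r n m ⧸ radical r n m

/-- The Hermitian form on the state space, induced by `bracketForm`. -/
def stateForm (r n m : ℕ) (u v : StateSpace r n m) : ℂ :=
  Quotient.liftOn₂' u v
    (fun x y => bracketForm r (x : Skein (n + m)) (y : Skein (n + m))) (by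
      intro x y x' y' hx hy
      rw [Submodule.quotientRel_def] at hx hy
      have h1 := hx y
      have h2 := hy x'
      have e1 : (x : Skein (n + m)) = (x - x' : labelledSkein r n m) + x' := by simp
      have e2 : (y : Skein (n + m)) = (y - y' : labelledSkein r n m) + y' := by simp
      change bracketForm r (x : Skein (n + m)) y = bracketForm r (x' : Skein (n + m)) y'
      rw [e1, bracketForm_add_left, h1, zero_add, ← bracketForm_conj, e2, bracketForm_add_left,
        h2, zero_add, bracketForm_conj])

/-- The linear automorphisms of `V(D_n^m)` preserving the Hermitian form. -/
def stateUnitary (r n m : ℕ) : Subgroup (StateSpace r n m ≃ₗ[ℂ] StateSpace r n m) where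
  carrier := {u | ∀ v w, stateForm r n m (u v) (u w) = stateForm r n m v w}
  one_mem' _ _ := rfl
  mul_mem' {u u'} hu hu' v w := by
    rw [LinearEquiv.mul_apply, LinearEquiv.mul_apply, hu, hu']
  inv_mem' {u} hu v w := by
    have := hu (u⁻¹ v) (u⁻¹ w)
    rw [← LinearEquiv.mul_apply, ← LinearEquiv.mul_apply, mul_inv_cancel] at this
    exact this.symm

/-- The subgroup of phases (multiplications by complex numbers of modulus one). -/
def phases (r n m : ℕ) : Subgroup (stateUnitary r n m) where
  carrier := {u | ∃ z : Circle, ∀ v, u.1 v = (z : ℂ) • v}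
  one_mem' := ⟨1, fun v => by simp⟩
  mul_mem' := by
    rintro u u' ⟨z, hz⟩ ⟨z', hz'⟩
    refine ⟨z * z', fun v => ?_⟩
    rw [Subgroup.coe_mul, LinearEquiv.mul_apply, hz', hz, smul_smul, Circle.coe_mul]
  inv_mem' := by
    rintro u ⟨z, hz⟩
    refine ⟨z⁻¹, fun v => ?_⟩
    apply u.1.injective
    have h1 : u.1 ((u⁻¹).1 v) = v := by
      rw [Subgroup.coe_inv, ← LinearEquiv.mul_apply, mul_inv_cancel, LinearEquiv.coe_one, id]
    have h2 : u.1 (((z⁻¹ : Circle) : ℂ) • v) = v := by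
      rw [map_smul, hz, smul_smul, Circle.coe_inv, inv_mul_cancel₀ z.coe_ne_zero, one_smul]
    exact h1.trans h2.symm

instance (r n m : ℕ) : (phases r n m).Normal where
  conj_mem := by
    rintro u ⟨z, hz⟩ g
    refine ⟨z, fun v => ?_⟩
    rw [Subgroup.coe_mul, Subgroup.coe_mul, LinearEquiv.mul_apply, LinearEquiv.mul_apply, hz,
      map_smul, Subgroup.coe_inv, ← LinearEquiv.mul_apply, mul_inv_cancel, LinearEquiv.coe_one, id]

/-- The projective unitary group of the state space. -/
abbrev ProjStateUnitary (r n m : ℕ) : Type := stateUnitary r n m ⧸ phases r n m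

/-- `u` is the operator induced on the state space by the operator `T` on skeins; this includes
that `T` preserves the labelled skeins. -/
def IsInducedBy (r n m : ℕ) (u : stateUnitary r n m)
    (T : Skein (n + m) →ₗ[ℂ] Skein (n + m)) : Prop :=
  ∀ x : labelledSkein r n m, ∃ y : labelledSkein r n m,
    (y : Skein (n + m)) = T x ∧
      u.1 (Submodule.Quotient.mk x) = (Submodule.Quotient.mk y : StateSpace r n m)

/-- `ρ` is the representation of `B_n` on `V(D_n^m)` given by `CSr` (with blackboard framing):
each half twist `σ_i` acts by gluing on the corresponding crossing. -/
def IsBraidAction (r n m : ℕ) (a : ℂ) (ρ : BraidGroup n →* stateUnitary r n m) : Prop :=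
  ∀ i : Fin (n - 1), IsInducedBy r n m (ρ (PresentedGroup.of i)) (crossing r (n + m) a i)

/-- `ρ` is the projective representation of `M(0, n + 1)` on `V(D_n^1)` given by `CSr`; here the
`n + 1` punctures of the sphere all have label `1`, and each half twist `σ_i` acts by gluing on
the corresponding crossing, up to phase. -/
def IsSphereAction (r n : ℕ) (a : ℂ) (ρ : SphereMCG (n + 1) →* ProjStateUnitary r n 1) : Prop :=
  ∀ i : Fin (n + 1 - 1), ∃ u : stateUnitary r n 1,
    IsInducedBy r n 1 u (crossing r (n + 1) a i) ∧
      ρ (PresentedGroup.of i) = (QuotientGroup.mk u : ProjStateUnitary r n 1)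

/-! ### Sectors of the Jones representation -/

/-- The quantum integer `[k] = (q^{k/2} - q^{-k/2}) / (q^{1/2} - q^{-1/2})`, which is
`sin (kπ/r) / sin (π/r)` for `q^{1/2} = exp (± πi/r)`. -/
def quantumInt (r : ℕ) (k : ℤ) : ℝ := Real.sin (k * Real.pi / r) / Real.sin (Real.pi / r)

theorem quantumInt_eq (r : ℕ) (k : ℤ) (s : ℂ)
    (hs : s = Complex.exp (Real.pi * Complex.I / r) ∨
      s = Complex.exp (-(Real.pi * Complex.I / r))) :
    (quantumInt r k : ℂ) = (s ^ k - s ^ (-k)) / (s - s⁻¹) := by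
  have key : ∀ t : ℂ, Complex.exp (Complex.I * t) - Complex.exp (-(Complex.I * t)) =
      2 * Complex.I * Complex.sin t := by
    intro t
    rw [Complex.sin]
    have := Complex.I_sq
    ring_nf
    simp only [this]
    ring_nf
  have e1 : (Real.pi * Complex.I / r : ℂ) = Complex.I * (Real.pi / r) := by ring
  have e2 : ∀ k : ℤ, (k * (Complex.I * (Real.pi / r)) : ℂ) = Complex.I * (k * Real.pi / r) := by
    intro k; ring
  have hI : (2 * Complex.I : ℂ) ≠ 0 := by simp
  have main : (quantumInt r k : ℂ) =
      (Complex.exp (Real.pi * Complex.I / r) ^ k - Complex.exp (Real.pi * Complex.I / r) ^ (-k)) /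
      (Complex.exp (Real.pi * Complex.I / r) - (Complex.exp (Real.pi * Complex.I / r))⁻¹) := by
    rw [zpow_neg, ← Complex.exp_int_mul, ← Complex.exp_neg, ← Complex.exp_neg, e1, e2, key, key,
      mul_div_mul_left _ _ hI, quantumInt]
    push_cast
    rfl
  rcases hs with rfl | rfl
  · exact main
  · rw [main, Complex.exp_neg, inv_zpow, inv_zpow, zpow_neg, inv_inv, inv_inv, ← neg_div_neg_eq, neg_sub, neg_sub]

/-- `μ` is a `(2, r)` diagram: at most two rows, and `μ_1 - μ_2 ≤ r - 2`. -/
def IsTwoRow (r : ℕ) (μ : YoungDiagram) : Prop :=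
  μ.colLen 0 ≤ 2 ∧ (μ.rowLen 0 : ℤ) - μ.rowLen 1 ≤ (r : ℤ) - 2

/-- Standard tableaux with `n` entries of shape `μ`; `cell a` is the cell containing the entry
`a + 1`, as a pair (row, column). -/
@[ext]
structure StdTableau (μ : YoungDiagram) (n : ℕ) where
  cell : Fin n ≃ {c : ℕ × ℕ // c ∈ μ.cells}
  row_lt : ∀ a b, (cell a).1.1 = (cell b).1.1 → (cell a).1.2 < (cell b).1.2 → a < b
  col_lt : ∀ a b, (cell a).1.2 = (cell b).1.2 → (cell a).1.1 < (cell b).1.1 → a < b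

/-- The cells that remain when all but the entries `1, …, k` are deleted. -/
def StdTableau.remaining {μ : YoungDiagram} {n : ℕ} (t : StdTableau μ n) (k : ℕ) :
    Finset (ℕ × ℕ) :=
  (Finset.univ.filter fun a : Fin n => (a : ℕ) < k).image fun a => (t.cell a).1

/-- `T_μ^{(2,r)}`: standard tableaux all of whose truncations have `(2, r)` diagrams as shapes. -/
def Tab (r : ℕ) (μ : YoungDiagram) (n : ℕ) : Type :=
  {t : StdTableau μ n // ∀ k ≤ n, ∃ ν : YoungDiagram, ν.cells = t.remaining k ∧ IsTwoRow r ν}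

instance (r : ℕ) (μ : YoungDiagram) (n : ℕ) : Finite (Tab r μ n) :=
  Finite.of_injective (fun t : Tab r μ n => t.1.cell)
    fun _ _ h => Subtype.ext (StdTableau.ext h)

instance (r : ℕ) (μ : YoungDiagram) (n : ℕ) : Fintype (Tab r μ n) := Fintype.ofFinite _

instance (r : ℕ) (μ : YoungDiagram) (n : ℕ) : DecidableEq (Tab r μ n) := Classical.decEq _

/-- `d_{t,i} = c_1 - c_2 - (r_1 - r_2)` for the entries in positions `a`, `b`. -/
def Tab.axial {r : ℕ} {μ : YoungDiagram} {n : ℕ} (t : Tab r μ n) (a b : Fin n) : ℤ :=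
  ((t.1.cell a).1.2 - (t.1.cell b).1.2 : ℤ) - ((t.1.cell a).1.1 - (t.1.cell b).1.1)

/-- `α_{t,i} = [d + 1] / ([2] [d])`. -/
def Tab.alpha {r : ℕ} {μ : YoungDiagram} {n : ℕ} (t : Tab r μ n) (a b : Fin n) : ℝ :=
  quantumInt r (t.axial a b + 1) / (quantumInt r 2 * quantumInt r (t.axial a b))

/-- `β_{t,i} = √(α (1 - α))`. -/
def Tab.beta {r : ℕ} {μ : YoungDiagram} {n : ℕ} (t : Tab r μ n) (a b : Fin n) : ℝ :=
  √(t.alpha a b * (1 - t.alpha a b))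

open Classical in
/-- The matrix of `π_μ^{(2,r)}(e_i)`, for consecutive entries `a`, `b`: the column of `t` is
`α v_t + β v_{g(t)}`, where `g(t)` is `t` with the two entries switched, and the second term is
absent if `g(t)` does not belong to `T_μ^{(2,r)}`. -/
def projMatrix (r : ℕ) (μ : YoungDiagram) (n : ℕ) (a b : Fin n) :
    Matrix (Tab r μ n) (Tab r μ n) ℂ :=
  Matrix.of fun s t =>
    (if s = t then (t.alpha a b : ℂ) else 0) +
      (if ∀ c, s.1.cell c = t.1.cell (Equiv.swap a b c) then (t.beta a b : ℂ) else 0)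

/-- `ρ` is the sector of the Jones representation of `B_n` at `q` for the diagram `μ`:
`σ_i ↦ q - (1 + q) e_i`. -/
def IsJonesSector (r : ℕ) (q : ℂ) (μ : YoungDiagram) (n : ℕ)
    (ρ : BraidGroup n →* Matrix.unitaryGroup (Tab r μ n) ℂ) : Prop :=
  ∀ i : Fin (n - 1), (ρ (PresentedGroup.of i) : Matrix (Tab r μ n) (Tab r μ n) ℂ) =
    q • (1 : Matrix (Tab r μ n) (Tab r μ n) ℂ) -
      (1 + q) • projMatrix r μ n ⟨i, by omega⟩ ⟨i + 1, by omega⟩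

/-- The Young diagram `[a, b]` for `b ≤ a`. -/
def twoRowDiagram (a b : ℕ) (h : b ≤ a) : YoungDiagram :=
  YoungDiagram.ofRowLens [a, b] (by
    simpa [List.sortedGE_iff_pairwise] using h)

/-- `S` is unitary from the state space to `ℂ^T` with its standard inner product. -/
def IsUnitaryIso (r n m : ℕ) {T : Type} [Fintype T] (S : StateSpace r n m ≃ₗ[ℂ] (T → ℂ)) : Prop :=
  ∀ v w, stateForm r n m v w = S v ⬝ᵥ star (S w)

end CSJones

end

namespace CSJones

theorem PlanarMatching.ext_partner {N : ℕ} {f g : PlanarMatching N}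
    (h : ∀ z, f.partner z = g.partner z) : f = g :=
  PlanarMatching.ext (Equiv.ext h)

theorem glueArc_partner {N : ℕ} (f : PlanarMatching N) (x y : Fin N) (h : (x : ℕ) + 1 = y)
    (z : Fin N) : (glueArc f x y h).partner z =
      if z = x then y else if z = y then x else if z = f.partner x then f.partner y else
        if z = f.partner y then f.partner x else f.partner z :=
  glue_apply f.partner f.invol f.noFix x y (by rintro rfl; omega) z

theorem glueArc_of_partner {N : ℕ} {f : PlanarMatching N} {x y : Fin N} (h : (x : ℕ) + 1 = y)
    (hf : f.partner x = y) : glueArc f x y h = f := by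
  have h1 := f.invol x
  refine PlanarMatching.ext_partner fun z => ?_
  rw [glueArc_partner]
  grind

theorem glueArc_partner_left {N : ℕ} (f : PlanarMatching N) (x y : Fin N) (h : (x : ℕ) + 1 = y) :
    (glueArc f x y h).partner x = y := by
  rw [glueArc_partner, if_pos rfl]

theorem glueArc_partner_right {N : ℕ} (f : PlanarMatching N) (x y : Fin N) (h : (x : ℕ) + 1 = y) :
    (glueArc f x y h).partner y = x := by
  have := (glueArc f x y h).invol x
  rwa [glueArc_partner_left] at this

/-- Gluing an arc does not affect arcs away from it. -/
theorem glueArc_partner_of_ne {N : ℕ} {f : PlanarMatching N} {x y : Fin N} (h : (x : ℕ) + 1 = y)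
    {z : Fin N} (h1 : z ≠ x) (h2 : z ≠ y) (h3 : f.partner z ≠ x) (h4 : f.partner z ≠ y) :
    (glueArc f x y h).partner z = f.partner z := by
  have := f.invol
  rw [glueArc_partner]
  grind

theorem glueArc_glueArc_succ {N : ℕ} {f : PlanarMatching N} {x y z : Fin N} (h : (x : ℕ) + 1 = y)
    (h' : (y : ℕ) + 1 = z) (hf : f.partner x = y) :
    glueArc (glueArc f y z h') x y h = f := by
  have h1 := f.invol
  have h2 := f.noFix
  have e1 : x ≠ y := by rintro rfl; omega
  have e2 : y ≠ z := by rintro rfl; omega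
  have e3 : x ≠ z := by rintro rfl; omega
  refine PlanarMatching.ext_partner fun w => ?_
  have h3 := h1 x
  have h4 := h1 z
  have h5 := h2 z
  have h6 := h1 w
  rw [glueArc_partner]
  simp only [glueArc_partner]
  grind

theorem glueArc_glueArc_pred {N : ℕ} {f : PlanarMatching N} {x y z : Fin N} (h : (x : ℕ) + 1 = y)
    (h' : (z : ℕ) + 1 = x) (hf : f.partner x = y) :
    glueArc (glueArc f z x h') x y h = f := by
  have h1 := f.invol
  have h2 := f.noFix
  have e1 : x ≠ y := by rintro rfl; omega
  have e2 : z ≠ x := by rintro rfl; omega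
  have e3 : z ≠ y := by rintro rfl; omega
  refine PlanarMatching.ext_partner fun w => ?_
  have h3 := h1 x
  have h4 := h1 z
  have h5 := h2 z
  have h6 := h1 w
  rw [glueArc_partner]
  simp only [glueArc_partner]
  grind

theorem glueArc_comm {N : ℕ} (f : PlanarMatching N) {x y x' y' : Fin N} (h : (x : ℕ) + 1 = y)
    (h' : (x' : ℕ) + 1 = y') (hd : (y : ℕ) < x') :
    glueArc (glueArc f x y h) x' y' h' = glueArc (glueArc f x' y' h') x y h := by
  have e1 : x ≠ y := by rintro rfl; omega
  have e2 : x' ≠ y' := by rintro rfl; omega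
  have e3 : x ≠ x' := by rintro rfl; omega
  have e4 : x ≠ y' := by rintro rfl; omega
  have e5 : y ≠ x' := by rintro rfl; omega
  have e6 : y ≠ y' := by rintro rfl; omega
  refine PlanarMatching.ext_partner fun w => ?_
  have i1 := f.invol x
  have i2 := f.invol y
  have i3 := f.invol x'
  have i4 := f.invol y'
  have i5 := f.invol w
  have n1 := f.noFix x
  have n2 := f.noFix y
  have n3 := f.noFix x'
  have n4 := f.noFix y'
  rw [glueArc_partner (glueArc f x y h), glueArc_partner (glueArc f x' y' h')]
  have px' : (glueArc f x y h).partner x' = if x' = f.partner x then f.partner y else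
      if x' = f.partner y then f.partner x else f.partner x' := by
    rw [glueArc_partner, if_neg e3.symm, if_neg e5.symm]
  have py' : (glueArc f x y h).partner y' = if y' = f.partner x then f.partner y else
      if y' = f.partner y then f.partner x else f.partner y' := by
    rw [glueArc_partner, if_neg e4.symm, if_neg e6.symm]
  have px : (glueArc f x' y' h').partner x = if x = f.partner x' then f.partner y' else
      if x = f.partner y' then f.partner x' else f.partner x := by
    rw [glueArc_partner, if_neg e3, if_neg e4]
  have py : (glueArc f x' y' h').partner y = if y = f.partner x' then f.partner y' else
      if y = f.partner y' then f.partner x' else f.partner y := by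
    rw [glueArc_partner, if_neg e5, if_neg e6]
  rw [px, py, px', py', glueArc_partner f, glueArc_partner f]
  by_cases c1 : f.partner x = x' <;> by_cases c2 : f.partner y = x' <;>
    by_cases c3 : f.partner x = y' <;> by_cases c4 : f.partner y = y' <;> grind (splits := 20)

/-- The factor created by gluing `∪∩` to `f` at `x`, `y`. -/
noncomputable def arcWeight (r : ℕ) {N : ℕ} (f : PlanarMatching N) (x y : Fin N) : ℂ :=
  if f.partner x = y then loopValue r else 1

theorem arcWeight_comm (r : ℕ) {N : ℕ} (f : PlanarMatching N) {x y x' y' : Fin N}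
    (h : (x : ℕ) + 1 = y) (h' : (x' : ℕ) + 1 = y') (hd : (y : ℕ) < x') :
    arcWeight r f x y * arcWeight r (glueArc f x y h) x' y' =
      arcWeight r f x' y' * arcWeight r (glueArc f x' y' h') x y := by
  have e1 : x ≠ y := by rintro rfl; omega
  have e2 : x' ≠ y' := by rintro rfl; omega
  have e3 : x ≠ x' := by rintro rfl; omega
  have e4 : x ≠ y' := by rintro rfl; omega
  have e5 : y ≠ x' := by rintro rfl; omega
  have e6 : y ≠ y' := by rintro rfl; omega
  have i1 := f.invol x
  have i2 := f.invol y
  have i3 := f.invol x'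
  have i4 := f.invol y'
  simp only [arcWeight, glueArc_partner]
  grind

theorem cupCap_single (r N : ℕ) (f : PlanarMatching N) (x y : Fin N) (h : (x : ℕ) + 1 = y) :
    cupCap r N x (Pi.single f 1) = arcWeight r f x y • Pi.single (glueArc f x y h) (1 : ℂ) := by
  have hx : (x : ℕ) + 1 < N := by omega
  obtain rfl : y = ⟨x + 1, hx⟩ := Fin.ext h.symm
  rw [cupCap, dif_pos hx, Fintype.linearCombination_apply_single, one_smul]
  rfl

theorem skein_hom_ext {N : ℕ} {V : Type*} [AddCommMonoid V] [Module ℂ V] {S T : Skein N →ₗ[ℂ] V}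
    (h : ∀ f : PlanarMatching N, S (Pi.single f 1) = T (Pi.single f 1)) : S = T := by
  refine LinearMap.pi_ext' fun f => LinearMap.ext_ring ?_
  simpa using h f

theorem cupCap_mul_self (r N j : ℕ) :
    cupCap r N j * cupCap r N j = loopValue r • cupCap r N j := by
  by_cases hj : j + 1 < N
  · refine skein_hom_ext fun f => ?_
    have key := fun f => cupCap_single r N f ⟨j, by omega⟩ ⟨j + 1, hj⟩ rfl
    simp only at key
    rw [Module.End.mul_apply, key, map_smul, key, LinearMap.smul_apply, key, smul_smul, smul_smul,
      glueArc_of_partner rfl (glueArc_partner_left _ _ _ _), mul_comm]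
    congr 2
    rw [arcWeight, if_pos (glueArc_partner_left _ _ _ _)]
  · simp [cupCap, hj]

theorem cupCap_succ (r N j : ℕ) (hj : j + 2 < N) :
    cupCap r N j * cupCap r N (j + 1) * cupCap r N j = cupCap r N j := by
  refine skein_hom_ext fun f => ?_
  have key := fun f => cupCap_single r N f ⟨j, by omega⟩ ⟨j + 1, by omega⟩ rfl
  have key' := fun f => cupCap_single r N f ⟨j + 1, by omega⟩ ⟨j + 2, by omega⟩ rfl
  simp only at key key'
  rw [Module.End.mul_apply, Module.End.mul_apply, key, map_smul, key', map_smul, map_smul, key,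
    glueArc_glueArc_succ _ _ (glueArc_partner_left _ _ _ _)]
  have h1 : arcWeight r (glueArc f ⟨j, by omega⟩ ⟨j + 1, by omega⟩ rfl)
      ⟨j + 1, by omega⟩ ⟨j + 2, by omega⟩ = 1 := by
    rw [arcWeight, if_neg]
    rw [glueArc_partner_right]
    simp
  have h2 : ∀ g : PlanarMatching N, arcWeight r (glueArc g ⟨j + 1, by omega⟩ ⟨j + 2, by omega⟩ rfl)
      ⟨j, by omega⟩ ⟨j + 1, by omega⟩ = 1 := by
    intro g
    rw [arcWeight, if_neg]
    intro h
    have := congrArg (glueArc g ⟨j + 1, by omega⟩ ⟨j + 2, by omega⟩ rfl).partner h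
    rw [PlanarMatching.invol, glueArc_partner_left] at this
    simp at this
  rw [h1, h2, one_smul, one_smul]

theorem cupCap_pred (r N j : ℕ) (hj : j + 2 < N) :
    cupCap r N (j + 1) * cupCap r N j * cupCap r N (j + 1) = cupCap r N (j + 1) := by
  refine skein_hom_ext fun f => ?_
  have key := fun f => cupCap_single r N f ⟨j, by omega⟩ ⟨j + 1, by omega⟩ rfl
  have key' := fun f => cupCap_single r N f ⟨j + 1, by omega⟩ ⟨j + 2, by omega⟩ rfl
  simp only at key key'
  rw [Module.End.mul_apply, Module.End.mul_apply, key', map_smul, key, map_smul, map_smul, key',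
    glueArc_glueArc_pred _ _ (glueArc_partner_left _ _ _ _)]
  have h1 : ∀ g : PlanarMatching N, arcWeight r (glueArc g ⟨j, by omega⟩ ⟨j + 1, by omega⟩ rfl)
      ⟨j + 1, by omega⟩ ⟨j + 2, by omega⟩ = 1 := by
    intro g
    rw [arcWeight, if_neg]
    rw [glueArc_partner_right]
    simp
  have h2 : arcWeight r (glueArc f ⟨j + 1, by omega⟩ ⟨j + 2, by omega⟩ rfl)
      ⟨j, by omega⟩ ⟨j + 1, by omega⟩ = 1 := by
    rw [arcWeight, if_neg]
    intro h
    have := congrArg (glueArc f ⟨j + 1, by omega⟩ ⟨j + 2, by omega⟩ rfl).partner h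
    rw [PlanarMatching.invol, glueArc_partner_left] at this
    simp at this
  rw [h1, h2, one_smul, one_smul]

theorem cupCap_commute (r N : ℕ) {i j : ℕ} (hij : i + 1 < j) :
    Commute (cupCap r N i) (cupCap r N j) := by
  by_cases hj : j + 1 < N
  · refine skein_hom_ext fun f => ?_
    have key := fun f => cupCap_single r N f ⟨i, by omega⟩ ⟨i + 1, by omega⟩ rfl
    have key' := fun f => cupCap_single r N f ⟨j, by omega⟩ ⟨j + 1, by omega⟩ rfl
    simp only at key key'
    rw [Module.End.mul_apply, Module.End.mul_apply, key', map_smul, key, key, map_smul, key', smul_smul,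
      smul_smul, arcWeight_comm r f (x := ⟨i, by omega⟩) (x' := ⟨j, by omega⟩) rfl rfl hij,
      glueArc_comm f (x := ⟨i, by omega⟩) (x' := ⟨j, by omega⟩) rfl rfl hij]
  · have : cupCap r N j = 0 := by simp [cupCap, hj]
    rw [this]
    exact Commute.zero_right _

/-! ### Loop counts and adjointness -/

/-- Two boundary points lie on the same loop of the glued diagram. -/
def SameLoop {N : ℕ} (f g : PlanarMatching N) : Fin N → Fin N → Prop :=
  Relation.EqvGen fun x y : Fin N => f.partner x = y ∨ g.partner x = y

theorem SameLoop.left {N : ℕ} (f g : PlanarMatching N) (z : Fin N) :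
    SameLoop f g z (f.partner z) := .rel _ _ (Or.inl rfl)

theorem SameLoop.right {N : ℕ} (f g : PlanarMatching N) (z : Fin N) :
    SameLoop f g z (g.partner z) := .rel _ _ (Or.inr rfl)

theorem SameLoop.refl {N : ℕ} (f g : PlanarMatching N) (z : Fin N) : SameLoop f g z z :=
  Relation.EqvGen.refl _

theorem SameLoop.symm {N : ℕ} {f g : PlanarMatching N} {z w : Fin N} (h : SameLoop f g z w) :
    SameLoop f g w z := Relation.EqvGen.symm _ _ h

theorem SameLoop.trans {N : ℕ} {f g : PlanarMatching N} {z w v : Fin N} (h : SameLoop f g z w)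
    (h' : SameLoop f g w v) : SameLoop f g z v := Relation.EqvGen.trans _ _ _ h h'

theorem sameLoop_comm {N : ℕ} {f g : PlanarMatching N} : SameLoop f g = SameLoop g f := by
  unfold SameLoop
  simp only [or_comm]

/-- Move the points `x`, `y` to `p`. -/
def movePair {N : ℕ} (x y p z : Fin N) : Fin N := if z = x ∨ z = y then p else z

theorem movePair_of_ne {N : ℕ} {x y p z : Fin N} (h1 : z ≠ x) (h2 : z ≠ y) :
    movePair x y p z = z := by
  rw [movePair, if_neg (by tauto)]

theorem movePair_left {N : ℕ} (x y p : Fin N) : movePair x y p x = p := if_pos (Or.inl rfl)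

theorem movePair_right {N : ℕ} (x y p : Fin N) : movePair x y p y = p := if_pos (Or.inr rfl)

theorem PlanarMatching.partner_eq_comm {N : ℕ} (f : PlanarMatching N) {z w : Fin N} :
    f.partner z = w ↔ f.partner w = z :=
  ⟨fun h => by rw [← h, f.invol], fun h => by rw [← h, f.invol]⟩

theorem sameLoop_movePair_right {N : ℕ} (f g : PlanarMatching N) {x y : Fin N}
    (h : (x : ℕ) + 1 = y) (hg : g.partner x ≠ y) (z : Fin N) :
    SameLoop f (glueArc g x y h) (movePair x y (g.partner x) z)
      (movePair x y (g.partner x) (g.partner z)) := by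
  have hg' : g.partner y ≠ x := fun e => hg (g.partner_eq_comm.1 e)
  have hxy : SameLoop f (glueArc g x y h) (g.partner x) (g.partner y) := by
    have := SameLoop.right f (glueArc g x y h) (g.partner x)
    rwa [glueArc_partner, if_neg (g.noFix x), if_neg hg, if_pos rfl] at this
  by_cases zx : z = x
  · rw [zx, movePair_left, movePair_of_ne (g.noFix x) hg]
    exact .refl ..
  by_cases zy : z = y
  · rw [zy, movePair_right, movePair_of_ne hg' (g.noFix y)]
    exact hxy
  rw [movePair_of_ne zx zy]
  by_cases gx : g.partner z = x
  · rw [gx, movePair_left, g.partner_eq_comm.1 gx]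
    exact .refl ..
  by_cases gy : g.partner z = y
  · rw [gy, movePair_right, ← g.partner_eq_comm.1 gy]
    exact hxy.symm
  rw [movePair_of_ne gx gy]
  have := SameLoop.right f (glueArc g x y h) z
  rwa [glueArc_partner_of_ne h zx zy gx gy] at this

theorem sameLoop_movePair_left {N : ℕ} (f g : PlanarMatching N) {x y : Fin N}
    (h : (x : ℕ) + 1 = y) (hf : f.partner x ≠ y) (p : Fin N) (z : Fin N) :
    SameLoop f (glueArc g x y h) (movePair x y p z)
      (movePair x y p ((glueArc f x y h).partner z)) := by
  have hf' : f.partner y ≠ x := fun e => hf (f.partner_eq_comm.1 e)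
  have hxy : SameLoop f (glueArc g x y h) (f.partner x) (f.partner y) := by
    refine (SameLoop.left _ _ _).symm.trans (.trans ?_ (SameLoop.left _ _ _))
    have := SameLoop.right f (glueArc g x y h) x
    rwa [glueArc_partner_left] at this
  by_cases zx : z = x
  · rw [zx, glueArc_partner_left, movePair_left, movePair_right]
    exact .refl ..
  by_cases zy : z = y
  · rw [zy, glueArc_partner_right, movePair_left, movePair_right]
    exact .refl ..
  rw [movePair_of_ne zx zy, glueArc_partner, if_neg zx, if_neg zy]
  split_ifs with h1 h2
  · rw [h1, movePair_of_ne hf' (f.noFix y)]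
    exact hxy
  · rw [h2, movePair_of_ne (f.noFix x) hf]
    exact hxy.symm
  · rw [movePair_of_ne (fun e => h1 (f.partner_eq_comm.1 e).symm)
      (fun e => h2 (f.partner_eq_comm.1 e).symm)]
    exact .left ..

theorem SameLoop.of_generators {N : ℕ} {f g f' g' : PlanarMatching N} {φ : Fin N → Fin N}
    (h1 : ∀ z, SameLoop f' g' (φ z) (φ (f.partner z)))
    (h2 : ∀ z, SameLoop f' g' (φ z) (φ (g.partner z))) {z w : Fin N} (h : SameLoop f g z w) :
    SameLoop f' g' (φ z) (φ w) := by
  induction h with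
  | rel a b hab => rcases hab with rfl | rfl; exacts [h1 _, h2 _]
  | refl a => exact .refl ..
  | symm a b _ ih => exact ih.symm
  | trans a b c _ _ ih ih' => exact ih.trans ih'

theorem sameLoop_movePair {N : ℕ} (f g : PlanarMatching N) {x y : Fin N}
    (h : (x : ℕ) + 1 = y) (hf : f.partner x ≠ y) (hg : g.partner x ≠ y) {z w : Fin N}
    (hzw : SameLoop (glueArc f x y h) g z w) :
    SameLoop f (glueArc g x y h) (movePair x y (g.partner x) z)
      (movePair x y (g.partner x) w) :=
  hzw.of_generators (sameLoop_movePair_left f g h hf _) (sameLoop_movePair_right f g h hg)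

theorem movePair_movePair {N : ℕ} (f g : PlanarMatching N) {x y : Fin N}
    (h : (x : ℕ) + 1 = y) (hg : g.partner x ≠ y) (p z : Fin N) :
    SameLoop (glueArc f x y h) g (movePair x y p (movePair x y (g.partner x) z)) z := by
  have hx : SameLoop (glueArc f x y h) g (g.partner x) x := (SameLoop.right _ _ _).symm
  have hxy : SameLoop (glueArc f x y h) g x y := by
    have := SameLoop.left (glueArc f x y h) g x
    rwa [glueArc_partner_left] at this
  by_cases zx : z = x
  · rw [zx, movePair_left, movePair_of_ne (g.noFix x) hg]
    exact hx
  by_cases zy : z = y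
  · rw [zy, movePair_right, movePair_of_ne (g.noFix x) hg]
    exact hx.trans hxy
  rw [movePair_of_ne zx zy, movePair_of_ne zx zy]
  exact .refl ..

theorem loops_glueArc_comm {N : ℕ} (f g : PlanarMatching N) {x y : Fin N}
    (h : (x : ℕ) + 1 = y) (hf : f.partner x ≠ y) (hg : g.partner x ≠ y) :
    loops (glueArc f x y h) g = loops f (glueArc g x y h) := by
  refine Nat.card_congr ⟨Quotient.map (movePair x y (g.partner x)) fun z w hzw =>
      sameLoop_movePair f g h hf hg hzw,
    Quotient.map (movePair x y (f.partner x)) fun z w hzw => ?_, ?_, ?_⟩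
  · have hzw' : SameLoop f (glueArc g x y h) z w := hzw
    rw [sameLoop_comm] at hzw'
    have := sameLoop_movePair g f h hg hf hzw'
    rwa [sameLoop_comm] at this
  · intro q
    induction q using Quotient.inductionOn with
    | h z => exact Quotient.sound (movePair_movePair f g h hg _ z)
  · intro q
    induction q using Quotient.inductionOn with
    | h z =>
      refine Quotient.sound ?_
      have := movePair_movePair g f h hf (g.partner x) z
      rwa [sameLoop_comm] at this

open Classical in
theorem loops_glueArc_of_partner {N : ℕ} (f g : PlanarMatching N) {x y : Fin N}
    (h : (x : ℕ) + 1 = y) (hf : f.partner x = y) (hg : g.partner x ≠ y) :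
    loops f (glueArc g x y h) = loops f g + 1 := by
  have hf' : f.partner y = x := f.partner_eq_comm.1 hf
  have fne : ∀ z, z ≠ x → z ≠ y → f.partner z ≠ x ∧ f.partner z ≠ y := fun z h1 h2 =>
    ⟨fun e => h2 ((f.partner_eq_comm.1 e).symm.trans hf),
      fun e => h1 ((f.partner_eq_comm.1 e).symm.trans hf')⟩
  rw [loops, loops, ← Finite.card_option]
  refine Nat.card_congr ⟨Quotient.lift (fun z => if z = x ∨ z = y then none else
      some (Quotient.mk _ z)) ?_, fun o => o.elim (Quotient.mk _ x)
        (Quotient.map (movePair x y (g.partner x)) ?_), ?_, ?_⟩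
  · intro z w hzw
    change SameLoop _ _ z w at hzw
    induction hzw with
    | refl a => rfl
    | symm a b _ ih => exact ih.symm
    | trans a b c _ _ ih ih' => exact ih.trans ih'
    | rel a b hab =>
      rcases hab with rfl | rfl
      · by_cases ax : a = x
        · simp [ax, hf]
        by_cases ay : a = y
        · simp [ay, hf']
        simp only [ax, ay, fne a ax ay, or_self, if_false]
        exact congrArg some (Quotient.sound (SameLoop.left f g a))
      · have hxy : SameLoop f g (g.partner x) (g.partner y) := by
          refine (SameLoop.right f g x).symm.trans (.trans ?_ (SameLoop.right f g y))
          have := SameLoop.left f g x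
          rwa [hf] at this
        have hg' : g.partner y ≠ x := fun e => hg (g.partner_eq_comm.1 e)
        by_cases ax : a = x
        · simp [ax, glueArc_partner_left]
        by_cases ay : a = y
        · simp [ay, glueArc_partner_right]
        rw [glueArc_partner, if_neg ax, if_neg ay]
        simp only [ax, ay, or_self, if_false]
        split_ifs with h1 h2 h3 h4 h5
        · simp [hg', g.noFix] at h2
        · exact congrArg some (Quotient.sound (h1 ▸ hxy))
        · simp [hg, g.noFix] at h4
        · exact congrArg some (Quotient.sound (h3 ▸ hxy.symm))
        · exfalso
          rcases h5 with h5 | h5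
          · exact h1 (g.partner_eq_comm.1 h5).symm
          · exact h3 (g.partner_eq_comm.1 h5).symm
        · exact congrArg some (Quotient.sound (SameLoop.right f g a))
  · intro z w hzw
    refine SameLoop.of_generators (f := f) (g := g) (fun z => ?_)
      (sameLoop_movePair_right f g h hg) hzw
    by_cases zx : z = x
    · rw [zx, hf, movePair_left, movePair_right]
      exact .refl ..
    by_cases zy : z = y
    · rw [zy, hf', movePair_left, movePair_right]
      exact .refl ..
    rw [movePair_of_ne zx zy, movePair_of_ne (fne z zx zy).1 (fne z zx zy).2]
    exact .left ..
  · intro q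
    induction q using Quotient.inductionOn with
    | h z =>
      by_cases zx : z = x
      · simp [zx]
      by_cases zy : z = y
      · subst zy
        simp only [Quotient.lift_mk, or_true, if_true, Option.elim]
        refine Quotient.sound ?_
        have := SameLoop.left f (glueArc g x z h) x
        rwa [hf] at this
      simp only [Quotient.lift_mk, zx, zy, or_self, if_false, Option.elim]
      exact congrArg (Quotient.mk _) (movePair_of_ne zx zy)
  · intro o
    rcases o with _ | q
    · simp
    induction q using Quotient.inductionOn with
    | h z =>
      have key : SameLoop f g (movePair x y (g.partner x) z) z := by
        by_cases zx : z = x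
        · rw [zx, movePair_left]; exact (SameLoop.right f g x).symm
        by_cases zy : z = y
        · rw [zy, movePair_right]
          refine (SameLoop.right f g x).symm.trans ?_
          have := SameLoop.left f g x
          rwa [hf] at this
        rw [movePair_of_ne zx zy]
        exact .refl ..
      refine (if_neg ?_).trans (congrArg some (Quotient.sound key))
      rw [movePair]
      split_ifs with hz
      · simp [hg, g.noFix]
      · exact hz

/-- The bracket form as a linear functional of its first argument. -/
noncomputable def bracketFunctional (r : ℕ) {N : ℕ} (y : Skein N) : Skein N →ₗ[ℂ] ℂ where
  toFun x := bracketForm r x y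
  map_add' x x' := bracketForm_add_left r x x' y
  map_smul' c x := bracketForm_smul_left r c x y

theorem bracketForm_single (r : ℕ) {N : ℕ} (f g : PlanarMatching N) :
    bracketForm r (Pi.single f 1) (Pi.single g 1) = loopValue r ^ loops f g := by
  rw [bracketForm, Finset.sum_eq_single f, Finset.sum_eq_single g]
  · simp
  · intro b _ hb; simp [hb]
  · simp
  · intro b _ hb; simp [Pi.single_apply, hb]
  · simp

theorem bracketForm_add_right (r : ℕ) {N : ℕ} (x y y' : Skein N) :
    bracketForm r x (y + y') = bracketForm r x y + bracketForm r x y' := by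
  rw [← bracketForm_conj, bracketForm_add_left, map_add, bracketForm_conj, bracketForm_conj]

theorem bracketForm_smul_right (r : ℕ) {N : ℕ} (c : ℂ) (x y : Skein N) :
    bracketForm r x (c • y) = conj c * bracketForm r x y := by
  rw [← bracketForm_conj, bracketForm_smul_left, map_mul, bracketForm_conj]

/-- Adjointness with respect to the bracket form may be checked on matchings. -/
theorem bracketForm_adjoint_of_single (r : ℕ) {N : ℕ} {S T : Skein N →ₗ[ℂ] Skein N}
    (h : ∀ f g : PlanarMatching N, bracketForm r (S (Pi.single f 1)) (Pi.single g 1) =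
      bracketForm r (Pi.single f 1) (T (Pi.single g 1))) (x y : Skein N) :
    bracketForm r (S x) y = bracketForm r x (T y) := by
  have h1 : ∀ g : PlanarMatching N, ∀ x, bracketForm r (S x) (Pi.single g 1) =
      bracketForm r x (T (Pi.single g 1)) := fun g x =>
    LinearMap.congr_fun (skein_hom_ext (S := bracketFunctional r (Pi.single g 1) ∘ₗ S)
      (T := bracketFunctional r (T (Pi.single g 1))) fun f => h f g) x
  have h2 : bracketFunctional r (S x) = bracketFunctional r x ∘ₗ T :=
    skein_hom_ext fun g => by
      have := congrArg conj (h1 g x)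
      rwa [bracketForm_conj, bracketForm_conj] at this
  have := congrArg conj (LinearMap.congr_fun h2 y)
  change conj (bracketForm r y (S x)) = conj (bracketForm r (T y) x) at this
  rwa [bracketForm_conj, bracketForm_conj] at this

theorem conj_arcWeight (r : ℕ) {N : ℕ} (f : PlanarMatching N) (x y : Fin N) :
    conj (arcWeight r f x y) = arcWeight r f x y := by
  rw [arcWeight]
  split_ifs
  · exact conj_loopValue r
  · exact map_one _

theorem arcWeight_mul_loops (r : ℕ) {N : ℕ} (f g : PlanarMatching N) {x y : Fin N}
    (h : (x : ℕ) + 1 = y) :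
    arcWeight r f x y * loopValue r ^ loops (glueArc f x y h) g =
      arcWeight r g x y * loopValue r ^ loops f (glueArc g x y h) := by
  rw [arcWeight, arcWeight]
  split_ifs with hf hg hg
  · rw [glueArc_of_partner h hf, glueArc_of_partner h hg]
  · rw [glueArc_of_partner h hf, loops_glueArc_of_partner f g h hf hg, pow_succ', one_mul]
  · rw [glueArc_of_partner h hg, loops_comm, loops_glueArc_of_partner g f h hg hf, pow_succ',
      one_mul, loops_comm]
  · rw [loops_glueArc_comm f g h hf hg]

theorem bracketForm_cupCap (r N j : ℕ) (x y : Skein N) :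
    bracketForm r (cupCap r N j x) y = bracketForm r x (cupCap r N j y) := by
  by_cases hj : j + 1 < N
  · refine bracketForm_adjoint_of_single r (fun f g => ?_) x y
    have key := fun f => cupCap_single r N f ⟨j, by omega⟩ ⟨j + 1, hj⟩ rfl
    simp only at key
    rw [key, key, bracketForm_smul_left, bracketForm_smul_right, bracketForm_single,
      bracketForm_single, conj_arcWeight, arcWeight_mul_loops]
  · simp [cupCap, hj, bracketForm]

/-! ### Quantum integers -/

theorem sin_pi_div_pos {r : ℕ} (hr : 2 ≤ r) : 0 < Real.sin (Real.pi / r) := by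
  have h2 : (2 : ℝ) ≤ r := by exact_mod_cast hr
  refine Real.sin_pos_of_pos_of_lt_pi (by positivity) ?_
  rw [div_lt_iff₀ (by linarith)]
  nlinarith [Real.pi_pos]

theorem quantumInt_zero (r : ℕ) : quantumInt r 0 = 0 := by simp [quantumInt]

theorem quantumInt_one {r : ℕ} (hr : 2 ≤ r) : quantumInt r 1 = 1 := by
  rw [quantumInt, Int.cast_one, one_mul, div_self (sin_pi_div_pos hr).ne']

theorem quantumInt_self {r : ℕ} (hr : 2 ≤ r) : quantumInt r r = 0 := by
  have : (r : ℝ) ≠ 0 := by positivity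
  rw [quantumInt, Int.cast_natCast, mul_div_cancel_left₀ _ this, Real.sin_pi, zero_div]

theorem quantumInt_neg (r : ℕ) (k : ℤ) : quantumInt r (-k) = -quantumInt r k := by
  rw [quantumInt, quantumInt, Int.cast_neg, neg_mul, neg_div, Real.sin_neg, neg_div]

theorem quantumInt_pos {r : ℕ} (hr : 2 ≤ r) {k : ℤ} (h0 : 0 < k) (hk : k < r) :
    0 < quantumInt r k := by
  have hr' : (0 : ℝ) < r := by positivity
  have h0' : (0 : ℝ) < k := by exact_mod_cast h0
  have hk' : (k : ℝ) < r := by exact_mod_cast hk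
  refine div_pos (Real.sin_pos_of_pos_of_lt_pi (by positivity) ?_) (sin_pi_div_pos hr)
  rw [div_lt_iff₀ hr', mul_comm]
  exact mul_lt_mul_of_pos_left hk' Real.pi_pos

theorem quantumInt_two {r : ℕ} (hr : 2 ≤ r) : quantumInt r 2 = 2 * Real.cos (Real.pi / r) := by
  rw [quantumInt, Int.cast_ofNat, mul_div_assoc, Real.sin_two_mul, mul_right_comm,
    mul_div_cancel_right₀ _ (sin_pi_div_pos hr).ne']

theorem quantumInt_two_mul {r : ℕ} (hr : 2 ≤ r) (k : ℤ) :
    quantumInt r 2 * quantumInt r k = quantumInt r (k + 1) + quantumInt r (k - 1) := by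
  rw [quantumInt_two hr, quantumInt, quantumInt, quantumInt, ← add_div, ← mul_div_assoc]
  congr 1
  push_cast
  rw [show ((k : ℝ) + 1) * Real.pi / r = k * Real.pi / r + Real.pi / r by ring,
    show ((k : ℝ) - 1) * Real.pi / r = k * Real.pi / r - Real.pi / r by ring,
    Real.sin_add, Real.sin_sub]
  ring

theorem kauffmanA_sq (r : ℕ) :
    kauffmanA r ^ 2 = -Complex.exp (-(Real.pi / r * Complex.I)) := by
  rw [kauffmanA, mul_pow, Complex.I_sq, neg_one_mul, ← Complex.exp_nat_mul]
  congr 2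
  by_cases hr : (r : ℂ) = 0
  · simp [hr]
  · field_simp
    norm_num

theorem kauffmanA_ne_zero (r : ℕ) : kauffmanA r ≠ 0 := by simp [kauffmanA]

theorem loopValue_eq {r : ℕ} (hr : 2 ≤ r) : loopValue r = (quantumInt r 2 : ℂ) := by
  rw [quantumInt_two hr, loopValue, inv_pow, kauffmanA_sq, inv_neg, ← Complex.exp_neg, neg_neg,
    Complex.ofReal_mul, Complex.ofReal_ofNat, Complex.ofReal_cos, Complex.two_cos, neg_neg,
    sub_neg_eq_add, add_comm]
  push_cast
  ring_nf

theorem loopValue_ne_zero {r : ℕ} (hr : 3 ≤ r) : loopValue r ≠ 0 := by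
  rw [loopValue_eq (by omega)]
  exact_mod_cast (quantumInt_pos (r := r) (k := 2) (by omega) (by norm_num) (by omega)).ne'

theorem chebyshevDelta_eq {r : ℕ} (hr : 2 ≤ r) (k : ℕ) :
    chebyshevDelta r k = (quantumInt r (k + 1) : ℂ) := by
  have key : ∀ k : ℕ, chebyshevDelta r k = (quantumInt r (k + 1) : ℂ) ∧
      chebyshevDelta r (k + 1) = (quantumInt r (k + 2) : ℂ) := by
    intro k
    induction k with
    | zero => simp [chebyshevDelta, quantumInt_one hr, loopValue_eq hr]
    | succ k ih =>
      refine ⟨by rw [ih.2]; push_cast; ring_nf, ?_⟩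
      rw [chebyshevDelta, ih.1, ih.2, loopValue_eq hr, sub_eq_iff_eq_add]
      have := quantumInt_two_mul hr (k + 2 : ℤ)
      rw [show (k + 2 + 1 : ℤ) = ((k + 1 : ℕ) : ℤ) + 2 by push_cast; ring,
        show (k + 2 - 1 : ℤ) = k + 1 by ring] at this
      exact_mod_cast this
  exact (key k).1

theorem chebyshevDelta_ne_zero {r k : ℕ} (hk : k + 2 ≤ r) : chebyshevDelta r k ≠ 0 := by
  rw [chebyshevDelta_eq (by omega)]
  exact_mod_cast (quantumInt_pos (r := r) (k := k + 1) (by omega) (by omega) (by omega)).ne'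

/-! ### Jones-Wenzl idempotents -/

theorem jonesWenzl_succ (r N s k : ℕ) : jonesWenzl r N s (k + 2) = jonesWenzl r N s (k + 1) -
    (chebyshevDelta r k / chebyshevDelta r (k + 1)) •
      (jonesWenzl r N s (k + 1) * cupCap r N (s + k) * jonesWenzl r N s (k + 1)) := rfl

theorem commute_jonesWenzl (r N s : ℕ) {T : Module.End ℂ (Skein N)} :
    ∀ k, (∀ l, l + 1 < k → Commute T (cupCap r N (s + l))) → Commute T (jonesWenzl r N s k)
  | 0, _ => Commute.one_right _
  | 1, _ => Commute.one_right _
  | k + 2, h => by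
    have ih := commute_jonesWenzl r N s (T := T) (k + 1) fun l hl => h l (by omega)
    rw [jonesWenzl_succ]
    exact ih.sub_right (((ih.mul_right (h k (by omega))).mul_right ih).smul_right _)

theorem jonesWenzl_induction {r : ℕ} (N s : ℕ) : ∀ j, j + 2 ≤ r → s + j < N →
    jonesWenzl r N s (j + 1) * jonesWenzl r N s (j + 1) = jonesWenzl r N s (j + 1) ∧
    jonesWenzl r N s j * jonesWenzl r N s (j + 1) = jonesWenzl r N s (j + 1) ∧
    (∀ l < j, cupCap r N (s + l) * jonesWenzl r N s (j + 1) = 0) ∧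
    (s + j + 1 < N → cupCap r N (s + j) * jonesWenzl r N s (j + 1) * cupCap r N (s + j) =
      (chebyshevDelta r (j + 1) / chebyshevDelta r j) •
        (cupCap r N (s + j) * jonesWenzl r N s j))
  | 0, hj, _ => by
    refine ⟨rfl, rfl, fun l hl => absurd hl (Nat.not_lt_zero l), fun _ => ?_⟩
    have : chebyshevDelta r (0 + 1) / chebyshevDelta r 0 = loopValue r := by
      simp [chebyshevDelta]
    rw [this]
    exact cupCap_mul_self r N (s + 0)
  | j + 1, hj, hN => by
    obtain ⟨h1, h2, h3, h4⟩ := jonesWenzl_induction (r := r) N s j (by omega) (by omega)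
    specialize h4 hN
    have d0 := chebyshevDelta_ne_zero (r := r) (k := j) (by omega)
    have d1 := chebyshevDelta_ne_zero (r := r) (k := j + 1) (by omega)
    have hrec := jonesWenzl_succ r N s j
    have hcomm : s + (j + 1) + 1 < N →
        cupCap r N (s + (j + 1)) * jonesWenzl r N s (j + 1) =
          jonesWenzl r N s (j + 1) * cupCap r N (s + (j + 1)) := fun _ =>
      commute_jonesWenzl r N s (j + 1) fun l hl => (cupCap_commute r N (by omega)).symm
    have hsq := cupCap_mul_self r N (s + (j + 1))
    have htl : s + (j + 1) + 1 < N → cupCap r N (s + (j + 1)) * cupCap r N (s + j) *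
        cupCap r N (s + (j + 1)) = cupCap r N (s + (j + 1)) := fun h =>
      cupCap_pred r N (s + j) (by omega)
    have hd : chebyshevDelta r (j + 2) =
      loopValue r * chebyshevDelta r (j + 1) - chebyshevDelta r j := rfl
    generalize jonesWenzl r N s (j + 1 + 1) = p' at *
    generalize jonesWenzl r N s (j + 1) = p at *
    generalize jonesWenzl r N s j = p₀ at *
    generalize cupCap r N (s + (j + 1)) = V at *
    have k1 : p * p' = p' := by
      rw [hrec, mul_sub, mul_smul_comm, ← mul_assoc, ← mul_assoc, h1]
    have k2 : cupCap r N (s + j) * p' = 0 := by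
      rw [hrec, mul_sub, mul_smul_comm, ← mul_assoc, ← mul_assoc, h4, smul_mul_assoc, smul_smul,
        div_mul_div_cancel₀ d1, div_self d0, one_smul, mul_assoc, h2, sub_self]
    refine ⟨?_, k1, fun l hl => ?_, fun h => ?_⟩
    · conv_lhs => enter [1]; rw [hrec]
      rw [sub_mul, k1, smul_mul_assoc, mul_assoc, k1, mul_assoc, k2, mul_zero, smul_zero, sub_zero]
    · rcases Nat.lt_succ_iff_lt_or_eq.1 hl with hl | rfl
      · rw [hrec, mul_sub, mul_smul_comm, ← mul_assoc, ← mul_assoc, h3 l hl, zero_mul, zero_mul,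
          smul_zero, sub_zero]
      · exact k2
    · have e1 : V * p * V = loopValue r • (V * p) := by
        rw [mul_assoc, ← hcomm h, ← mul_assoc, hsq, smul_mul_assoc]
      have e2 : V * (p * cupCap r N (s + j) * p) * V = V * p := by
        calc V * (p * cupCap r N (s + j) * p) * V
            = (V * p) * cupCap r N (s + j) * (p * V) := by simp only [mul_assoc]
          _ = (p * V) * cupCap r N (s + j) * (V * p) :=
            congrArg₂ (fun A B => A * cupCap r N (s + j) * B) (hcomm h) (hcomm h).symm
          _ = p * (V * cupCap r N (s + j) * V) * p := by simp only [mul_assoc]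
          _ = V * p := by rw [htl h, ← hcomm h, mul_assoc, h1]
      rw [hrec, mul_sub, sub_mul, mul_smul_comm, smul_mul_assoc, e1, e2, hd, sub_div,
        mul_div_cancel_right₀ _ d1]
      exact (sub_smul _ _ _).symm

/-- The Jones-Wenzl idempotent is annihilated by `U_j` on its strands. -/
theorem cupCap_jonesWenzl {r N s k : ℕ} (hk : k ≤ r - 1) (hN : s + k ≤ N) {l : ℕ}
    (hl : l + 1 < k) (x : Skein N) : cupCap r N (s + l) (jonesWenzl r N s k x) = 0 := by
  obtain ⟨j, rfl⟩ : ∃ j, k = j + 1 := ⟨k - 1, by omega⟩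
  exact LinearMap.congr_fun ((jonesWenzl_induction (r := r) N s j (by omega) (by omega)).2.2.1 l
    (by omega)) x

/-! ### Crossings -/

/-- The Kauffman bracket value of a crossing is compatible with the loop value. -/
def IsKauffmanParameter (r : ℕ) (a : ℂ) : Prop :=
  a ≠ 0 ∧ a ^ 2 + loopValue r + a⁻¹ ^ 2 = 0

theorem braid_of_temperleyLieb {R : Type*} [Ring R] [Algebra ℂ R] {U V : R} {a δ : ℂ} (ha : a ≠ 0)
    (h : a ^ 2 + δ + a⁻¹ ^ 2 = 0) (hU : U * U = δ • U) (hV : V * V = δ • V)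
    (hUV : U * V * U = U) (hVU : V * U * V = V) :
    (a • 1 + a⁻¹ • U) * (a • 1 + a⁻¹ • V) * (a • 1 + a⁻¹ • U) =
      (a • 1 + a⁻¹ • V) * (a • 1 + a⁻¹ • U) * (a • 1 + a⁻¹ • V) := by
  have expand : ∀ U V : R, U * U = δ • U → U * V * U = U →
      (a • 1 + a⁻¹ • U) * (a • 1 + a⁻¹ • V) * (a • 1 + a⁻¹ • U) =
        (a ^ 3) • (1 : R) + a • (U + V) + a⁻¹ • (U * V + V * U) +
          (a⁻¹ * (a ^ 2 + δ + a⁻¹ ^ 2)) • U := by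
    intro U V hU hUV
    simp only [mul_add, add_mul, smul_mul_assoc, mul_smul_comm, one_mul, mul_one, hU, hUV]
    match_scalars <;> field_simp
  rw [expand U V hU hUV, expand V U hV hVU, h, mul_zero, zero_smul, zero_smul, add_comm V U,
    add_comm (V * U)]

theorem crossing_eq (r N : ℕ) (a : ℂ) (j : ℕ) :
    crossing r N a j = a • (1 : Module.End ℂ (Skein N)) + a⁻¹ • cupCap r N j := rfl

theorem crossing_braid {r : ℕ} {a : ℂ} (ha : IsKauffmanParameter r a) (N j : ℕ) (hj : j + 2 < N) :
    (crossing r N a j * crossing r N a (j + 1) * crossing r N a j : Module.End ℂ (Skein N)) =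
      crossing r N a (j + 1) * crossing r N a j * crossing r N a (j + 1) :=
  braid_of_temperleyLieb ha.1 ha.2 (cupCap_mul_self r N j) (cupCap_mul_self r N (j + 1))
    (cupCap_succ r N j hj) (cupCap_pred r N j hj)

theorem Commute.crossing_right {r N : ℕ} (a : ℂ) {j : ℕ} {T : Module.End ℂ (Skein N)}
    (h : Commute T (cupCap r N j)) : Commute T (crossing r N a j) :=
  ((Commute.one_right T).smul_right a).add_right (h.smul_right a⁻¹)

theorem crossing_commute (r N : ℕ) (a : ℂ) {i j : ℕ} (hij : i + 1 < j) :
    Commute (crossing r N a i : Module.End ℂ (Skein N)) (crossing r N a j) :=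
  Commute.crossing_right a (Commute.crossing_right a (cupCap_commute r N hij).symm).symm

theorem commute_cupCap_of_crossing {r N : ℕ} {a : ℂ} (ha : a ≠ 0) {j : ℕ}
    {T : Module.End ℂ (Skein N)} (h : Commute T (crossing r N a j)) :
    Commute T (cupCap r N j) := by
  have : cupCap r N j = a • ((crossing r N a j : Module.End ℂ (Skein N)) - a • 1) := by
    rw [crossing_eq, add_sub_cancel_left, smul_smul, mul_inv_cancel₀ ha, one_smul]
  rw [this]
  exact (h.sub_right ((Commute.one_right T).smul_right a)).smul_right a

theorem crossing_mul_inv {r : ℕ} {a : ℂ} (ha : IsKauffmanParameter r a) (N j : ℕ) :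
    (crossing r N a j * crossing r N a⁻¹ j : Module.End ℂ (Skein N)) = 1 := by
  have e : (crossing r N a j * crossing r N a⁻¹ j : Module.End ℂ (Skein N)) =
      1 + (a ^ 2 + loopValue r + a⁻¹ ^ 2) • cupCap r N j := by
    have := ha.1
    rw [crossing_eq, crossing_eq]
    simp only [mul_add, add_mul, smul_mul_assoc, mul_smul_comm, one_mul, mul_one,
      cupCap_mul_self, inv_inv]
    match_scalars <;> field_simp
    ring
  rw [e, ha.2, zero_smul, add_zero]

theorem IsKauffmanParameter.inv {r : ℕ} {a : ℂ} (ha : IsKauffmanParameter r a) :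
    IsKauffmanParameter r a⁻¹ := by
  refine ⟨inv_ne_zero ha.1, ?_⟩
  rw [inv_inv, ← ha.2]
  ring

theorem crossing_inv_mul {r : ℕ} {a : ℂ} (ha : IsKauffmanParameter r a) (N j : ℕ) :
    (crossing r N a⁻¹ j * crossing r N a j : Module.End ℂ (Skein N)) = 1 := by
  simpa using crossing_mul_inv ha.inv N j

theorem isKauffmanParameter_kauffmanA (r : ℕ) : IsKauffmanParameter r (kauffmanA r) := by
  refine ⟨kauffmanA_ne_zero r, ?_⟩
  rw [loopValue]
  ring

theorem bracketForm_crossing {r : ℕ} {a : ℂ} (ha : IsKauffmanParameter r a)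
    (hu : conj a = a⁻¹) (N j : ℕ) (x y : Skein N) :
    bracketForm r (crossing r N a j x) (crossing r N a j y) = bracketForm r x y := by
  have adj : ∀ x y, bracketForm r (crossing r N a j x) y =
      bracketForm r x (crossing r N a⁻¹ j y) := by
    intro x y
    simp only [crossing, LinearMap.add_apply, LinearMap.smul_apply, LinearMap.id_apply,
      bracketForm_add_left, bracketForm_add_right, bracketForm_smul_left, bracketForm_smul_right,
      bracketForm_cupCap, map_inv₀, hu, inv_inv]
  rw [adj, ← Module.End.mul_apply, crossing_inv_mul ha, Module.End.one_apply]

/-! ### Generating all matchings from one -/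

/-- The matching `(0 1)(2 3)⋯`. -/
def stdMatching (N : ℕ) (hN : Even N) : PlanarMatching N where
  partner :=
    { toFun := fun i => ⟨if (i : ℕ) % 2 = 0 then i + 1 else i - 1, by grind⟩
      invFun := fun i => ⟨if (i : ℕ) % 2 = 0 then i + 1 else i - 1, by grind⟩
      left_inv := fun i => by ext; simp only; grind
      right_inv := fun i => by ext; simp only; grind }
  invol i := by ext; simp only [Equiv.coe_fn_mk]; grind
  noFix i := by rw [ne_eq, Fin.ext_iff]; simp only [Equiv.coe_fn_mk]; grind
  planar i j := by simp only [Equiv.coe_fn_mk, Fin.lt_def]; grind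

theorem stdMatching_partner (N : ℕ) (hN : Even N) {x y : Fin N} (h : (x : ℕ) + 1 = y)
    (hx : (x : ℕ) % 2 = 0) : (stdMatching N hN).partner x = y := by
  ext
  change (if (x : ℕ) % 2 = 0 then (x : ℕ) + 1 else x - 1) = y
  rw [if_pos hx, h]

/-- The first `k` arcs of `f` are `(0 1)(2 3)⋯`. -/
def PlanarMatching.StdBelow {N : ℕ} (f : PlanarMatching N) (k : ℕ) : Prop :=
  ∀ x y : Fin N, (x : ℕ) + 1 = y → (x : ℕ) % 2 = 0 → (x : ℕ) < 2 * k → f.partner x = y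

theorem PlanarMatching.eq_stdMatching {N : ℕ} {f : PlanarMatching N} {k : ℕ} (hN : Even N)
    (hk : N ≤ 2 * k) (hf : f.StdBelow k) : f = stdMatching N hN := by
  refine PlanarMatching.ext_partner fun z => ?_
  have hz := z.isLt
  rcases Nat.mod_two_eq_zero_or_one z with h | h
  · have : (z : ℕ) + 1 < N := by grind
    rw [hf z ⟨z + 1, this⟩ rfl h (by omega),
      stdMatching_partner N hN (y := ⟨z + 1, this⟩) rfl h]
  · have hw : (z : ℕ) - 1 + 1 = z := by omega
    have h1 := hf ⟨z - 1, by omega⟩ z hw (by simp only; omega) (by simp only; omega)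
    have h2 := stdMatching_partner N hN (x := ⟨z - 1, by omega⟩) hw (by simp only; omega)
    rw [f.partner_eq_comm.1 h1, (stdMatching N hN).partner_eq_comm.1 h2]

theorem PlanarMatching.StdBelow.partner_lt {N : ℕ} {f : PlanarMatching N} {k : ℕ} (hN : 2 * k ≤ N)
    (hf : f.StdBelow k) {z : Fin N} (hz : (z : ℕ) < 2 * k) : (f.partner z : ℕ) < 2 * k := by
  rcases Nat.mod_two_eq_zero_or_one z with h | h
  · rw [hf z ⟨z + 1, by omega⟩ rfl h hz]
    simp only
    omega
  · have hw : (z : ℕ) - 1 + 1 = z := by omega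
    have h1 := hf ⟨z - 1, by omega⟩ z hw (by simp only; omega) (by simp only; omega)
    rw [f.partner_eq_comm.1 h1]
    simp only
    omega

/-- Inside every arc there is an innermost one. -/
theorem PlanarMatching.exists_innermost {N : ℕ} (f : PlanarMatching N) :
    ∀ (d : ℕ) (x : Fin N), (f.partner x : ℕ) = x + d + 1 →
      ∃ u v : Fin N, (u : ℕ) + 1 = v ∧ x ≤ u ∧ f.partner u = v := by
  intro d
  induction d using Nat.strong_induction_on with
  | _ d ih =>
    intro x hx
    rcases Nat.eq_zero_or_pos d with rfl | hd
    · exact ⟨x, f.partner x, hx.symm, le_rfl, rfl⟩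
    have hlt := (f.partner x).isLt
    let u : Fin N := ⟨x + 1, by omega⟩
    have hu : (u : ℕ) = x + 1 := rfl
    have n1 : (f.partner u : ℕ) ≠ f.partner x := fun h => by
      have := f.partner.injective (Fin.ext h)
      rw [this] at hu
      omega
    have n2 : (f.partner u : ℕ) ≠ u := fun h => f.noFix u (Fin.ext h)
    have n3 : (f.partner u : ℕ) ≠ x := fun h => by
      have := f.partner_eq_comm.1 (Fin.ext h)
      rw [this] at hx
      omega
    have p1 := f.planar x u
    have p2 := f.planar (f.partner u) x
    rw [f.invol] at p2
    simp only [Fin.lt_def] at p1 p2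
    obtain ⟨v, w, h1, h2, h3⟩ := ih ((f.partner u : ℕ) - u - 1) (by omega) u (by omega)
    exact ⟨v, w, h1, by rw [Fin.le_def] at h2 ⊢; omega, h3⟩

theorem PlanarMatching.StdBelow.glueArc {N : ℕ} {f : PlanarMatching N} {k : ℕ} (hN : 2 * k ≤ N)
    (hf : f.StdBelow k) {x y : Fin N} (h : (x : ℕ) + 1 = y) (hx : 2 * k ≤ x) :
    (glueArc f x y h).StdBelow k := by
  intro z w hzw hz hzk
  have := hf.partner_lt hN hzk
  rw [glueArc_partner_of_ne h, hf z w hzw hz hzk]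
  all_goals rw [ne_eq, Fin.ext_iff]; omega

/-- Every matching is obtained from `(0 1)(2 3)⋯` by gluing on diagrams `∪∩` away from the
first point. -/
theorem PlanarMatching.induction {N : ℕ} (hN : Even N) {P : PlanarMatching N → Prop}
    (h0 : P (stdMatching N hN))
    (hg : ∀ f, ∀ x y : Fin N, ∀ h : (x : ℕ) + 1 = y, 1 ≤ (x : ℕ) → P f → P (glueArc f x y h)) :
    ∀ f, P f := by
  obtain ⟨M, hM⟩ := hN.two_dvd
  have main : ∀ d k, k + d = M → ∀ f : PlanarMatching N, f.StdBelow k → P f := by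
    intro d
    induction d with
    | zero =>
      intro k hk f hf
      rwa [PlanarMatching.eq_stdMatching hN (by omega) hf]
    | succ d ih =>
      intro k hk f hf
      have move : ∀ e : ℕ, ∀ f : PlanarMatching N, f.StdBelow k → ∀ x y : Fin N,
          (x : ℕ) + 1 = y → (x : ℕ) = 2 * k + e → f.partner x = y → P f := by
        intro e
        induction e with
        | zero =>
          intro f hf x y hxy hx hfx
          refine ih (k + 1) (by omega) f fun z w hzw hz hzk => ?_
          by_cases hzk' : (z : ℕ) < 2 * k
          · exact hf z w hzw hz hzk'
          · obtain rfl : z = x := Fin.ext (by omega)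
            obtain rfl : w = y := Fin.ext (by omega)
            exact hfx
        | succ e ihe =>
          intro f hf x y hxy hx hfx
          have hz : (x : ℕ) - 1 + 1 = x := by omega
          let z : Fin N := ⟨x - 1, by omega⟩
          rw [← glueArc_glueArc_pred (z := z) hxy hz hfx]
          refine hg _ x y hxy (by omega) (ihe _ (hf.glueArc (by omega) hz ?_) z x hz ?_
            (glueArc_partner_left _ _ _ _)) <;> simp only [z] <;> omega
      let z : Fin N := ⟨2 * k, by omega⟩
      have hz : 2 * k ≤ (f.partner z : ℕ) := by
        by_contra h
        have := hf.partner_lt (by omega) (lt_of_not_ge h)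
        rw [f.invol] at this
        exact lt_irrefl _ this
      have hz' : (f.partner z : ℕ) ≠ 2 * k := fun h => f.noFix z (Fin.ext h)
      have hzv : (z : ℕ) = 2 * k := rfl
      obtain ⟨u, v, huv, hu, hfu⟩ := f.exists_innermost ((f.partner z : ℕ) - 2 * k - 1) z
        (by omega)
      rw [Fin.le_def] at hu
      exact move ((u : ℕ) - 2 * k) f hf u v huv (by omega) hfu
  exact fun f => main M 0 (by omega) f fun x y _ _ h => by omega

/-! ### Operators commuting with the Temperley-Lieb action -/

theorem cupCap_apply_eq_zero (r : ℕ) {N : ℕ} {x y : Fin N} (h : (x : ℕ) + 1 = y)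
    {f : PlanarMatching N} (hf : f.partner x ≠ y) (v : Skein N) : cupCap r N x v f = 0 := by
  have : LinearMap.proj f ∘ₗ cupCap r N x = (0 : Skein N →ₗ[ℂ] ℂ) := by
    refine skein_hom_ext fun g => ?_
    rw [LinearMap.comp_apply, cupCap_single r N g x y h, LinearMap.proj_apply, Pi.smul_apply,
      Pi.single_eq_of_ne, smul_zero, LinearMap.zero_apply]
    rintro rfl
    exact hf (glueArc_partner_left _ _ _ _)
  exact LinearMap.congr_fun this v

theorem arcWeight_ne_zero {r : ℕ} (hr : 3 ≤ r) {N : ℕ} (f : PlanarMatching N) (x y : Fin N) :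
    arcWeight r f x y ≠ 0 := by
  rw [arcWeight]
  split_ifs
  · exact loopValue_ne_zero hr
  · exact one_ne_zero

theorem exists_eq_smul_of_commute {r : ℕ} (hr : 3 ≤ r) {N : ℕ} (hN : Even N)
    {T : Module.End ℂ (Skein N)}
    (hT : ∀ j, 1 ≤ j → j + 1 < N → Commute T (cupCap r N j)) : ∃ c : ℂ, T = c • 1 := by
  set f₀ := stdMatching N hN with hf₀
  set v := T (Pi.single f₀ 1) with hv
  have hδ := loopValue_ne_zero hr
  have hsupp : ∀ f, f ≠ f₀ → v f = 0 := by
    intro f hf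
    by_contra hvf
    apply hf
    have key : ∀ x y : Fin N, (x : ℕ) + 1 = y → (x : ℕ) % 2 = 0 → 1 ≤ (x : ℕ) →
        f.partner x = y := by
      intro x y hxy hx h1
      by_contra hfx
      have e : cupCap r N x v = loopValue r • v := by
        rw [hv, ← Module.End.mul_apply, ← (hT x h1 (by omega)).eq, Module.End.mul_apply,
          cupCap_single r N f₀ x y hxy, arcWeight, if_pos (stdMatching_partner N hN hxy hx),
          glueArc_of_partner hxy (stdMatching_partner N hN hxy hx), map_smul]
      have e' := congrFun e f
      rw [cupCap_apply_eq_zero r hxy hfx, Pi.smul_apply, smul_eq_mul] at e'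
      exact mul_ne_zero hδ hvf e'.symm
    refine PlanarMatching.eq_stdMatching (k := N) hN (by omega) fun x y hxy hx _ => ?_
    by_cases h1 : 1 ≤ (x : ℕ)
    · exact key x y hxy hx h1
    set z := f.partner x with hz
    have hz' : f.partner z = x := f.invol x
    have hne : (z : ℕ) ≠ x := fun h => f.noFix x (Fin.ext h)
    have hlt := z.isLt
    by_contra hzy
    have hzy' : (z : ℕ) ≠ y := fun h => hzy (Fin.ext h)
    rcases Nat.mod_two_eq_zero_or_one z with h | h
    · have := key z ⟨z + 1, by grind⟩ rfl h (by omega)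
      rw [hz'] at this
      have := congrArg Fin.val this
      simp only at this
      omega
    · have := key ⟨z - 1, by omega⟩ z (by simp only; omega) (by simp only; omega)
        (by simp only; omega)
      have := f.partner_eq_comm.1 this
      rw [hz'] at this
      have := congrArg Fin.val this
      simp only at this
      omega
  refine ⟨v f₀, skein_hom_ext (PlanarMatching.induction hN ?_ ?_)⟩
  · rw [← hf₀, ← hv, LinearMap.smul_apply, Module.End.one_apply]
    ext f
    by_cases h : f = f₀
    · simp [h]
    · simp [hsupp f h, h]
  · intro f x y hxy hx ih
    have hw := arcWeight_ne_zero hr f x y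
    have e : Pi.single (glueArc f x y hxy) (1 : ℂ) =
        (arcWeight r f x y)⁻¹ • cupCap r N x (Pi.single f 1) := by
      rw [cupCap_single r N f x y hxy, smul_smul, inv_mul_cancel₀ hw, one_smul]
    rw [e, map_smul, ← Module.End.mul_apply, (hT x hx (by omega)).eq, Module.End.mul_apply, ih]
    simp only [LinearMap.smul_apply, Module.End.one_apply, map_smul]

/-! ### Words in the braid generators -/

section BraidWords

variable {M : Type*} [Monoid M] {σ : ℕ → M}

/-- `σ_0 ⋯ σ_{k-1}`. -/
def ascending (σ : ℕ → M) : ℕ → M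
  | 0 => 1
  | k + 1 => ascending σ k * σ k

/-- `σ_{k-1} ⋯ σ_0`. -/
def descending (σ : ℕ → M) : ℕ → M
  | 0 => 1
  | k + 1 => σ k * descending σ k

/-- The braid relations for `σ_0, …, σ_{n-1}`. -/
structure IsBraided (σ : ℕ → M) (n : ℕ) : Prop where
  comm : ∀ i j, i + 1 < j → j < n → Commute (σ i) (σ j)
  braid : ∀ i, i + 1 < n → σ i * σ (i + 1) * σ i = σ (i + 1) * σ i * σ (i + 1)

theorem IsBraided.commute_ascending {n : ℕ} (h : IsBraided σ n) {j : ℕ} (hj : j < n) :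
    ∀ k, k < j → Commute (ascending σ k) (σ j)
  | 0, _ => Commute.one_left _
  | k + 1, hk => (h.commute_ascending hj k (by omega)).mul_left (h.comm k j hk hj)

theorem IsBraided.commute_descending {n : ℕ} (h : IsBraided σ n) {j : ℕ} (hj : j < n) :
    ∀ k, k < j → Commute (descending σ k) (σ j)
  | 0, _ => Commute.one_left _
  | k + 1, hk => (h.comm k j hk hj).mul_left (h.commute_descending hj k (by omega))

theorem IsBraided.ascending_mul {n : ℕ} (h : IsBraided σ n) :
    ∀ k i, i + 1 < k → k ≤ n → ascending σ k * σ i = σ (i + 1) * ascending σ k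
  | 0, i, hi, _ => by omega
  | 1, i, hi, _ => by omega
  | k + 2, i, hi, hk => by
    rcases Nat.lt_or_ge (i + 1) (k + 1) with hik | hik
    · rw [ascending, mul_assoc, ← (h.comm i (k + 1) (by omega) (by omega)).eq, ← mul_assoc,
        h.ascending_mul (k + 1) i hik (by omega), mul_assoc]
    · obtain rfl : i = k := by omega
      rw [ascending, ascending, mul_assoc, mul_assoc, ← mul_assoc (σ i), h.braid i (by omega),
        mul_assoc, ← mul_assoc, (h.commute_ascending (by omega) i (by omega)).eq]
      simp only [mul_assoc]

theorem IsBraided.descending_mul {n : ℕ} (h : IsBraided σ n) :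
    ∀ k i, i + 1 < k → k ≤ n → descending σ k * σ (i + 1) = σ i * descending σ k
  | 0, i, hi, _ => by omega
  | 1, i, hi, _ => by omega
  | k + 2, i, hi, hk => by
    rcases Nat.lt_or_ge (i + 1) (k + 1) with hik | hik
    · rw [descending, mul_assoc, h.descending_mul (k + 1) i hik (by omega), ← mul_assoc,
        ← (h.comm i (k + 1) (by omega) (by omega)).eq, mul_assoc]
    · obtain rfl : i = k := by omega
      rw [descending, descending, mul_assoc, mul_assoc,
        (h.commute_descending (by omega) i (by omega)).eq, ← mul_assoc, ← mul_assoc,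
        ← h.braid i (by omega)]
      simp only [mul_assoc]

theorem IsBraided.ascending_mul_descending_commute {n : ℕ} (h : IsBraided σ n) {i : ℕ}
    (hi : 1 ≤ i) (hin : i < n) : Commute (ascending σ n * descending σ n) (σ i) := by
  obtain ⟨i, rfl⟩ : ∃ l, i = l + 1 := ⟨i - 1, by omega⟩
  rw [Commute, SemiconjBy, mul_assoc, h.descending_mul n i hin le_rfl, ← mul_assoc,
    h.ascending_mul n i hin le_rfl, mul_assoc]

theorem IsBraided.ascending_pow_mul {n : ℕ} (h : IsBraided σ n) :
    ∀ l i, i + l < n → ascending σ n ^ l * σ i = σ (i + l) * ascending σ n ^ l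
  | 0, i, _ => by simp
  | l + 1, i, hl => by
    rw [pow_succ, mul_assoc, h.ascending_mul n i (by omega) le_rfl, ← mul_assoc,
      h.ascending_pow_mul l (i + 1) (by omega), mul_assoc, ← add_assoc, add_right_comm]

theorem ascending_succ' (σ : ℕ → M) : ∀ k,
    ascending σ (k + 1) = σ 0 * ascending (fun i => σ (i + 1)) k
  | 0 => by simp [ascending]
  | k + 1 => by rw [ascending, ascending_succ' σ k, ascending, mul_assoc]

theorem IsBraided.ascending_mul_ascending {n : ℕ} (h : IsBraided σ n) :
    ∀ k, k < n → ascending σ n * ascending σ k =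
      ascending (fun i => σ (i + 1)) k * ascending σ n
  | 0, _ => by simp [ascending]
  | k + 1, hk => by
    rw [ascending, ← mul_assoc, h.ascending_mul_ascending k (by omega), mul_assoc,
      h.ascending_mul n k hk le_rfl, ascending, mul_assoc]

theorem IsBraided.ascending_sq_mul {n : ℕ} (h : IsBraided σ (n + 1)) :
    ascending σ (n + 1) ^ 2 * σ n = σ 0 * ascending σ (n + 1) ^ 2 := by
  have e : ascending σ (n + 1) ^ 2 =
      ascending (fun i => σ (i + 1)) n * ascending σ (n + 1) * σ n := by
    rw [← h.ascending_mul_ascending n (by omega), mul_assoc, sq]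
    rfl
  conv_rhs => rw [e, ← mul_assoc, ← mul_assoc, ← ascending_succ']
  rw [sq]

theorem IsBraided.ascending_pow_commute {n : ℕ} (h : IsBraided σ n) {i : ℕ} (hi : i < n) :
    Commute (ascending σ n ^ (n + 1)) (σ i) := by
  obtain ⟨k, rfl⟩ : ∃ k, n = k + 1 := ⟨n - 1, by omega⟩
  have e : ascending σ (k + 1) ^ (k + 1 + 1) =
      ascending σ (k + 1) ^ i * ascending σ (k + 1) ^ 2 * ascending σ (k + 1) ^ (k - i) := by
    rw [← pow_add, ← pow_add]
    congr 1
    omega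
  have e1 := h.ascending_pow_mul (k - i) i (by omega)
  have e2 := h.ascending_pow_mul i 0 (by omega)
  rw [show i + (k - i) = k by omega] at e1
  rw [zero_add] at e2
  rw [Commute, SemiconjBy, e, mul_assoc, e1, ← mul_assoc, mul_assoc (_ ^ i), h.ascending_sq_mul,
    ← mul_assoc, e2]
  simp only [mul_assoc]

theorem prod_ofFn_eq_ascending (σ : ℕ → M) (n : ℕ) :
    (List.ofFn fun i : Fin n => σ i).prod = ascending σ n := by
  induction n with
  | zero => simp [ascending]
  | succ n ih => rw [List.ofFn_succ_last]; simp [ascending, ih]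

theorem prod_reverse_ofFn_eq_descending (σ : ℕ → M) (n : ℕ) :
    (List.ofFn fun i : Fin n => σ i).reverse.prod = descending σ n := by
  induction n with
  | zero => simp [descending]
  | succ n ih => rw [List.ofFn_succ_last]; simp [descending, ih]

end BraidWords

theorem isBraided_crossing {r : ℕ} {a : ℂ} (ha : IsKauffmanParameter r a) (n : ℕ) :
    IsBraided (fun i => (crossing r (n + 1) a i : Module.End ℂ (Skein (n + 1)))) n where
  comm i j hij _ := crossing_commute r (n + 1) a hij
  braid i hi := crossing_braid ha (n + 1) i (by omega)

/-- Moving the first point around all others is a scalar operator on skeins. -/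
theorem exists_ascending_mul_descending_crossing {r : ℕ} (hr : 3 ≤ r) {a : ℂ}
    (ha : IsKauffmanParameter r a) {n : ℕ} (hn : Odd n) :
    ∃ c : ℂ, ascending (fun i => (crossing r (n + 1) a i : Module.End ℂ (Skein (n + 1)))) n *
      descending (fun i => (crossing r (n + 1) a i : Module.End ℂ (Skein (n + 1)))) n = c • 1 :=
  exists_eq_smul_of_commute hr hn.add_one fun _ h1 h2 => commute_cupCap_of_crossing ha.1
    ((isBraided_crossing ha n).ascending_mul_descending_commute h1 (by omega))

/-- The full twist is a scalar operator on skeins. -/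
theorem exists_ascending_pow_crossing {r : ℕ} (hr : 3 ≤ r) {a : ℂ}
    (ha : IsKauffmanParameter r a) {n : ℕ} (hn : Odd n) :
    ∃ c : ℂ, ascending (fun i => (crossing r (n + 1) a i : Module.End ℂ (Skein (n + 1)))) n ^
      (n + 1) = c • 1 :=
  exists_eq_smul_of_commute hr hn.add_one fun _ _ h2 => commute_cupCap_of_crossing ha.1
    ((isBraided_crossing ha n).ascending_pow_commute (by omega))

/-! ### The path model -/

/-- Height functions of paths from `0` to `0` of length `N`, with heights in `[0, r - 2]`. -/
structure IsPath (r N : ℕ) (h : ℕ → ℤ) : Prop where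
  zero : h 0 = 0
  step : ∀ i < N, h (i + 1) = h i + 1 ∨ h (i + 1) = h i - 1
  nonneg : ∀ i, 0 ≤ h i
  le : ∀ i, h i + 2 ≤ r
  eq_zero : ∀ i, N ≤ i → h i = 0

/-- Paths from `0` to `0` of length `N`, with heights in `[0, r - 2]`. -/
abbrev Path (r N : ℕ) : Type := {h : ℕ → ℤ // IsPath r N h}

instance (r N : ℕ) : Finite (Path r N) := by
  refine Finite.of_injective (fun (h : Path r N) (i : Fin N) =>
    (⟨h.1 i, Finset.mem_Icc.2 ⟨h.2.nonneg i, by have := h.2.le i; omega⟩⟩ :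
      Finset.Icc (0 : ℤ) r)) fun h k hk => Subtype.ext (funext fun i => ?_)
  by_cases hi : i < N
  · exact congrArg Subtype.val (congrFun hk ⟨i, hi⟩)
  · rw [h.2.eq_zero i (by omega), k.2.eq_zero i (by omega)]

noncomputable instance (r N : ℕ) : Fintype (Path r N) := Fintype.ofFinite _

noncomputable instance (r N : ℕ) : DecidableEq (Path r N) := Classical.decEq _

/-- The quantum dimension of height `k`. -/
noncomputable def qdim (r : ℕ) (k : ℤ) : ℝ := quantumInt r (k + 1)

/-- The square root of the quantum dimension. -/
noncomputable def sqdim (r : ℕ) (k : ℤ) : ℝ := √(qdim r k)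

theorem qdim_pos {r : ℕ} {k : ℤ} (h0 : 0 ≤ k) (hk : k + 2 ≤ r) : 0 < qdim r k :=
  quantumInt_pos (by omega) (by omega) (by omega)

theorem sqdim_pos {r : ℕ} {k : ℤ} (h0 : 0 ≤ k) (hk : k + 2 ≤ r) : 0 < sqdim r k :=
  Real.sqrt_pos.2 (qdim_pos h0 hk)

theorem sqdim_mul_self {r : ℕ} {k : ℤ} (h0 : 0 ≤ k) (hk : k + 2 ≤ r) :
    sqdim r k * sqdim r k = qdim r k :=
  Real.mul_self_sqrt (qdim_pos h0 hk).le

theorem IsPath.qdim_pos {r N : ℕ} {h : ℕ → ℤ} (hh : IsPath r N h) (i : ℕ) : 0 < qdim r (h i) :=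
  CSJones.qdim_pos (hh.nonneg i) (hh.le i)

theorem IsPath.sqdim_pos {r N : ℕ} {h : ℕ → ℤ} (hh : IsPath r N h) (i : ℕ) : 0 < sqdim r (h i) :=
  CSJones.sqdim_pos (hh.nonneg i) (hh.le i)

theorem IsPath.sqdim_mul_self {r N : ℕ} {h : ℕ → ℤ} (hh : IsPath r N h) (i : ℕ) :
    sqdim r (h i) * sqdim r (h i) = qdim r (h i) :=
  CSJones.sqdim_mul_self (hh.nonneg i) (hh.le i)

/-- Two height functions agree except possibly at `j + 1`. -/
def AgreeOff (j : ℕ) (h k : ℕ → ℤ) : Prop := ∀ i, i ≠ j + 1 → h i = k i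

theorem AgreeOff.symm {j : ℕ} {h k : ℕ → ℤ} (hk : AgreeOff j h k) : AgreeOff j k h :=
  fun i hi => (hk i hi).symm

theorem AgreeOff.eq_update {j : ℕ} {h k : ℕ → ℤ} (hk : AgreeOff j h k) :
    k = Function.update h (j + 1) (k (j + 1)) := by
  ext i
  by_cases hi : i = j + 1
  · rw [hi, Function.update_self]
  · rw [Function.update_of_ne hi, hk i hi]

theorem agreeOff_update (j : ℕ) (h : ℕ → ℤ) (c : ℤ) :
    AgreeOff j h (Function.update h (j + 1) c) :=
  fun i hi => by rw [Function.update_of_ne hi]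

theorem AgreeOff.ext {j : ℕ} {h k : ℕ → ℤ} (hk : AgreeOff j h k) (e : h (j + 1) = k (j + 1)) :
    h = k := by
  ext i
  by_cases hi : i = j + 1
  · rw [hi, e]
  · exact hk i hi

theorem IsPath.update {r N : ℕ} {h : ℕ → ℤ} (hh : IsPath r N h) {j : ℕ} (hj : j + 1 < N)
    (hb : h j = h (j + 2)) {c : ℤ} (hc : c = h j + 1 ∨ c = h j - 1) (h0 : 0 ≤ c)
    (hr : c + 2 ≤ r) : IsPath r N (Function.update h (j + 1) c) where
  zero := by rw [Function.update_of_ne (by omega), hh.zero]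
  step i hi := by
    by_cases h1 : i = j
    · subst h1
      rw [Function.update_self, Function.update_of_ne (by omega)]
      exact hc
    by_cases h2 : i = j + 1
    · subst h2
      rw [Function.update_self, Function.update_of_ne (by omega)]
      rw [show j + 1 + 1 = j + 2 from rfl, ← hb]
      omega
    rw [Function.update_of_ne (by omega), Function.update_of_ne h2]
    exact hh.step i hi
  nonneg i := by
    by_cases h1 : i = j + 1
    · rwa [h1, Function.update_self]
    · rw [Function.update_of_ne h1]; exact hh.nonneg i
  le i := by
    by_cases h1 : i = j + 1
    · rwa [h1, Function.update_self]
    · rw [Function.update_of_ne h1]; exact hh.le i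
  eq_zero i hi := by rw [Function.update_of_ne (by omega), hh.eq_zero i hi]

open Classical in
/-- Matrix entries of `U_j` in the path model. -/
noncomputable def pathEntry (r : ℕ) (j : ℕ) (h k : ℕ → ℤ) : ℝ :=
  if h j = h (j + 2) ∧ AgreeOff j h k then
    sqdim r (h (j + 1)) * sqdim r (k (j + 1)) / qdim r (h j) else 0

theorem pathEntry_symm (r j : ℕ) (h k : ℕ → ℤ) : pathEntry r j h k = pathEntry r j k h := by
  by_cases hk : AgreeOff j h k
  · have e1 := hk j (by omega)
    have e2 := hk (j + 2) (by omega)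
    rw [pathEntry, pathEntry, e1, e2, mul_comm (sqdim r (h _))]
    simp only [hk, hk.symm, and_true]
  · have hk' : ¬ AgreeOff j k h := fun h' => hk h'.symm
    rw [pathEntry, pathEntry, if_neg (by tauto), if_neg (by tauto)]

open Classical in
theorem sum_agreeOff_qdim {r N : ℕ} (hr : 2 ≤ r) (h : Path r N) {j : ℕ} (hj : j + 1 < N)
    (hb : h.1 j = h.1 (j + 2)) :
    ∑ k : Path r N, (if AgreeOff j h.1 k.1 then qdim r (k.1 (j + 1)) else 0) =
      quantumInt r 2 * qdim r (h.1 j) := by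
  have b0 := h.2.nonneg j
  have br := h.2.le j
  have step1 : ∑ k : Path r N, (if AgreeOff j h.1 k.1 then qdim r (k.1 (j + 1)) else 0) =
      ∑ c ∈ ({h.1 j + 1, h.1 j - 1} : Finset ℤ) with 0 ≤ c ∧ c + 2 ≤ (r : ℤ), qdim r c := by
    rw [← Finset.sum_filter]
    refine Finset.sum_bij' (fun k _ => k.1 (j + 1)) (fun c hc => ⟨Function.update h.1 (j + 1) c, ?_⟩)
      ?_ ?_ ?_ ?_ ?_
    · simp only [Finset.mem_filter, Finset.mem_insert, Finset.mem_singleton] at hc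
      exact h.2.update hj hb hc.1 hc.2.1 hc.2.2
    · intro k hk
      simp only [Finset.mem_filter, Finset.mem_univ, true_and] at hk
      simp only [Finset.mem_filter, Finset.mem_insert, Finset.mem_singleton]
      refine ⟨?_, k.2.nonneg _, k.2.le _⟩
      rw [hk j (by omega)]
      exact k.2.step j (by omega)
    · intro c hc
      simp only [Finset.mem_filter, Finset.mem_univ, true_and]
      exact agreeOff_update j h.1 c
    · intro k hk
      simp only [Finset.mem_filter, Finset.mem_univ, true_and] at hk
      exact Subtype.ext hk.eq_update.symm
    · intro c hc
      simp
    · intro k hk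
      rfl
  have step2 : ∑ c ∈ ({h.1 j + 1, h.1 j - 1} : Finset ℤ) with 0 ≤ c ∧ c + 2 ≤ (r : ℤ), qdim r c =
      ∑ c ∈ ({h.1 j + 1, h.1 j - 1} : Finset ℤ), qdim r c := by
    refine Finset.sum_filter_of_ne fun c hc hne => ?_
    simp only [Finset.mem_insert, Finset.mem_singleton] at hc
    by_contra hcr
    apply hne
    have : c = -1 ∨ c + 1 = r := by omega
    rcases this with rfl | hc'
    · exact quantumInt_zero r
    · rw [qdim, hc', quantumInt_self hr]
  rw [step1, step2, Finset.sum_pair (by omega), qdim, qdim, qdim, quantumInt_two_mul hr]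
  congr 2
  ring

/-! ### Matchings as vectors in the path model -/

/-- The arcs of `f` join opposite steps of `h`. -/
def Fits {N : ℕ} (f : PlanarMatching N) (h : ℕ → ℤ) : Prop :=
  ∀ x : Fin N, h (x + 1) - h x = -(h (f.partner x + 1) - h (f.partner x))

theorem PlanarMatching.inside {N : ℕ} (f : PlanarMatching N) {x z : Fin N} (h1 : x < z)
    (h2 : z < f.partner x) : x < f.partner z ∧ f.partner z < f.partner x := by
  have p1 := f.planar x z
  have p2 := f.planar (f.partner z) x
  rw [f.invol] at p2
  have n1 : (f.partner z : ℕ) ≠ f.partner x := fun e => by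
    have := f.partner.injective (Fin.ext e)
    exact absurd this h1.ne'
  have n2 : (f.partner z : ℕ) ≠ x := fun e => by
    have := f.partner_eq_comm.1 (Fin.ext e)
    exact absurd this h2.ne'
  simp only [Fin.lt_def] at *
  omega

theorem Fits.inner_eq {N : ℕ} {f : PlanarMatching N} {h : ℕ → ℤ} (hf : Fits f h) {x : Fin N}
    (hx : x < f.partner x) : h (x + 1) = h (f.partner x) := by
  have key : ∑ i ∈ Finset.Ico ((x : ℕ) + 1) (f.partner x), (h (i + 1) - h i) = 0 := by
    have hlt : ∀ i ∈ Finset.Ico ((x : ℕ) + 1) (f.partner x), i < N := fun i hi =>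
      (Finset.mem_Ico.1 hi).2.trans (f.partner x).isLt
    refine Finset.sum_involution (fun i hi => (f.partner ⟨i, hlt i hi⟩ : ℕ)) ?_ ?_ ?_ ?_
    · intro i hi
      have := hf ⟨i, hlt i hi⟩
      simp only at this
      omega
    · intro i hi _ e
      exact f.noFix ⟨i, hlt i hi⟩ (Fin.ext e)
    · intro i hi
      rw [Finset.mem_Ico] at hi
      have := f.inside (x := x) (z := ⟨i, by have := (f.partner x).isLt; omega⟩)
        (Fin.lt_def.2 (by simp only; omega)) (Fin.lt_def.2 hi.2)
      simp only [Fin.lt_def] at this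
      rw [Finset.mem_Ico]
      omega
    · intro i hi
      simp only [Fin.eta, f.invol]
  rw [Fin.lt_def] at hx
  rw [Finset.sum_Ico_eq_sub _ (by omega), Finset.sum_range_sub, Finset.sum_range_sub] at key
  omega

theorem Fits.partner_eq {N : ℕ} {f : PlanarMatching N} {h : ℕ → ℤ} (hf : Fits f h) (x : Fin N) :
    h (f.partner x) = h (x + 1) ∧ h (f.partner x + 1) = h x := by
  have h1 := hf x
  rcases lt_trichotomy x (f.partner x) with hx | hx | hx
  · have := hf.inner_eq hx
    omega
  · exact absurd hx.symm (f.noFix x)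
  · have := hf.inner_eq (x := f.partner x) (by rwa [f.invol])
    rw [f.invol] at this
    omega

/-- The weight of an arc of `f` beginning at `x`. -/
noncomputable def openWeight (r : ℕ) {N : ℕ} (f : PlanarMatching N) (h : ℕ → ℤ) (x : Fin N) : ℝ :=
  if x < f.partner x then sqdim r (h (x + 1)) / sqdim r (h x) else 1

open Classical in
/-- The coordinates of the matching `f` in the path model. -/
noncomputable def matchingVec (r : ℕ) {N : ℕ} (f : PlanarMatching N) (h : ℕ → ℤ) : ℝ :=
  if Fits f h then ∏ x, openWeight r f h x else 0

section Intertwining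

variable {r N : ℕ} {f : PlanarMatching N} {x y : Fin N}

theorem AgreeOff.step_eq {x : ℕ} {h k : ℕ → ℤ} (hk : AgreeOff x h k) {z : ℕ} (h1 : z ≠ x)
    (h2 : z ≠ x + 1) : k z = h z ∧ k (z + 1) = h (z + 1) :=
  ⟨(hk z h2).symm, (hk (z + 1) (by omega)).symm⟩

theorem Fits.of_agreeOff {h k : ℕ → ℤ} (hxy : (x : ℕ) + 1 = y) (hf : f.partner x = y)
    (hb : h x = h (x + 2)) (hk : AgreeOff x h k) (hfit : Fits f h) : Fits f k := by
  have hf' := f.partner_eq_comm.1 hf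
  have e1 := hk x (by omega)
  have e2 := hk (x + 2) (by omega)
  intro z
  by_cases zx : z = x
  · subst zx
    rw [hf, ← hxy, show (z : ℕ) + 1 + 1 = z + 2 from rfl]
    omega
  by_cases zy : z = y
  · subst zy
    rw [hf', ← hxy, show (x : ℕ) + 1 + 1 = x + 2 from rfl]
    omega
  have hz1 : (z : ℕ) ≠ x := fun e => zx (Fin.ext e)
  have hz2 : (z : ℕ) ≠ x + 1 := fun e => zy (Fin.ext (by omega))
  have hz3 : (f.partner z : ℕ) ≠ x := fun e =>
    zy (by rw [← hf, f.partner_eq_comm.1 (Fin.ext e)])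
  have hz4 : (f.partner z : ℕ) ≠ x + 1 := fun e =>
    zx (by rw [← hf', f.partner_eq_comm.1 (Fin.ext (e.trans hxy))])
  obtain ⟨a1, a2⟩ := hk.step_eq hz1 hz2
  obtain ⟨a3, a4⟩ := hk.step_eq hz3 hz4
  rw [a1, a2, a3, a4]
  exact hfit z

theorem matchingVec_agreeOff {h k : Path r N} (hxy : (x : ℕ) + 1 = y) (hf : f.partner x = y)
    (hb : h.1 x = h.1 (x + 2)) (hk : AgreeOff x h.1 k.1) :
    matchingVec r f k.1 * sqdim r (h.1 (x + 1)) = matchingVec r f h.1 * sqdim r (k.1 (x + 1)) := by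
  have hf' := f.partner_eq_comm.1 hf
  have e1 := hk x (by omega)
  have e2 := hk (x + 2) (by omega)
  by_cases hfit : Fits f h.1
  · rw [matchingVec, matchingVec, if_pos hfit, if_pos (hfit.of_agreeOff hxy hf hb hk),
      ← Finset.mul_prod_erase _ _ (Finset.mem_univ x),
      ← Finset.mul_prod_erase _ (openWeight r f h.1) (Finset.mem_univ x)]
    have hlt : x < f.partner x := by rw [hf, Fin.lt_def]; omega
    have hprod : ∏ z ∈ Finset.univ.erase x, openWeight r f k.1 z =
        ∏ z ∈ Finset.univ.erase x, openWeight r f h.1 z := by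
      refine Finset.prod_congr rfl fun z hz => ?_
      have zx : (z : ℕ) ≠ x := fun e => (Finset.mem_erase.1 hz).1 (Fin.ext e)
      by_cases zy : z = y
      · rw [openWeight, openWeight, zy, hf', if_neg, if_neg] <;> rw [Fin.lt_def] <;> omega
      · obtain ⟨a1, a2⟩ := hk.step_eq zx (fun e => zy (Fin.ext (by omega)))
        rw [openWeight, openWeight, a1, a2]
    rw [hprod, openWeight, openWeight, if_pos hlt, if_pos hlt, e1]
    ring
  · rw [matchingVec, matchingVec, if_neg hfit, if_neg]
    · ring
    · exact fun hfit' => hfit (hfit'.of_agreeOff hxy hf (by rw [← e1, ← e2, hb]) hk.symm)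

theorem sum_pathEntry_of_partner (hr : 2 ≤ r) (hxy : (x : ℕ) + 1 = y) (hf : f.partner x = y)
    (h : Path r N) : ∑ k : Path r N, pathEntry r x h.1 k.1 * matchingVec r f k.1 =
      quantumInt r 2 * matchingVec r f h.1 := by
  classical
  by_cases hb : h.1 x = h.1 (x + 2)
  · have hq := (h.2.qdim_pos x).ne'
    have e : ∀ k : Path r N, pathEntry r x h.1 k.1 * matchingVec r f k.1 =
        matchingVec r f h.1 / qdim r (h.1 x) *
          (if AgreeOff x h.1 k.1 then qdim r (k.1 (x + 1)) else 0) := by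
      intro k
      by_cases hk : AgreeOff x h.1 k.1
      · rw [pathEntry, if_pos ⟨hb, hk⟩, if_pos hk, ← k.2.sqdim_mul_self]
        have := matchingVec_agreeOff hxy hf hb hk
        field_simp
        linear_combination sqdim r (k.1 (x + 1)) * this
      · rw [pathEntry, if_neg (fun h => hk h.2), if_neg hk, zero_mul, mul_zero]
    rw [Finset.sum_congr rfl fun k _ => e k, ← Finset.mul_sum, sum_agreeOff_qdim hr h (by omega) hb]
    field_simp
  · rw [Finset.sum_eq_zero, matchingVec, if_neg, mul_zero]
    · intro hfit
      have := hfit x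
      rw [hf, ← hxy, show (x : ℕ) + 1 + 1 = x + 2 from rfl] at this
      omega
    · intro k _
      rw [pathEntry, if_neg (fun h => hb h.1), zero_mul]

theorem fits_glueArc_iff {h k : ℕ → ℤ} (hxy : (x : ℕ) + 1 = y) (hf : f.partner x ≠ y)
    (hb : h x = h (x + 2)) (hk : AgreeOff x h k) :
    Fits f k ↔ Fits (glueArc f x y hxy) h ∧
      k (x + 1) = h x - (h (f.partner x + 1) - h (f.partner x)) := by
  have hf' : f.partner y ≠ x := fun e => hf (f.partner_eq_comm.1 e)
  have e1 := hk x (by omega)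
  have e2 := hk (x + 2) (by omega)
  have val : ∀ z : Fin N, z ≠ x → z ≠ y → k z = h z ∧ k (z + 1) = h (z + 1) := fun z h1 h2 =>
    hk.step_eq (fun e => h1 (Fin.ext e)) (fun e => h2 (Fin.ext (by omega)))
  obtain ⟨x1, x2⟩ := val (f.partner x) (f.noFix x) hf
  obtain ⟨y1, y2⟩ := val (f.partner y) hf' (f.noFix y)
  have hy2 : (y : ℕ) + 1 = x + 2 := by omega
  constructor
  · intro hfit
    have fx := hfit x
    have fy := hfit y
    rw [hy2, ← hxy] at fy
    refine ⟨fun z => ?_, by omega⟩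
    by_cases zx : z = x
    · subst zx
      rw [glueArc_partner_left, hy2, ← hxy]
      omega
    by_cases zy : z = y
    · subst zy
      rw [glueArc_partner_right, hy2, ← hxy]
      omega
    obtain ⟨z1, z2⟩ := val z zx zy
    rw [glueArc_partner, if_neg zx, if_neg zy]
    split_ifs with h1 h2
    · rw [h1]
      omega
    · rw [h2]
      omega
    · obtain ⟨w1, w2⟩ := val (f.partner z) (fun e => h1 (f.partner_eq_comm.1 e).symm)
        (fun e => h2 (f.partner_eq_comm.1 e).symm)
      have := hfit z
      omega
  · rintro ⟨hfit, hc⟩ z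
    have fx := hfit (f.partner x)
    rw [glueArc_partner, if_neg (f.noFix x), if_neg hf, if_pos rfl] at fx
    by_cases zx : z = x
    · subst zx
      omega
    by_cases zy : z = y
    · subst zy
      rw [hy2, ← hxy]
      omega
    by_cases gx : f.partner z = x
    · rw [gx]
      rw [← f.partner_eq_comm.1 gx]
      omega
    by_cases gy : f.partner z = y
    · rw [gy, hy2, ← hxy]
      rw [← f.partner_eq_comm.1 gy]
      omega
    obtain ⟨z1, z2⟩ := val z zx zy
    obtain ⟨w1, w2⟩ := val (f.partner z) gx gy
    have := hfit z
    rw [glueArc_partner_of_ne hxy zx zy gx gy] at this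
    omega

theorem prod_openWeight_glueArc {h k : Path r N} (hxy : (x : ℕ) + 1 = y) (hf : f.partner x ≠ y)
    (hb : h.1 x = h.1 (x + 2)) (hk : AgreeOff x h.1 k.1) (hfit : Fits f k.1) :
    sqdim r (h.1 (x + 1)) * sqdim r (k.1 (x + 1)) / qdim r (h.1 x) * ∏ z, openWeight r f k.1 z =
      ∏ z, openWeight r (glueArc f x y hxy) h.1 z := by
  classical
  have hf' : f.partner y ≠ x := fun e => hf (f.partner_eq_comm.1 e)
  have hxy' : x ≠ y := fun e => by rw [e] at hxy; omega
  have hxx : f.partner x ≠ x := f.noFix x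
  have hyy : f.partner y ≠ y := f.noFix y
  have hpp : f.partner x ≠ f.partner y := fun e => hxy' (f.partner.injective e)
  have val : ∀ z : Fin N, z ≠ x → z ≠ y → h.1 z = k.1 z ∧ h.1 (z + 1) = k.1 (z + 1) :=
    fun z h1 h2 => hk.symm.step_eq (fun e => h1 (Fin.ext e)) (fun e => h2 (Fin.ext (by omega)))
  have hsub := Finset.subset_univ ({x, y, f.partner x, f.partner y} : Finset (Fin N))
  have hrest : ∏ z ∈ Finset.univ \ {x, y, f.partner x, f.partner y}, openWeight r f k.1 z =
      ∏ z ∈ Finset.univ \ {x, y, f.partner x, f.partner y},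
        openWeight r (glueArc f x y hxy) h.1 z := by
    refine Finset.prod_congr rfl fun z hz => ?_
    simp only [Finset.mem_sdiff, Finset.mem_univ, true_and, Finset.mem_insert,
      Finset.mem_singleton, not_or] at hz
    obtain ⟨z1, z2, z3, z4⟩ := hz
    rw [openWeight, openWeight, (val z z1 z2).1, (val z z1 z2).2, glueArc_partner_of_ne hxy z1 z2
      (fun e => z3 (f.partner_eq_comm.1 e).symm) (fun e => z4 (f.partner_eq_comm.1 e).symm)]
  rw [← Finset.prod_sdiff hsub, ← Finset.prod_sdiff hsub, hrest, mul_left_comm]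
  congr 1
  have split : ∀ F : Fin N → ℝ, ∏ z ∈ ({x, y, f.partner x, f.partner y} : Finset (Fin N)), F z =
      F x * (F y * (F (f.partner x) * F (f.partner y))) := by
    intro F
    rw [Finset.prod_insert, Finset.prod_insert, Finset.prod_insert, Finset.prod_singleton] <;>
      simp [hpp, hxy', hxx.symm, hyy.symm, hf.symm, hf'.symm]
  have hglue : (glueArc f x y hxy).partner (f.partner x) = f.partner y := by
    rw [glueArc_partner, if_neg hxx, if_neg hf, if_pos rfl]
  have hglue' : (glueArc f x y hxy).partner (f.partner y) = f.partner x := by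
    rw [glueArc_partner, if_neg hf', if_neg hyy, if_neg hpp.symm, if_pos rfl]
  have hy2 : (y : ℕ) + 1 = x + 2 := by omega
  have k0 := hk x (by omega)
  have k2 := hk (x + 2) (by omega)
  obtain ⟨px, px'⟩ := hfit.partner_eq x
  obtain ⟨py, py'⟩ := hfit.partner_eq y
  rw [hy2, ← k2, ← hb] at py
  rw [← hxy] at py'
  rw [← k0] at px'
  simp only [split, openWeight, glueArc_partner_left, glueArc_partner_right, hglue, hglue',
    f.invol, (val _ hxx hf).1, (val _ hxx hf).2, (val _ hf' hyy).1, (val _ hf' hyy).2, px, px', py,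
    py', hy2, ← k0, ← k2, ← hb]
  rw [← hxy, ← h.2.sqdim_mul_self]
  have sb := (h.2.sqdim_pos x).ne'
  have sc := (k.2.sqdim_pos (x + 1)).ne'
  have p1 := f.planar x y
  have p2 := f.planar (f.partner x) (f.partner y)
  have p3 := f.planar (f.partner y) x
  have n1 : (f.partner x : ℕ) ≠ x := fun e => hxx (Fin.ext e)
  have n2 : (f.partner x : ℕ) ≠ y := fun e => hf (Fin.ext e)
  have n3 : (f.partner y : ℕ) ≠ x := fun e => hf' (Fin.ext e)
  have n4 : (f.partner y : ℕ) ≠ y := fun e => hyy (Fin.ext e)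
  have n5 : (f.partner x : ℕ) ≠ f.partner y := fun e => hpp (Fin.ext e)
  simp only [Fin.lt_def, f.invol] at p1 p2 p3 ⊢
  rw [if_pos (show (x : ℕ) < y by omega), if_neg (show ¬ (y : ℕ) < x by omega)]
  rcases Nat.lt_or_gt_of_ne n1 with c1 | c1 <;> rcases Nat.lt_or_gt_of_ne n4 with c2 | c2
  · rw [if_neg (by omega), if_neg (by omega), if_pos c1, if_pos c2, if_neg (by omega),
      if_pos (by omega)]
    field_simp
  · rw [if_neg (by omega), if_pos c2, if_pos c1, if_neg (by omega), if_pos (by omega),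
      if_neg (by omega)]
    field_simp
  · omega
  · rw [if_pos c1, if_pos c2, if_neg (by omega), if_neg (by omega), if_neg (by omega),
      if_pos (by omega)]
    field_simp

theorem sum_pathEntry_of_not_partner (hxy : (x : ℕ) + 1 = y) (hf : f.partner x ≠ y)
    (h : Path r N) : ∑ k : Path r N, pathEntry r x h.1 k.1 * matchingVec r f k.1 =
      matchingVec r (glueArc f x y hxy) h.1 := by
  classical
  by_cases hb : h.1 x = h.1 (x + 2)
  · by_cases hfit : Fits (glueArc f x y hxy) h.1
    · set c := h.1 x - (h.1 (f.partner x + 1) - h.1 (f.partner x)) with hc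
      have hagree := agreeOff_update x h.1 c
      have hfit' : Fits f (Function.update h.1 (x + 1) c) :=
        (fits_glueArc_iff hxy hf hb hagree).2 ⟨hfit, Function.update_self ..⟩
      have hcx : c = h.1 (f.partner x) := by
        have := (hfit'.partner_eq x).1
        rw [Function.update_self, Function.update_of_ne] at this
        · exact this.symm
        · rw [hxy]
          exact fun e => hf (Fin.ext e)
      have hstep : c = h.1 x + 1 ∨ c = h.1 x - 1 := by
        have := h.2.step (f.partner x) (f.partner x).isLt
        omega
      let k₀ : Path r N := ⟨_, h.2.update (by omega) hb hstep (hcx ▸ h.2.nonneg _)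
        (hcx ▸ h.2.le _)⟩
      rw [Finset.sum_eq_single k₀, pathEntry, if_pos ⟨hb, hagree⟩, matchingVec, if_pos hfit',
        matchingVec, if_pos hfit]
      · exact prod_openWeight_glueArc (k := k₀) hxy hf hb hagree hfit'
      · intro k _ hne
        by_cases hk : AgreeOff x h.1 k.1
        · rw [matchingVec, if_neg, mul_zero]
          intro hfk
          apply hne
          have := ((fits_glueArc_iff hxy hf hb hk).1 hfk).2
          refine Subtype.ext ?_
          rw [hk.eq_update, this]
        · rw [pathEntry, if_neg (fun h => hk h.2), zero_mul]
      · simp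
    · rw [matchingVec, if_neg hfit]
      refine Finset.sum_eq_zero fun k _ => ?_
      by_cases hk : AgreeOff x h.1 k.1
      · rw [matchingVec, if_neg, mul_zero]
        exact fun hfk => hfit ((fits_glueArc_iff hxy hf hb hk).1 hfk).1
      · rw [pathEntry, if_neg (fun h => hk h.2), zero_mul]
  · rw [Finset.sum_eq_zero, matchingVec, if_neg]
    · intro hfit
      have := hfit x
      rw [glueArc_partner_left, ← hxy, show (x : ℕ) + 1 + 1 = x + 2 from rfl] at this
      omega
    · intro k _
      rw [pathEntry, if_neg (fun h => hb h.1), zero_mul]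

end Intertwining

/-- `U_j` in the path model. -/
noncomputable def pathOp (r N j : ℕ) : (Path r N → ℂ) →ₗ[ℂ] (Path r N → ℂ) :=
  Matrix.mulVecLin (Matrix.of fun h k : Path r N => (pathEntry r j h.1 k.1 : ℂ))

theorem pathOp_apply (r N j : ℕ) (v : Path r N → ℂ) (h : Path r N) :
    pathOp r N j v h = ∑ k : Path r N, (pathEntry r j h.1 k.1 : ℂ) * v k := rfl

/-- The map from skeins to the path model. -/
noncomputable def toPaths (r N : ℕ) : Skein N →ₗ[ℂ] (Path r N → ℂ) :=
  Fintype.linearCombination ℂ fun (f : PlanarMatching N) (h : Path r N) =>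
    (matchingVec r f h.1 : ℂ)

theorem toPaths_single (r N : ℕ) (f : PlanarMatching N) (h : Path r N) :
    toPaths r N (Pi.single f 1) h = (matchingVec r f h.1 : ℂ) := by
  rw [toPaths, Fintype.linearCombination_apply_single, one_smul]

theorem toPaths_cupCap {r : ℕ} (hr : 2 ≤ r) {N j : ℕ} (hj : j + 1 < N) (v : Skein N) :
    toPaths r N (cupCap r N j v) = pathOp r N j (toPaths r N v) := by
  have : toPaths r N ∘ₗ cupCap r N j = pathOp r N j ∘ₗ toPaths r N := by
    refine skein_hom_ext fun f => funext fun h => ?_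
    have key := cupCap_single r N f ⟨j, by omega⟩ ⟨j + 1, hj⟩ rfl
    simp only at key
    rw [LinearMap.comp_apply, LinearMap.comp_apply, key, map_smul, Pi.smul_apply, toPaths_single,
      pathOp_apply]
    simp only [toPaths_single]
    rw [arcWeight, smul_eq_mul]
    split_ifs with hf
    · rw [loopValue_eq hr, glueArc_of_partner rfl hf]
      exact_mod_cast (sum_pathEntry_of_partner (x := ⟨j, by omega⟩) hr rfl hf h).symm
    · rw [one_mul]
      exact_mod_cast (sum_pathEntry_of_not_partner (x := ⟨j, by omega⟩) rfl hf h).symm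
  exact LinearMap.congr_fun this v

/-! ### The standard path -/

/-- The path `0, 1, 0, 1, …, 0`. -/
def stdHeight (N i : ℕ) : ℤ := if i < N ∧ i % 2 = 1 then 1 else 0

theorem isPath_stdHeight {r : ℕ} (hr : 3 ≤ r) {N : ℕ} (hN : Even N) :
    IsPath r N (stdHeight N) where
  zero := by simp [stdHeight]
  step i hi := by
    rw [stdHeight, stdHeight]
    have := Nat.even_iff.1 hN
    split_ifs <;> omega
  nonneg i := by rw [stdHeight]; split_ifs <;> omega
  le i := by rw [stdHeight]; split_ifs <;> omega
  eq_zero i hi := by rw [stdHeight, if_neg (by omega)]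

theorem IsPath.mod_two {r N : ℕ} {h : ℕ → ℤ} (hh : IsPath r N h) :
    ∀ i ≤ N, h i % 2 = (i : ℤ) % 2
  | 0, _ => by rw [hh.zero]; rfl
  | i + 1, hi => by
    have h1 := hh.mod_two i (by omega)
    have h2 := hh.step i (by omega)
    push_cast
    omega

theorem IsPath.eq_stdHeight {r N : ℕ} {h : ℕ → ℤ} (hh : IsPath r N h) (h1 : ∀ i, h i ≤ 1) :
    h = stdHeight N := by
  ext i
  rw [stdHeight]
  by_cases hi : i < N
  · have h2 := hh.mod_two i hi.le
    have h3 := hh.nonneg i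
    have h4 := h1 i
    split_ifs <;> omega
  · rw [hh.eq_zero i (by omega), if_neg (by omega)]

theorem fits_stdMatching_iff {r : ℕ} {N : ℕ} (hN : Even N) {h : ℕ → ℤ}
    (hh : IsPath r N h) : Fits (stdMatching N hN) h ↔ h = stdHeight N := by
  have hN' := Nat.even_iff.1 hN
  constructor
  · intro hfit
    have heven : ∀ i, 2 * i ≤ N → h (2 * i) = 0 := by
      intro i
      induction i with
      | zero => exact fun _ => hh.zero
      | succ i ih =>
        intro hi
        have := hfit ⟨2 * i, by omega⟩
        rw [stdMatching_partner N hN (y := ⟨2 * i + 1, by omega⟩) rfl (by simp)] at this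
        have ih := ih (by omega)
        simp only [show 2 * i + 1 + 1 = 2 * (i + 1) by ring] at this
        omega
    refine hh.eq_stdHeight fun i => ?_
    by_cases hi : i < N
    · rcases Nat.mod_two_eq_zero_or_one i with h0 | h0
      · have := heven (i / 2) (by omega)
        rw [show 2 * (i / 2) = i by omega] at this
        omega
      · have := heven (i / 2) (by omega)
        have hs := hh.step (2 * (i / 2)) (by omega)
        rw [show 2 * (i / 2) + 1 = i by omega] at hs
        omega
    · rw [hh.eq_zero i (by omega)]
      omega
  · rintro rfl z
    have hz := z.isLt
    rcases Nat.mod_two_eq_zero_or_one z with h0 | h0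
    · rw [stdMatching_partner N hN (y := ⟨z + 1, by omega⟩) rfl h0]
      simp only [stdHeight]
      split_ifs <;> omega
    · have e := stdMatching_partner N hN (x := ⟨z - 1, by omega⟩) (y := z) (by simp only; omega)
        (by simp only; omega)
      rw [(stdMatching N hN).partner_eq_comm.1 e]
      simp only [stdHeight]
      split_ifs <;> omega

theorem prod_openWeight_stdMatching {r : ℕ} (hr : 2 ≤ r) {N M : ℕ} (hN : Even N)
    (hM : N = 2 * M) :
    ∏ x, openWeight r (stdMatching N hN) (stdHeight N) x = sqdim r 1 ^ M := by
  have e : ∀ x : Fin N, openWeight r (stdMatching N hN) (stdHeight N) x =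
      if (x : ℕ) % 2 = 0 then sqdim r 1 else 1 := by
    intro z
    have hz := z.isLt
    have s0 : sqdim r 0 = 1 := by rw [sqdim, qdim, zero_add, quantumInt_one hr, Real.sqrt_one]
    rcases Nat.mod_two_eq_zero_or_one z with h0 | h0
    · rw [openWeight, stdMatching_partner N hN (y := ⟨z + 1, by omega⟩) rfl h0,
        if_pos (Fin.lt_def.2 (by simp only; omega)), if_pos h0, stdHeight, stdHeight,
        if_pos (by omega), if_neg (by omega), s0, div_one]
    · have e := stdMatching_partner N hN (x := ⟨z - 1, by omega⟩) (y := z) (by simp only; omega)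
        (by simp only; omega)
      rw [openWeight, (stdMatching N hN).partner_eq_comm.1 e,
        if_neg (by rw [Fin.lt_def]; simp only; omega), if_neg (by omega)]
  rw [Finset.prod_congr rfl fun x _ => e x,
    Fin.prod_univ_eq_prod_range (fun i => if i % 2 = 0 then sqdim r 1 else 1) N, hM]
  clear e hM hN
  induction M with
  | zero => simp
  | succ M ih =>
    rw [show 2 * (M + 1) = 2 * M + 1 + 1 by ring, Finset.prod_range_succ, Finset.prod_range_succ,
      ih, if_pos (by omega), if_neg (by omega), mul_one, pow_succ]

theorem matchingVec_stdMatching {r : ℕ} (hr : 3 ≤ r) {N M : ℕ} (hN : Even N) (hM : N = 2 * M)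
    (h : Path r N) : matchingVec r (stdMatching N hN) h.1 =
      if h = ⟨stdHeight N, isPath_stdHeight hr hN⟩ then sqdim r 1 ^ M else 0 := by
  rw [matchingVec]
  by_cases hh : h = ⟨stdHeight N, isPath_stdHeight hr hN⟩
  · rw [if_pos hh, if_pos ((fits_stdMatching_iff hN h.2).2 (congrArg Subtype.val hh)), hh,
      prod_openWeight_stdMatching (by omega) hN hM]
  · rw [if_neg hh, if_neg fun hf => hh (Subtype.ext ((fits_stdMatching_iff hN h.2).1 hf))]

theorem loops_stdMatching {N M : ℕ} (hN : Even N) (hM : N = 2 * M) :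
    loops (stdMatching N hN) (stdMatching N hN) = M := by
  have val : ∀ z : Fin N, ((stdMatching N hN).partner z : ℕ) =
      if (z : ℕ) % 2 = 0 then (z : ℕ) + 1 else z - 1 := fun _ => rfl
  rw [loops, ← Nat.card_fin M]
  refine Nat.card_congr ⟨Quotient.lift (fun z => (⟨z / 2, by omega⟩ : Fin M)) ?_,
    fun i => Quotient.mk _ ⟨2 * i, by omega⟩, ?_, ?_⟩
  · intro z w hzw
    change SameLoop _ _ z w at hzw
    induction hzw with
    | refl a => rfl
    | symm a b _ ih => exact ih.symm
    | trans a b c _ _ ih ih' => exact ih.trans ih'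
    | rel a b hab =>
      rw [or_self] at hab
      subst hab
      ext
      simp only [val]
      split_ifs <;> omega
  · intro q
    induction q using Quotient.inductionOn with
    | h z =>
      rcases Nat.mod_two_eq_zero_or_one z with h0 | h0
      · exact congrArg (Quotient.mk _) (Fin.ext (show 2 * ((z : ℕ) / 2) = z by omega))
      · refine Quotient.sound (SameLoop.symm ?_)
        have := SameLoop.left (stdMatching N hN) (stdMatching N hN) z
        convert this using 1
        ext
        change 2 * ((z : ℕ) / 2) = _
        rw [val, if_neg (by omega)]
        omega
  · intro i
    ext
    simp

/-! ### The map to the path model is isometric -/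

/-- The inner product of two matchings in the path model. -/
noncomputable def matchingInner (r : ℕ) {N : ℕ} (f g : PlanarMatching N) : ℂ :=
  ∑ h : Path r N, (matchingVec r f h.1 : ℂ) * (matchingVec r g h.1 : ℂ)

theorem arcWeight_mul_matchingVec {r : ℕ} (hr : 2 ≤ r) {N : ℕ} (f : PlanarMatching N)
    {x y : Fin N} (hxy : (x : ℕ) + 1 = y) (h : Path r N) :
    arcWeight r f x y * (matchingVec r (glueArc f x y hxy) h.1 : ℂ) =
      ∑ k : Path r N, (pathEntry r x h.1 k.1 : ℂ) * (matchingVec r f k.1 : ℂ) := by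
  have := congrFun (toPaths_cupCap hr (show (x : ℕ) + 1 < N by omega) (Pi.single f 1)) h
  rw [cupCap_single r N f x y hxy, map_smul, Pi.smul_apply, toPaths_single, pathOp_apply] at this
  simpa only [toPaths_single, smul_eq_mul] using this

theorem arcWeight_mul_matchingInner {r : ℕ} (hr : 2 ≤ r) {N : ℕ} (f g : PlanarMatching N)
    {x y : Fin N} (hxy : (x : ℕ) + 1 = y) :
    arcWeight r f x y * matchingInner r (glueArc f x y hxy) g =
      arcWeight r g x y * matchingInner r f (glueArc g x y hxy) := by
  rw [matchingInner, matchingInner, Finset.mul_sum, Finset.mul_sum]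
  simp only [← mul_assoc, arcWeight_mul_matchingVec hr f hxy]
  simp only [mul_left_comm (arcWeight r g x y), mul_assoc,
    arcWeight_mul_matchingVec hr g hxy, Finset.sum_mul, Finset.mul_sum]
  rw [Finset.sum_comm]
  refine Finset.sum_congr rfl fun h _ => Finset.sum_congr rfl fun k _ => ?_
  rw [pathEntry_symm]
  ring

theorem matchingInner_stdMatching {r : ℕ} (hr : 3 ≤ r) {N : ℕ} (hN : Even N)
    (f : PlanarMatching N) :
    matchingInner r f (stdMatching N hN) = loopValue r ^ loops f (stdMatching N hN) := by
  obtain ⟨M, hM⟩ := hN.two_dvd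
  have hδ := loopValue_ne_zero hr
  have main : ∀ d k, k + d = M → ∀ f : PlanarMatching N, f.StdBelow k →
      matchingInner r f (stdMatching N hN) = loopValue r ^ loops f (stdMatching N hN) := by
    intro d
    induction d with
    | zero =>
      intro k hk f hf
      rw [PlanarMatching.eq_stdMatching hN (by omega) hf, loops_stdMatching hN hM, matchingInner,
        Finset.sum_eq_single ⟨stdHeight N, isPath_stdHeight hr hN⟩, matchingVec_stdMatching hr hN hM,
        if_pos rfl, loopValue_eq (by omega), ← Complex.ofReal_mul, ← mul_pow,
        sqdim_mul_self (by omega) (by omega), Complex.ofReal_pow]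
      · rfl
      · intro h _ hne
        rw [matchingVec_stdMatching hr hN hM, if_neg hne, Complex.ofReal_zero, zero_mul]
      · simp
    | succ d ih =>
      intro k hk f hf
      let x : Fin N := ⟨2 * k, by omega⟩
      let y : Fin N := ⟨2 * k + 1, by omega⟩
      have hxy : (x : ℕ) + 1 = y := rfl
      have hx : (x : ℕ) = 2 * k := rfl
      have hglue : (glueArc f x y hxy).StdBelow (k + 1) := by
        intro z w hzw hz hzk
        by_cases hzk' : (z : ℕ) < 2 * k
        · exact hf.glueArc (by omega) hxy hx.ge z w hzw hz hzk'
        · obtain rfl : z = x := Fin.ext (by omega)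
          obtain rfl : w = y := Fin.ext (by omega)
          exact glueArc_partner_left ..
      have hstd := stdMatching_partner N hN hxy (by omega)
      have e1 := arcWeight_mul_matchingInner (by omega : 2 ≤ r) f (stdMatching N hN) hxy
      have e2 := arcWeight_mul_loops r f (stdMatching N hN) hxy
      rw [ih (k + 1) (by omega) _ hglue, e2] at e1
      have hw := arcWeight_ne_zero hr (stdMatching N hN) x y
      rw [glueArc_of_partner hxy hstd] at e1
      exact (mul_left_cancel₀ hw e1).symm
  exact main M 0 (by omega) f fun x y _ _ h => by omega

theorem matchingInner_eq {r : ℕ} (hr : 3 ≤ r) {N : ℕ} (hN : Even N) (f g : PlanarMatching N) :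
    matchingInner r f g = loopValue r ^ loops f g := by
  revert f
  refine PlanarMatching.induction hN (P := fun g => ∀ f, matchingInner r f g =
    loopValue r ^ loops f g) (matchingInner_stdMatching hr hN) ?_ g
  intro g x y hxy _ ih f
  have e1 := arcWeight_mul_matchingInner (by omega : 2 ≤ r) f g hxy
  rw [ih, arcWeight_mul_loops r f g hxy] at e1
  exact (mul_left_cancel₀ (arcWeight_ne_zero hr g x y) e1).symm

theorem toPaths_apply (r N : ℕ) (v : Skein N) (h : Path r N) :
    toPaths r N v h = ∑ f, v f * (matchingVec r f h.1 : ℂ) := by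
  rw [toPaths, Fintype.linearCombination_apply, Finset.sum_apply]
  rfl

theorem bracketForm_eq_sum {r : ℕ} (hr : 3 ≤ r) {N : ℕ} (hN : Even N) (u v : Skein N) :
    bracketForm r u v = ∑ h : Path r N, toPaths r N u h * conj (toPaths r N v h) := by
  simp only [bracketForm, toPaths_apply, map_sum, map_mul, Complex.conj_ofReal, Finset.sum_mul_sum]
  rw [Finset.sum_comm]
  simp only [← matchingInner_eq hr hN, matchingInner, Finset.mul_sum]
  rw [Finset.sum_comm]
  refine (Finset.sum_congr rfl fun f _ => Finset.sum_comm).trans ?_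
  rw [Finset.sum_comm]
  refine Finset.sum_congr rfl fun h _ => Finset.sum_congr rfl fun f _ =>
    Finset.sum_congr rfl fun g _ => ?_
  ring

/-! ### The map to the path model is surjective -/

/-- The area under a path. -/
def area (N : ℕ) (h : ℕ → ℤ) : ℕ := ∑ i ∈ Finset.range N, (h i).toNat

theorem AgreeOff.area_lt {r N j : ℕ} {h k : ℕ → ℤ} (hh : IsPath r N k) (hk : AgreeOff j h k)
    (hj : j + 1 < N) (hlt : k (j + 1) < h (j + 1)) : area N k < area N h := by
  refine Finset.sum_lt_sum (fun i _ => ?_) ⟨j + 1, Finset.mem_range.2 hj, ?_⟩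
  · by_cases hi : i = j + 1
    · rw [hi]; omega
    · rw [hk i hi]
  · have := hh.nonneg (j + 1)
    omega

theorem AgreeOff.eq_or_lt {r N j : ℕ} {h k : ℕ → ℤ} (hh : IsPath r N k) (hj : j + 1 < N)
    (hk : AgreeOff j h k) (hup : h (j + 1) = h j + 1) :
    k = h ∨ k (j + 1) = h j - 1 := by
  rcases hh.step j (by omega) with e | e
  · left
    exact hk.symm.ext (by rw [e, hup, hk j (by omega)])
  · right
    rw [e, hk j (by omega)]

theorem IsPath.exists_peak {r N : ℕ} {h : ℕ → ℤ} (hh : IsPath r N h) (hne : h ≠ stdHeight N) :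
    ∃ j, j + 1 < N ∧ h j = h (j + 2) ∧ h (j + 1) = h j + 1 ∧ 1 ≤ h j := by
  obtain ⟨i₀, hi₀⟩ : ∃ i, 2 ≤ h i := by
    by_contra hcon
    push Not at hcon
    exact hne (hh.eq_stdHeight fun i => by have := hcon i; omega)
  obtain ⟨i, hi, hmax⟩ := Finset.exists_max_image (Finset.range (N + 1)) h ⟨0, by simp⟩
  rw [Finset.mem_range] at hi
  have hi₀N : i₀ < N + 1 := by
    by_contra hcon
    rw [hh.eq_zero i₀ (by omega)] at hi₀
    omega
  have h2 : 2 ≤ h i := hi₀.trans (hmax i₀ (Finset.mem_range.2 hi₀N))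
  have hi0 : i ≠ 0 := by rintro rfl; rw [hh.zero] at h2; omega
  have hiN : i ≠ N := by rintro rfl; rw [hh.eq_zero i le_rfl] at h2; omega
  obtain ⟨j, rfl⟩ : ∃ j, i = j + 1 := ⟨i - 1, by omega⟩
  have s1 := hh.step j (by omega)
  have s2 := hh.step (j + 1) (by omega)
  have m1 := hmax j (Finset.mem_range.2 (by omega))
  have m2 := hmax (j + 2) (Finset.mem_range.2 (by omega))
  rw [show j + 1 + 1 = j + 2 from rfl] at s2
  exact ⟨j, by omega, by omega, by omega, by omega⟩

theorem toPaths_surjective {r : ℕ} (hr : 3 ≤ r) {N : ℕ} (hN : Even N) :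
    Function.Surjective (toPaths r N) := by
  classical
  obtain ⟨M, hM⟩ := hN.two_dvd
  rw [← LinearMap.range_eq_top]
  have hop : ∀ j, j + 1 < N → ∀ v ∈ LinearMap.range (toPaths r N),
      pathOp r N j v ∈ LinearMap.range (toPaths r N) := by
    rintro j hj _ ⟨v, rfl⟩
    exact ⟨cupCap r N j v, toPaths_cupCap (by omega) hj v⟩
  have hsingle : ∀ A : ℕ, ∀ h : Path r N, area N h.1 = A →
      Pi.single h (1 : ℂ) ∈ LinearMap.range (toPaths r N) := by
    intro A
    induction A using Nat.strong_induction_on with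
    | _ A ih =>
      intro h hA
      by_cases hstd : h.1 = stdHeight N
      · have hs : sqdim r 1 ≠ 0 := (sqdim_pos (by omega) (by omega)).ne'
        have hc : ((sqdim r 1 ^ M : ℝ) : ℂ) ≠ 0 := by exact_mod_cast pow_ne_zero M hs
        refine ⟨((sqdim r 1 ^ M : ℝ) : ℂ)⁻¹ • Pi.single (stdMatching N hN) 1, ?_⟩
        ext k
        rw [map_smul, Pi.smul_apply, toPaths_single, matchingVec_stdMatching hr hN hM]
        have : (k = h) ↔ k = ⟨stdHeight N, isPath_stdHeight hr hN⟩ := by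
          rw [show h = ⟨stdHeight N, isPath_stdHeight hr hN⟩ from Subtype.ext hstd]
        rw [Pi.single_apply]
        simp only [this]
        split_ifs
        · rw [smul_eq_mul, inv_mul_cancel₀ hc]
        · simp
      · obtain ⟨j, hj, hb, hup, h1⟩ := h.2.exists_peak hstd
        have hpath := h.2.update hj hb (c := h.1 j - 1) (Or.inr rfl) (by omega)
          (by have := h.2.le j; omega)
        let k : Path r N := ⟨_, hpath⟩
        have hk : AgreeOff j h.1 k.1 := agreeOff_update j h.1 _
        have hkj : k.1 (j + 1) = h.1 j - 1 := Function.update_self ..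
        have hmem := ih (area N k.1) (hA ▸ hk.area_lt k.2 hj (by omega)) k rfl
        have hentry : pathEntry r j h.1 k.1 ≠ 0 := by
          rw [pathEntry, if_pos ⟨hb, hk⟩]
          exact (div_pos (mul_pos (h.2.sqdim_pos _) (k.2.sqdim_pos _)) (h.2.qdim_pos _)).ne'
        have hhk : h ≠ k := fun e => by
          have := congrArg (fun p : Path r N => p.1 (j + 1)) e
          change h.1 (j + 1) = k.1 (j + 1) at this
          omega
        have e : Pi.single h (1 : ℂ) = (pathEntry r j h.1 k.1 : ℂ)⁻¹ •
            (pathOp r N j (Pi.single k 1) - (pathEntry r j k.1 k.1 : ℂ) • Pi.single k 1) := by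
          ext l
          have hop' : pathOp r N j (Pi.single k 1) l = (pathEntry r j l.1 k.1 : ℂ) := by
            rw [pathOp_apply, Finset.sum_eq_single k]
            · simp
            · intro b _ hbk; simp [hbk]
            · simp
          simp only [Pi.smul_apply, Pi.sub_apply, smul_eq_mul, hop']
          by_cases hlh : l = h
          · subst hlh
            rw [Pi.single_eq_same, Pi.single_eq_of_ne hhk, mul_zero, sub_zero, inv_mul_cancel₀]
            exact_mod_cast hentry
          by_cases hlk : l = k
          · rw [hlk, Pi.single_eq_same, Pi.single_eq_of_ne hhk.symm, mul_one, sub_self, mul_zero]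
          · suffices hz : ¬ (l.1 j = l.1 (j + 2) ∧ AgreeOff j l.1 k.1) by
              rw [Pi.single_eq_of_ne hlh, Pi.single_eq_of_ne hlk, mul_zero, sub_zero,
                pathEntry.eq_def r j l.1, if_neg hz, Complex.ofReal_zero, mul_zero]
            rintro ⟨-, hlk'⟩
            have hhl : AgreeOff j h.1 l.1 := fun i hi => (hk i hi).trans (hlk' i hi).symm
            rcases hhl.eq_or_lt l.2 hj hup with e | e
            · exact hlh (Subtype.ext e)
            · exact hlk (Subtype.ext (hlk'.ext (e.trans hkj.symm)))
        rw [e]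
        exact Submodule.smul_mem _ _ (Submodule.sub_mem _ (hop j hj _ hmem)
          (Submodule.smul_mem _ _ hmem))
  rw [Submodule.eq_top_iff']
  intro v
  rw [← Finset.univ_sum_single v]
  refine Submodule.sum_mem _ fun h _ => ?_
  rw [show Pi.single h (v h) = v h • Pi.single h (1 : ℂ) by rw [← Pi.single_smul]; simp]
  exact Submodule.smul_mem _ _ (hsingle _ h rfl)

/-! ### Vectors annihilated by the last generators -/

theorem IsPath.le_of_add {r N : ℕ} {h : ℕ → ℤ} (hh : IsPath r N h) :
    ∀ m n, n + m = N → h n ≤ m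
  | 0, n, e => by rw [hh.eq_zero n (by omega)]; simp
  | m + 1, n, e => by
    have := hh.le_of_add m (n + 1) (by omega)
    have := hh.step n (by omega)
    push_cast
    omega

/-- A path at height `m` at time `m` before its end descends directly. -/
theorem IsPath.descent {r n m : ℕ} {h : ℕ → ℤ} (hh : IsPath r (n + m) h) (hend : h n = m) :
    ∀ l ≤ m, h (n + l) = m - l
  | 0, _ => by simpa using hend
  | l + 1, hl => by
    have h1 := hh.descent hend l (by omega)
    have h2 := hh.step (n + l) (by omega)
    have h3 := hh.le_of_add (m - (l + 1)) (n + (l + 1)) (by omega)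
    rw [show n + l + 1 = n + (l + 1) by ring] at h2
    push_cast
    omega

/-- A path which does not descend directly from time `n` on has a peak after time `n`. -/
theorem IsPath.exists_peak_of_ne {r : ℕ} {N : ℕ} {h : ℕ → ℤ} (hh : IsPath r N h) :
    ∀ m n, n + m = N → h n ≠ m →
      ∃ j, n ≤ j ∧ j + 1 < N ∧ h j = h (j + 2) ∧ h (j + 1) = h j + 1
  | 0, n, e, hne => by
    rw [hh.eq_zero n (by omega)] at hne
    simp at hne
  | m + 1, n, e, hne => by
    have hs := hh.step n (by omega)
    by_cases h1 : h (n + 1) = m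
    · have hup : h (n + 1) = h n + 1 := by push_cast at hne; omega
      rcases Nat.eq_zero_or_pos m with rfl | hm
      · have := hh.nonneg n
        simp at h1
        omega
      · have hs' := hh.step (n + 1) (by omega)
        have hle := hh.le_of_add (m - 1) (n + 2) (by omega)
        rw [show n + 1 + 1 = n + 2 from rfl] at hs'
        exact ⟨n, le_rfl, by omega, by omega, hup⟩
    · obtain ⟨j, hj1, hj2, hj3, hj4⟩ := hh.exists_peak_of_ne m (n + 1) (by omega) h1
      exact ⟨j, by omega, hj2, hj3, hj4⟩

theorem eq_zero_of_pathOp {r n m : ℕ} {v : Path r (n + m) → ℂ}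
    (hv : ∀ j, n ≤ j → j + 1 < n + m → pathOp r (n + m) j v = 0) (h : Path r (n + m))
    (hne : h.1 n ≠ m) : v h = 0 := by
  have main : ∀ A : ℕ, ∀ h : Path r (n + m), area (n + m) h.1 = A → h.1 n ≠ m → v h = 0 := by
    intro A
    induction A using Nat.strong_induction_on with
    | _ A ih =>
      intro h hA hne
      obtain ⟨j, hnj, hj, hb, hup⟩ := h.2.exists_peak_of_ne m n rfl hne
      have e := congrFun (hv j hnj hj) h
      rw [pathOp_apply, Finset.sum_eq_single h] at e
      · refine (mul_eq_zero.1 e).resolve_left ?_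
        rw [pathEntry, if_pos ⟨hb, fun _ _ => rfl⟩]
        exact_mod_cast
          (div_pos (mul_pos (h.2.sqdim_pos _) (h.2.sqdim_pos _)) (h.2.qdim_pos _)).ne'
      · intro k _ hkh
        by_cases hk : AgreeOff j h.1 k.1
        · rcases hk.eq_or_lt k.2 hj hup with e' | e'
          · exact absurd (Subtype.ext e') hkh
          · rw [ih (area (n + m) k.1) (hA ▸ hk.area_lt k.2 hj (by omega)) k rfl
              (by rw [← hk n (by omega)]; exact hne), mul_zero]
        · rw [pathEntry, if_neg (fun h => hk h.2), Complex.ofReal_zero, zero_mul]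
      · simp
  exact main _ h rfl hne

theorem pathOp_eq_zero {r n m : ℕ} {v : Path r (n + m) → ℂ}
    (hv : ∀ h : Path r (n + m), h.1 n ≠ m → v h = 0) {j : ℕ} (hnj : n ≤ j) (hj : j + 1 < n + m) :
    pathOp r (n + m) j v = 0 := by
  ext h
  rw [pathOp_apply, Pi.zero_apply]
  refine Finset.sum_eq_zero fun k _ => ?_
  by_cases hk : k.1 n = m
  · rw [pathEntry, if_neg, Complex.ofReal_zero, zero_mul]
    rintro ⟨hb, hagree⟩
    rw [hagree j (by omega), hagree (j + 2) (by omega)] at hb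
    have d1 := k.2.descent hk (j - n) (by omega)
    have d2 := k.2.descent hk (j + 2 - n) (by omega)
    rw [show n + (j - n) = j by omega] at d1
    rw [show n + (j + 2 - n) = j + 2 by omega] at d2
    omega
  · rw [hv k hk, mul_zero]

/-! ### Counting entries in rows -/

/-- The number of entries before the `k`-th which are in row `i`, for the row sequence `ρ`. -/
def rowCount {n : ℕ} (ρ : Fin n → ℕ) (i k : ℕ) : ℕ :=
  (Finset.univ.filter fun a : Fin n => (a : ℕ) < k ∧ ρ a = i).card

theorem rowCount_zero {n : ℕ} (ρ : Fin n → ℕ) (i : ℕ) : rowCount ρ i 0 = 0 := by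
  simp [rowCount]

theorem rowCount_mono {n : ℕ} (ρ : Fin n → ℕ) (i : ℕ) {k l : ℕ} (h : k ≤ l) :
    rowCount ρ i k ≤ rowCount ρ i l :=
  Finset.card_le_card fun a ha => by
    simp only [Finset.mem_filter, Finset.mem_univ, true_and] at ha ⊢
    exact ⟨by omega, ha.2⟩

theorem rowCount_succ_of_eq {n : ℕ} (ρ : Fin n → ℕ) (a : Fin n) {i : ℕ} (h : ρ a = i) :
    rowCount ρ i (a + 1) = rowCount ρ i a + 1 := by
  classical
  have : (Finset.univ.filter fun b : Fin n => (b : ℕ) < a + 1 ∧ ρ b = i) =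
      insert a (Finset.univ.filter fun b : Fin n => (b : ℕ) < a ∧ ρ b = i) := by
    ext b
    simp only [Finset.mem_filter, Finset.mem_univ, true_and, Finset.mem_insert, Fin.ext_iff]
    constructor
    · rintro ⟨h1, h2⟩
      by_cases hb : (b : ℕ) = a
      · exact Or.inl hb
      · exact Or.inr ⟨by omega, h2⟩
    · rintro (h1 | ⟨h1, h2⟩)
      · rw [Fin.ext h1]
        exact ⟨by omega, h⟩
      · exact ⟨by omega, h2⟩
  rw [rowCount, this, Finset.card_insert_of_notMem (by simp)]
  rfl

theorem rowCount_succ_of_ne {n : ℕ} (ρ : Fin n → ℕ) (a : Fin n) {i : ℕ} (h : ρ a ≠ i) :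
    rowCount ρ i (a + 1) = rowCount ρ i a := by
  rw [rowCount, rowCount]
  congr 1
  ext b
  simp only [Finset.mem_filter, Finset.mem_univ, true_and]
  constructor
  · rintro ⟨h1, h2⟩
    have : (b : ℕ) ≠ a := fun e => h (by rw [← Fin.ext e, h2])
    exact ⟨by omega, h2⟩
  · rintro ⟨h1, h2⟩
    exact ⟨by omega, h2⟩

theorem rowCount_lt {n : ℕ} (ρ : Fin n → ℕ) (a : Fin n) {k : ℕ} (h : (a : ℕ) < k) :
    rowCount ρ (ρ a) a < rowCount ρ (ρ a) k := by
  have h1 := rowCount_succ_of_eq ρ a rfl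
  have h2 := rowCount_mono ρ (ρ a) (show (a : ℕ) + 1 ≤ k from h)
  omega

theorem rowCount_add {n : ℕ} {ρ : Fin n → ℕ} (hρ : ∀ a, ρ a = 0 ∨ ρ a = 1) :
    ∀ k ≤ n, rowCount ρ 0 k + rowCount ρ 1 k = k
  | 0, _ => by simp [rowCount_zero]
  | k + 1, hk => by
    have ih := rowCount_add hρ k (by omega)
    rcases hρ ⟨k, hk⟩ with h | h
    · have h1 := rowCount_succ_of_eq ρ ⟨k, hk⟩ h
      have h2 := rowCount_succ_of_ne ρ ⟨k, hk⟩ (i := 1) (by omega)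
      simp only at h1 h2
      omega
    · have h1 := rowCount_succ_of_eq ρ ⟨k, hk⟩ h
      have h2 := rowCount_succ_of_ne ρ ⟨k, hk⟩ (i := 0) (by omega)
      simp only at h1 h2
      omega

theorem exists_rowCount_eq {n : ℕ} (ρ : Fin n → ℕ) {i c : ℕ} :
    ∀ k ≤ n, c < rowCount ρ i k → ∃ a : Fin n, (a : ℕ) < k ∧ ρ a = i ∧ rowCount ρ i a = c
  | 0, _, hc => by simp [rowCount_zero] at hc
  | k + 1, hk, hc => by
    by_cases hck : c < rowCount ρ i k
    · obtain ⟨a, h1, h2⟩ := exists_rowCount_eq ρ k (by omega) hck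
      exact ⟨a, by omega, h2⟩
    · by_cases h : ρ ⟨k, hk⟩ = i
      · have h1 := rowCount_succ_of_eq ρ ⟨k, hk⟩ h
        simp only at h1
        exact ⟨⟨k, hk⟩, by simp, h, by simp only; omega⟩
      · have h1 := rowCount_succ_of_ne ρ ⟨k, hk⟩ h
        simp only at h1
        omega

theorem rowCount_swap {n : ℕ} {ρ ρ' : Fin n → ℕ} {a b : Fin n} (hab : (a : ℕ) + 1 = b)
    (h : ∀ c, ρ' c = ρ (Equiv.swap a b c)) (i : ℕ) {k : ℕ} (hk : k ≠ b) :
    rowCount ρ' i k = rowCount ρ i k := by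
  refine Finset.card_equiv (Equiv.swap a b) fun c => ?_
  simp only [Finset.mem_filter, Finset.mem_univ, true_and, h]
  refine and_congr ?_ Iff.rfl
  rw [Equiv.swap_apply_def]
  split_ifs with h1 h2
  · rw [h1]; omega
  · rw [h2]; omega
  · rfl

/-! ### Tableaux and their row sequences -/

theorem mem_twoRowDiagram {A B : ℕ} (h : B ≤ A) {c : ℕ × ℕ} :
    c ∈ (twoRowDiagram A B h).cells ↔ c.1 = 0 ∧ c.2 < A ∨ c.1 = 1 ∧ c.2 < B := by
  rw [YoungDiagram.mem_cells, twoRowDiagram, YoungDiagram.mem_ofRowLens]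
  obtain ⟨i, j⟩ := c
  rcases i with _ | _ | i <;> simp

/-- The row of an entry of a tableau. -/
def StdTableau.row {μ : YoungDiagram} {n : ℕ} (t : StdTableau μ n) (a : Fin n) : ℕ :=
  (t.cell a).1.1

theorem StdTableau.rowLen_eq {μ : YoungDiagram} {n : ℕ} (t : StdTableau μ n) {k : ℕ}
    {ν : YoungDiagram} (hν : ν.cells = t.remaining k) (i : ℕ) :
    ν.rowLen i = rowCount t.row i k := by
  have hinj : Function.Injective fun a : Fin n => (t.cell a).1 :=
    Subtype.val_injective.comp t.cell.injective
  rw [YoungDiagram.rowLen_eq_card, YoungDiagram.row, hν, StdTableau.remaining, Finset.filter_image,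
    Finset.card_image_of_injective _ hinj, Finset.filter_filter]
  rfl

section Tab

variable {r n : ℕ} {μ : YoungDiagram}

theorem Tab.col_eq (t : Tab r μ n) (a : Fin n) :
    (t.1.cell a).1.2 = rowCount t.1.row (t.1.row a) a := by
  obtain ⟨ν, hν, -⟩ := t.2 a a.isLt.le
  obtain ⟨ν', hν', -⟩ := t.2 (a + 1) a.isLt
  have hcell : (t.1.cell a).1 = (t.1.row a, (t.1.cell a).1.2) := rfl
  have h1 : (t.1.cell a).1 ∈ ν'.cells := by
    rw [hν', StdTableau.remaining, Finset.mem_image]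
    exact ⟨a, by simp, rfl⟩
  have h2 : (t.1.cell a).1 ∉ ν.cells := by
    rw [hν, StdTableau.remaining, Finset.mem_image]
    rintro ⟨b, hb, e⟩
    have : b = a := t.1.cell.injective (Subtype.ext e)
    simp [this] at hb
  rw [YoungDiagram.mem_cells, hcell, YoungDiagram.mem_iff_lt_rowLen, t.1.rowLen_eq hν',
    rowCount_succ_of_eq _ _ rfl] at h1
  rw [YoungDiagram.mem_cells, hcell, YoungDiagram.mem_iff_lt_rowLen, t.1.rowLen_eq hν] at h2
  omega

theorem Tab.cell_eq (t : Tab r μ n) (a : Fin n) :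
    (t.1.cell a).1 = (t.1.row a, rowCount t.1.row (t.1.row a) a) :=
  Prod.ext rfl (t.col_eq a)

theorem Tab.ext_row {s t : Tab r μ n} (h : ∀ a, s.1.row a = t.1.row a) : s = t := by
  refine Subtype.ext (StdTableau.ext (Equiv.ext fun a => Subtype.ext ?_))
  rw [s.cell_eq, t.cell_eq, funext h]

theorem Tab.rowCount_bounds (t : Tab r μ n) {k : ℕ} (hk : k ≤ n) :
    rowCount t.1.row 1 k ≤ rowCount t.1.row 0 k ∧
      (rowCount t.1.row 0 k : ℤ) - rowCount t.1.row 1 k + 2 ≤ r := by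
  obtain ⟨ν, hν, h1, h2⟩ := t.2 k hk
  rw [t.1.rowLen_eq hν, t.1.rowLen_eq hν] at h2
  refine ⟨?_, by omega⟩
  rw [← t.1.rowLen_eq hν, ← t.1.rowLen_eq hν]
  exact ν.rowLen_anti 0 1 (by omega)

end Tab

/-! ### Tableaux and paths -/

section TabPath

variable {r n m A B : ℕ} {hBA : B ≤ A}

theorem StdTableau.row_eq (t : StdTableau (twoRowDiagram A B hBA) n) (a : Fin n) :
    t.row a = 0 ∨ t.row a = 1 := by
  have := (mem_twoRowDiagram hBA).1 (t.cell a).2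
  rw [StdTableau.row]
  omega

theorem StdTableau.rowCount_total (t : StdTableau (twoRowDiagram A B hBA) n) :
    rowCount t.row 0 n = A ∧ rowCount t.row 1 n = B := by
  have hν : (twoRowDiagram A B hBA).cells = t.remaining n := by
    ext c
    rw [StdTableau.remaining, Finset.mem_image]
    constructor
    · intro hc
      exact ⟨t.cell.symm ⟨c, hc⟩, by simp, by simp⟩
    · rintro ⟨a, -, rfl⟩
      exact (t.cell a).2
  rw [← t.rowLen_eq hν, ← t.rowLen_eq hν]
  constructor
  · refine Nat.le_antisymm (le_of_not_gt fun h => ?_) (le_of_not_gt fun h => ?_)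
    · rw [← YoungDiagram.mem_iff_lt_rowLen, ← YoungDiagram.mem_cells, mem_twoRowDiagram] at h
      simp at h
    · have := (mem_twoRowDiagram hBA (c := (0, (twoRowDiagram A B hBA).rowLen 0))).2
        (Or.inl ⟨rfl, h⟩)
      rw [YoungDiagram.mem_cells, YoungDiagram.mem_iff_lt_rowLen] at this
      exact lt_irrefl _ this
  · refine Nat.le_antisymm (le_of_not_gt fun h => ?_) (le_of_not_gt fun h => ?_)
    · rw [← YoungDiagram.mem_iff_lt_rowLen, ← YoungDiagram.mem_cells, mem_twoRowDiagram] at h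
      simp at h
    · have := (mem_twoRowDiagram hBA (c := (1, (twoRowDiagram A B hBA).rowLen 1))).2
        (Or.inr ⟨rfl, h⟩)
      rw [YoungDiagram.mem_cells, YoungDiagram.mem_iff_lt_rowLen] at this
      exact lt_irrefl _ this

/-- The difference of the row lengths of the truncations of a tableau, followed by a descent
from `m` to `0`. -/
def tabHeight (m : ℕ) {μ : YoungDiagram} (t : StdTableau μ n) (k : ℕ) : ℤ :=
  if k < n then (rowCount t.row 0 k : ℤ) - rowCount t.row 1 k else ((n + m - k : ℕ) : ℤ)

theorem tabHeight_of_le (hm : A = B + m) (t : StdTableau (twoRowDiagram A B hBA) n) {k : ℕ}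
    (hk : k ≤ n) : tabHeight m t k = (rowCount t.row 0 k : ℤ) - rowCount t.row 1 k := by
  rw [tabHeight]
  split_ifs with h
  · rfl
  · obtain rfl : k = n := by omega
    rw [t.rowCount_total.1, t.rowCount_total.2]
    omega

theorem tabHeight_succ_of_row_zero (hm : A = B + m) (t : StdTableau (twoRowDiagram A B hBA) n)
    {a : Fin n} (ha : t.row a = 0) : tabHeight m t (a + 1) = tabHeight m t a + 1 := by
  rw [tabHeight_of_le hm t a.isLt, tabHeight_of_le hm t a.isLt.le, rowCount_succ_of_eq _ _ ha,
    rowCount_succ_of_ne _ _ (by omega)]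
  push_cast
  ring

theorem tabHeight_succ_of_row_one (hm : A = B + m) (t : StdTableau (twoRowDiagram A B hBA) n)
    {a : Fin n} (ha : t.row a = 1) : tabHeight m t (a + 1) = tabHeight m t a - 1 := by
  rw [tabHeight_of_le hm t a.isLt, tabHeight_of_le hm t a.isLt.le, rowCount_succ_of_eq _ _ ha,
    rowCount_succ_of_ne _ _ (by omega)]
  push_cast
  ring

theorem isPath_tabHeight (hm : A = B + m) (hmr : m + 2 ≤ r)
    (t : Tab r (twoRowDiagram A B hBA) n) : IsPath r (n + m) (tabHeight m t.1) where
  zero := by rw [tabHeight_of_le hm _ (Nat.zero_le _), rowCount_zero, rowCount_zero]; rfl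
  step i hi := by
    by_cases hin : i < n
    · rcases t.1.row_eq ⟨i, hin⟩ with h | h
      · exact Or.inl (tabHeight_succ_of_row_zero hm t.1 h)
      · exact Or.inr (tabHeight_succ_of_row_one hm t.1 h)
    · rw [tabHeight, tabHeight, if_neg (by omega), if_neg hin]
      omega
  nonneg i := by
    by_cases hin : i ≤ n
    · rw [tabHeight_of_le hm _ hin]
      have := (t.rowCount_bounds hin).1
      omega
    · rw [tabHeight, if_neg (by omega)]
      omega
  le i := by
    by_cases hin : i ≤ n
    · rw [tabHeight_of_le hm _ hin]
      exact (t.rowCount_bounds hin).2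
    · rw [tabHeight, if_neg (by omega)]
      omega
  eq_zero i hi := by
    by_cases hin : i ≤ n
    · obtain rfl : i = n := by omega
      obtain rfl : m = 0 := by omega
      rw [tabHeight, if_neg (by omega)]
      omega
    · rw [tabHeight, if_neg (by omega)]
      omega

/-- The path of a tableau. -/
def tabPath (hm : A = B + m) (hmr : m + 2 ≤ r) (t : Tab r (twoRowDiagram A B hBA) n) :
    Path r (n + m) :=
  ⟨tabHeight m t.1, isPath_tabHeight hm hmr t⟩

theorem tabPath_end (hm : A = B + m) (hmr : m + 2 ≤ r) (t : Tab r (twoRowDiagram A B hBA) n) :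
    (tabPath hm hmr t).1 n = m := by
  change tabHeight m t.1 n = m
  rw [tabHeight, if_neg (by omega)]
  omega

theorem row_eq_iff (hm : A = B + m) (t : StdTableau (twoRowDiagram A B hBA) n) (a : Fin n) :
    t.row a = if tabHeight m t (a + 1) = tabHeight m t a + 1 then 0 else 1 := by
  rcases t.row_eq a with h | h
  · rw [if_pos (tabHeight_succ_of_row_zero hm t h), h]
  · rw [if_neg, h]
    rw [tabHeight_succ_of_row_one hm t h]
    omega

theorem tabPath_injective (hm : A = B + m) (hmr : m + 2 ≤ r) :
    Function.Injective (tabPath (n := n) (hBA := hBA) hm hmr) := by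
  intro s t h
  have h' : tabHeight m s.1 = tabHeight m t.1 := congrArg Subtype.val h
  refine Tab.ext_row fun a => ?_
  rw [row_eq_iff hm, row_eq_iff hm, h']

/-- The row sequence of a path. -/
def pathRow (n : ℕ) (h : ℕ → ℤ) (a : Fin n) : ℕ := if h (a + 1) = h a + 1 then 0 else 1

theorem pathRow_eq (h : ℕ → ℤ) (a : Fin n) : pathRow n h a = 0 ∨ pathRow n h a = 1 := by
  rw [pathRow]
  split_ifs <;> simp

theorem IsPath.rowCount_sub {N : ℕ} {h : ℕ → ℤ} (hh : IsPath r N h) (hn : n ≤ N) :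
    ∀ k ≤ n, (rowCount (pathRow n h) 0 k : ℤ) - rowCount (pathRow n h) 1 k = h k
  | 0, _ => by rw [rowCount_zero, rowCount_zero, hh.zero]; rfl
  | k + 1, hk => by
    have ih := hh.rowCount_sub hn k (by omega)
    have hs := hh.step k (by omega)
    by_cases h0 : h (k + 1) = h k + 1
    · have e : pathRow n h ⟨k, hk⟩ = 0 := if_pos h0
      have h1 := rowCount_succ_of_eq _ _ e
      have h2 := rowCount_succ_of_ne (i := 1) (pathRow n h) ⟨k, hk⟩ (by omega)
      simp only at h1 h2
      omega
    · have e : pathRow n h ⟨k, hk⟩ = 1 := if_neg h0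
      have h1 := rowCount_succ_of_eq _ _ e
      have h2 := rowCount_succ_of_ne (i := 0) (pathRow n h) ⟨k, hk⟩ (by omega)
      simp only at h1 h2
      omega

theorem tabPath_surjective (hm : A = B + m) (hn : n = A + B) (hmr : m + 2 ≤ r)
    (h : Path r (n + m)) (hend : h.1 n = m) :
    ∃ t : Tab r (twoRowDiagram A B hBA) n, tabPath hm hmr t = h := by
  set ρ := pathRow n h.1 with hρ
  have hrow : ∀ a, ρ a = 0 ∨ ρ a = 1 := pathRow_eq h.1
  have hsub := h.2.rowCount_sub (n := n) (by omega)
  have hadd := rowCount_add hrow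
  have tot := hsub n le_rfl
  have tot' := hadd n le_rfl
  rw [← hρ, hend] at tot
  have tA : rowCount ρ 0 n = A := by omega
  have tB : rowCount ρ 1 n = B := by omega
  have hnonneg : ∀ k ≤ n, rowCount ρ 1 k ≤ rowCount ρ 0 k := fun k hk => by
    have := hsub k hk
    have := h.2.nonneg k
    rw [← hρ] at *
    omega
  have hmem : ∀ a : Fin n, (ρ a, rowCount ρ (ρ a) a) ∈ (twoRowDiagram A B hBA).cells := by
    intro a
    have := rowCount_lt ρ a a.isLt
    rw [mem_twoRowDiagram]
    rcases hrow a with e | e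
    · rw [e] at this ⊢
      exact Or.inl ⟨rfl, by simp only; omega⟩
    · rw [e] at this ⊢
      exact Or.inr ⟨rfl, by simp only; omega⟩
  have hbij : Function.Bijective fun a : Fin n =>
      (⟨(ρ a, rowCount ρ (ρ a) a), hmem a⟩ : {c : ℕ × ℕ // c ∈ (twoRowDiagram A B hBA).cells}) := by
    constructor
    · intro a b hab
      have hab' := congrArg Subtype.val hab
      simp only [Prod.mk.injEq] at hab'
      obtain ⟨h1, h2⟩ := hab'
      rcases lt_trichotomy a b with hlt | rfl | hlt
      · have := rowCount_lt ρ a hlt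
        rw [h2, h1] at this
        exact absurd this (lt_irrefl _)
      · rfl
      · have := rowCount_lt ρ b hlt
        rw [← h2, h1] at this
        exact absurd this (lt_irrefl _)
    · rintro ⟨⟨i, c⟩, hc⟩
      have hc' := (mem_twoRowDiagram hBA).1 hc
      have hlt : c < rowCount ρ i n := by
        rcases hc' with ⟨rfl, h2⟩ | ⟨rfl, h2⟩
        · rw [tA]; exact h2
        · rw [tB]; exact h2
      obtain ⟨a, -, h1, h2⟩ := exists_rowCount_eq ρ n le_rfl hlt
      exact ⟨a, Subtype.ext (by simp only [h1, h2])⟩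
  let t : StdTableau (twoRowDiagram A B hBA) n :=
    { cell := Equiv.ofBijective _ hbij
      row_lt := by
        intro a b h1 h2
        simp only [Equiv.ofBijective_apply] at h1 h2
        rw [h1] at h2
        by_contra hab
        have := rowCount_mono ρ (ρ b) (show (b : ℕ) ≤ a from not_lt.1 hab)
        omega
      col_lt := by
        intro a b h1 h2
        simp only [Equiv.ofBijective_apply] at h1 h2
        have ha : ρ a = 0 := by have := hrow a; have := hrow b; omega
        have hb : ρ b = 1 := by have := hrow a; have := hrow b; omega
        rw [ha, hb] at h1
        by_contra hab
        have e1 := rowCount_mono ρ 0 (show (b : ℕ) ≤ a from not_lt.1 hab)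
        have e2 := rowCount_succ_of_eq ρ b hb
        have e3 := rowCount_succ_of_ne ρ b (i := 0) (by omega)
        have e4 := hnonneg (b + 1) b.isLt
        omega }
  have trow : t.row = ρ := rfl
  have ttab : ∀ k ≤ n, ∃ ν : YoungDiagram, ν.cells = t.remaining k ∧ IsTwoRow r ν := by
    intro k hk
    have hν : (twoRowDiagram (rowCount ρ 0 k) (rowCount ρ 1 k) (hnonneg k hk)).cells =
        t.remaining k := by
      ext ⟨i, c⟩
      rw [mem_twoRowDiagram, StdTableau.remaining, Finset.mem_image]
      constructor
      · intro hc
        have hlt : c < rowCount ρ i k := by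
          rcases hc with ⟨h1, h2⟩ | ⟨h1, h2⟩
          · simp only at h1 h2; rw [h1]; exact h2
          · simp only at h1 h2; rw [h1]; exact h2
        obtain ⟨a, ha, h1, h2⟩ := exists_rowCount_eq ρ k hk hlt
        exact ⟨a, by simp [ha], Prod.ext h1 (by rw [← h2, ← h1]; rfl)⟩
      · rintro ⟨a, ha, e⟩
        simp only [Finset.mem_filter, Finset.mem_univ, true_and] at ha
        have e' : (ρ a, rowCount ρ (ρ a) a) = (i, c) := e
        simp only [Prod.mk.injEq] at e'
        have := rowCount_lt ρ a ha
        rw [e'.1] at this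
        rw [← e'.2, e'.1]
        rcases hrow a with e0 | e0
        · rw [e0] at e'
          rw [← e'.1] at this ⊢
          exact Or.inl ⟨rfl, this⟩
        · rw [e0] at e'
          rw [← e'.1] at this ⊢
          exact Or.inr ⟨rfl, this⟩
    refine ⟨_, hν, ?_, ?_⟩
    · refine le_of_not_gt fun hcol => ?_
      rw [← YoungDiagram.mem_iff_lt_colLen, ← YoungDiagram.mem_cells, mem_twoRowDiagram] at hcol
      simp at hcol
    · rw [t.rowLen_eq hν, t.rowLen_eq hν, trow]
      have e := hsub k hk
      rw [← hρ] at e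
      have := h.2.le k
      omega
  refine ⟨⟨t, ttab⟩, Subtype.ext (funext fun k => ?_)⟩
  change tabHeight m t k = h.1 k
  by_cases hk : k < n
  · rw [tabHeight, if_pos hk, trow, hsub k hk.le]
  · rw [tabHeight, if_neg hk]
    by_cases hkm : k ≤ n + m
    · have := h.2.descent hend (k - n) (by omega)
      rw [show n + (k - n) = k by omega] at this
      omega
    · rw [h.2.eq_zero k (by omega)]
      omega

end TabPath

/-! ### Matrix entries of the Jones sectors -/

theorem qdim_nonneg {r : ℕ} (hr : 2 ≤ r) {k : ℤ} (h0 : -1 ≤ k) (hk : k + 1 ≤ r) :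
    0 ≤ qdim r k := by
  rcases eq_or_lt_of_le h0 with rfl | h0
  · simp [qdim, quantumInt_zero]
  rcases eq_or_lt_of_le hk with hk | hk
  · rw [qdim, hk, quantumInt_self hr]
  · exact (qdim_pos (by omega) (by omega)).le

section Entries

variable {r n m A B : ℕ} {hBA : B ≤ A}

theorem Tab.axial_eq (t : Tab r (twoRowDiagram A B hBA) n) (a b : Fin n) :
    t.axial a b = ((rowCount t.1.row (t.1.row a) a : ℤ) - rowCount t.1.row (t.1.row b) b) -
      ((t.1.row a : ℤ) - t.1.row b) := by
  rw [Tab.axial, t.cell_eq, t.cell_eq]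

theorem Tab.axial_of_row_eq (t : Tab r (twoRowDiagram A B hBA) n) {a b : Fin n}
    (hab : (a : ℕ) + 1 = b) (h : t.1.row a = t.1.row b) : t.axial a b = -1 := by
  rw [t.axial_eq, ← h, ← hab, rowCount_succ_of_eq _ _ rfl]
  push_cast
  ring

theorem Tab.axial_of_zero_one (hm : A = B + m) (t : Tab r (twoRowDiagram A B hBA) n) {a b : Fin n}
    (hab : (a : ℕ) + 1 = b) (ha : t.1.row a = 0) (hb : t.1.row b = 1) :
    t.axial a b = tabHeight m t.1 a + 1 := by
  rw [t.axial_eq, ← hab, tabHeight_of_le hm t.1 a.isLt.le, ha, hb,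
    rowCount_succ_of_ne _ _ (by omega)]
  push_cast
  ring

theorem Tab.axial_of_one_zero (hm : A = B + m) (t : Tab r (twoRowDiagram A B hBA) n) {a b : Fin n}
    (hab : (a : ℕ) + 1 = b) (ha : t.1.row a = 1) (hb : t.1.row b = 0) :
    t.axial a b = -(tabHeight m t.1 a + 1) := by
  rw [t.axial_eq, ← hab, tabHeight_of_le hm t.1 a.isLt.le, ha, hb,
    rowCount_succ_of_ne _ _ (by omega)]
  push_cast
  ring

theorem Tab.height_eq_iff (hm : A = B + m) (t : Tab r (twoRowDiagram A B hBA) n) {a b : Fin n}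
    (hab : (a : ℕ) + 1 = b) :
    tabHeight m t.1 a = tabHeight m t.1 (a + 2) ↔ t.1.row a ≠ t.1.row b := by
  have hb2 : (a : ℕ) + 2 = b + 1 := by omega
  rw [hb2]
  rcases t.1.row_eq a with ha | ha <;> rcases t.1.row_eq b with hb | hb <;>
    rw [ha, hb]
  · rw [tabHeight_succ_of_row_zero hm t.1 hb, ← hab, tabHeight_succ_of_row_zero hm t.1 ha]
    omega
  · rw [tabHeight_succ_of_row_one hm t.1 hb, ← hab, tabHeight_succ_of_row_zero hm t.1 ha]
    omega
  · rw [tabHeight_succ_of_row_zero hm t.1 hb, ← hab, tabHeight_succ_of_row_one hm t.1 ha]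
    omega
  · rw [tabHeight_succ_of_row_one hm t.1 hb, ← hab, tabHeight_succ_of_row_one hm t.1 ha]
    omega

theorem Tab.alpha_of_row_eq (t : Tab r (twoRowDiagram A B hBA) n) {a b : Fin n}
    (hab : (a : ℕ) + 1 = b) (h : t.1.row a = t.1.row b) : t.alpha a b = 0 := by
  rw [Tab.alpha, t.axial_of_row_eq hab h, neg_add_cancel, quantumInt_zero, zero_div]

theorem Tab.alpha_of_row_ne (hm : A = B + m) (t : Tab r (twoRowDiagram A B hBA) n) {a b : Fin n}
    (hab : (a : ℕ) + 1 = b) (h : t.1.row a ≠ t.1.row b) :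
    t.alpha a b = qdim r (tabHeight m t.1 (a + 1)) /
      (quantumInt r 2 * qdim r (tabHeight m t.1 a)) := by
  rcases t.1.row_eq a with ha | ha <;> rcases t.1.row_eq b with hb | hb
  · omega
  · rw [Tab.alpha, t.axial_of_zero_one hm hab ha hb, tabHeight_succ_of_row_zero hm t.1 ha]
    rfl
  · rw [Tab.alpha, t.axial_of_one_zero hm hab ha hb, tabHeight_succ_of_row_one hm t.1 ha,
      quantumInt_neg, qdim, qdim, sub_add_cancel, mul_neg, neg_add, neg_add_cancel_right,
      quantumInt_neg, neg_div_neg_eq]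
  · omega

theorem Tab.beta_of_row_ne (hr : 3 ≤ r) (hm : A = B + m) (hmr : m + 2 ≤ r)
    (t : Tab r (twoRowDiagram A B hBA) n) {a b : Fin n}
    (hab : (a : ℕ) + 1 = b) (h : t.1.row a ≠ t.1.row b) :
    quantumInt r 2 * t.beta a b = sqdim r (tabHeight m t.1 a + 1) *
      sqdim r (tabHeight m t.1 a - 1) / qdim r (tabHeight m t.1 a) := by
  have hp := isPath_tabHeight hm hmr t
  have h0 := hp.nonneg a
  have h1 := hp.le a
  have q2 : 0 < quantumInt r 2 := quantumInt_pos (by omega) (by omega) (by omega)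
  have qa := hp.qdim_pos a
  have qu := qdim_nonneg (r := r) (k := tabHeight m t.1 a + 1) (by omega) (by omega) (by omega)
  have hrec : quantumInt r 2 * qdim r (tabHeight m t.1 a) =
      qdim r (tabHeight m t.1 a + 1) + qdim r (tabHeight m t.1 a - 1) := by
    rw [qdim, quantumInt_two_mul (by omega), qdim, qdim]
    congr 2
    ring
  have key : t.alpha a b * (1 - t.alpha a b) =
      qdim r (tabHeight m t.1 a + 1) * qdim r (tabHeight m t.1 a - 1) /
        (quantumInt r 2 * qdim r (tabHeight m t.1 a)) ^ 2 := by
    rw [Tab.alpha_of_row_ne hm t hab h]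
    rcases t.1.row_eq a with ha | ha
    · rw [tabHeight_succ_of_row_zero hm t.1 ha]
      field_simp
      rw [hrec]
      ring
    · rw [tabHeight_succ_of_row_one hm t.1 ha]
      field_simp
      rw [hrec]
      ring
  rw [Tab.beta, key, Real.sqrt_div' _ (by positivity), Real.sqrt_sq (by positivity),
    Real.sqrt_mul qu]
  simp only [sqdim]
  field_simp

theorem Tab.row_swap {s t : Tab r (twoRowDiagram A B hBA) n} {a b : Fin n}
    (h : ∀ c, s.1.cell c = t.1.cell (Equiv.swap a b c)) (c : Fin n) :
    s.1.row c = t.1.row (Equiv.swap a b c) := by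
  rw [StdTableau.row, h c]
  rfl

theorem Tab.agreeOff_of_row_swap {s t : Tab r (twoRowDiagram A B hBA) n}
    {a b : Fin n} (hab : (a : ℕ) + 1 = b) (h : ∀ c, s.1.row c = t.1.row (Equiv.swap a b c)) :
    AgreeOff a (tabHeight m s.1) (tabHeight m t.1) := by
  intro k hk
  rw [tabHeight, tabHeight, rowCount_swap hab h 0 (by omega), rowCount_swap hab h 1 (by omega)]

theorem Tab.eq_of_rows_eq {s t : Tab r (twoRowDiagram A B hBA) n}
    {a b : Fin n} (h : ∀ c, s.1.row c = t.1.row (Equiv.swap a b c))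
    (hrow : t.1.row a = t.1.row b) : s = t := by
  refine Tab.ext_row fun c => ?_
  rw [h, Equiv.swap_apply_def]
  split_ifs with h1 h2
  · rw [h1, hrow]
  · rw [h2, hrow]
  · rfl

theorem Tab.cell_swap_of_row {s t : Tab r (twoRowDiagram A B hBA) n}
    {a b : Fin n} (hab : (a : ℕ) + 1 = b) (h : ∀ c, s.1.row c = t.1.row (Equiv.swap a b c))
    (hrow : t.1.row a ≠ t.1.row b) (c : Fin n) :
    s.1.cell c = t.1.cell (Equiv.swap a b c) := by
  refine Subtype.ext ?_
  rw [s.cell_eq, t.cell_eq, h]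
  congr 1
  by_cases hca : c = a
  · rw [hca, Equiv.swap_apply_left, rowCount_swap hab h _ (by omega), ← hab,
      rowCount_succ_of_ne _ _ hrow]
  by_cases hcb : c = b
  · have hsa : s.1.row a ≠ t.1.row a := by
      rw [h, Equiv.swap_apply_left]
      exact hrow.symm
    rw [hcb, Equiv.swap_apply_right, ← hab, rowCount_succ_of_ne _ _ hsa,
      rowCount_swap hab h _ (by omega)]
  · rw [Equiv.swap_apply_of_ne_of_ne hca hcb,
      rowCount_swap hab h _ (fun e => hcb (Fin.ext e))]

theorem Tab.row_swap_of_agreeOff (hm : A = B + m) {s t : Tab r (twoRowDiagram A B hBA) n}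
    {a b : Fin n} (hab : (a : ℕ) + 1 = b) (hne : s ≠ t)
    (hs : tabHeight m s.1 a = tabHeight m s.1 (a + 2))
    (hagree : AgreeOff a (tabHeight m s.1) (tabHeight m t.1)) (c : Fin n) :
    s.1.row c = t.1.row (Equiv.swap a b c) := by
  have ht : tabHeight m t.1 a = tabHeight m t.1 (a + 2) := by
    rw [← hagree a (by omega), ← hagree (a + 2) (by omega), hs]
  have hsab := (s.height_eq_iff hm hab).1 hs
  have htab := (t.height_eq_iff hm hab).1 ht
  have hother : ∀ d : Fin n, d ≠ a → d ≠ b → s.1.row d = t.1.row d := by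
    intro d h1 h2
    rw [row_eq_iff hm, row_eq_iff hm, hagree d (fun e => h2 (Fin.ext (by omega))),
      hagree (d + 1) (fun e => h1 (Fin.ext (by omega)))]
  have ha : s.1.row a ≠ t.1.row a := by
    intro e
    refine hne (Tab.ext_row fun d => ?_)
    by_cases h1 : d = a
    · rw [h1, e]
    by_cases h2 : d = b
    · rw [h2]
      have := s.1.row_eq a
      have := s.1.row_eq b
      have := t.1.row_eq a
      have := t.1.row_eq b
      omega
    · exact hother d h1 h2
  have r1 := s.1.row_eq a
  have r2 := s.1.row_eq b
  have r3 := t.1.row_eq a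
  have r4 := t.1.row_eq b
  by_cases hca : c = a
  · rw [hca, Equiv.swap_apply_left]
    omega
  by_cases hcb : c = b
  · rw [hcb, Equiv.swap_apply_right]
    omega
  · rw [Equiv.swap_apply_of_ne_of_ne hca hcb, hother c hca hcb]

theorem loopValue_mul_projMatrix (hr : 3 ≤ r) (hm : A = B + m) (hmr : m + 2 ≤ r)
    (s t : Tab r (twoRowDiagram A B hBA) n) {a b : Fin n} (hab : (a : ℕ) + 1 = b) :
    loopValue r * projMatrix r (twoRowDiagram A B hBA) n a b s t =
      (pathEntry r a (tabPath hm hmr s).1 (tabPath hm hmr t).1 : ℂ) := by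
  have q2 : quantumInt r 2 ≠ 0 :=
    (quantumInt_pos (r := r) (k := 2) (by omega) (by omega) (by omega)).ne'
  have hne : a ≠ b := fun e => by rw [e] at hab; omega
  change loopValue r * _ = (pathEntry r a (tabHeight m s.1) (tabHeight m t.1) : ℂ)
  rw [loopValue_eq (by omega), projMatrix, Matrix.of_apply]
  by_cases hst : s = t
  · subst hst
    have hp := isPath_tabHeight hm hmr s
    rw [if_pos rfl, if_neg, add_zero, ← Complex.ofReal_mul]
    · congr 1
      by_cases hrow : s.1.row a = s.1.row b
      · rw [Tab.alpha_of_row_eq s hab hrow, mul_zero, pathEntry, if_neg]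
        rw [s.height_eq_iff hm hab]
        tauto
      · rw [Tab.alpha_of_row_ne hm s hab hrow, pathEntry,
          if_pos ⟨(s.height_eq_iff hm hab).2 hrow, fun _ _ => rfl⟩, hp.sqdim_mul_self]
        field_simp
    · intro h
      have := s.1.cell.injective (h a)
      rw [Equiv.swap_apply_left] at this
      exact hne this
  · rw [if_neg hst, zero_add]
    split_ifs with hsw
    · have hrs := Tab.row_swap hsw
      have hrow : t.1.row a ≠ t.1.row b := fun e => hst (Tab.eq_of_rows_eq hrs e)
      have hsa : s.1.row a = t.1.row b := by rw [hrs, Equiv.swap_apply_left]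
      have hsb : s.1.row b = t.1.row a := by rw [hrs, Equiv.swap_apply_right]
      have hagree := Tab.agreeOff_of_row_swap (m := m) hab hrs
      rw [← Complex.ofReal_mul, Tab.beta_of_row_ne hr hm hmr t hab hrow, pathEntry, if_pos]
      · rw [hagree a (by omega)]
        congr 2
        rcases t.1.row_eq a with ha | ha <;> rcases t.1.row_eq b with hb | hb
        · omega
        · rw [tabHeight_succ_of_row_zero hm t.1 ha,
            tabHeight_succ_of_row_one hm s.1 (hsa.trans hb), hagree a (by omega), mul_comm]
        · rw [tabHeight_succ_of_row_one hm t.1 ha,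
            tabHeight_succ_of_row_zero hm s.1 (hsa.trans hb), hagree a (by omega)]
        · omega
      · refine ⟨(s.height_eq_iff hm hab).2 ?_, hagree⟩
        rw [hsa, hsb]
        exact hrow.symm
    · rw [pathEntry, if_neg, Complex.ofReal_zero, mul_zero]
      rintro ⟨hs, hagree⟩
      refine hsw (Tab.cell_swap_of_row hab (Tab.row_swap_of_agreeOff hm hab hst hs hagree) ?_)
      rw [← t.height_eq_iff hm hab, ← hagree a (by omega), ← hagree (a + 2) (by omega), hs]

theorem pathOp_apply_tabPath (hr : 3 ≤ r) (hm : A = B + m) (hn : n = A + B) (hmr : m + 2 ≤ r)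
    {a b : Fin n} (hab : (a : ℕ) + 1 = b) (v : Path r (n + m) → ℂ)
    (t : Tab r (twoRowDiagram A B hBA) n) :
    pathOp r (n + m) a v (tabPath hm hmr t) =
      loopValue r * Matrix.mulVec (projMatrix r (twoRowDiagram A B hBA) n a b)
        (fun s => v (tabPath hm hmr s)) t := by
  rw [pathOp_apply, Matrix.mulVec, dotProduct, Finset.mul_sum]
  symm
  refine Fintype.sum_of_injective (tabPath hm hmr) (tabPath_injective hm hmr) _ _ ?_ ?_
  · intro k hk
    rw [pathEntry, if_neg, Complex.ofReal_zero, zero_mul]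
    rintro ⟨-, hagree⟩
    apply hk
    refine tabPath_surjective hm hn hmr k ?_
    rw [← hagree n (by omega), tabPath_end]
  · intro s
    rw [← mul_assoc, loopValue_mul_projMatrix hr hm hmr t s hab]

end Entries

/-! ### The state space in the path model -/

section StateIso

variable {r n m A B : ℕ} {hBA : B ≤ A}

theorem toPaths_labelledSkein (hmr : m + 2 ≤ r) {x : Skein (n + m)} (hx : x ∈ labelledSkein r n m)
    (h : Path r (n + m)) (hne : h.1 n ≠ m) : toPaths r (n + m) x h = 0 := by
  obtain ⟨y, rfl⟩ := hx
  refine eq_zero_of_pathOp (fun j hj1 hj2 => ?_) h hne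
  obtain ⟨l, rfl⟩ : ∃ l, j = n + l := ⟨j - n, by omega⟩
  rw [← toPaths_cupCap (by omega) hj2, cupCap_jonesWenzl (by omega) le_rfl (by omega), map_zero]

/-- Coordinates of a labelled skein with respect to tableaux. -/
noncomputable def skeinCoords (hm : A = B + m) (hmr : m + 2 ≤ r) :
    labelledSkein r n m →ₗ[ℂ] (Tab r (twoRowDiagram A B hBA) n → ℂ) :=
  LinearMap.funLeft ℂ ℂ (tabPath hm hmr) ∘ₗ toPaths r (n + m) ∘ₗ (labelledSkein r n m).subtype

theorem skeinCoords_apply (hm : A = B + m) (hmr : m + 2 ≤ r) (x : labelledSkein r n m)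
    (t : Tab r (twoRowDiagram A B hBA) n) :
    skeinCoords hm hmr x t = toPaths r (n + m) x (tabPath hm hmr t) := rfl

theorem bracketForm_eq_skeinCoords (hr : 3 ≤ r) (hm : A = B + m) (hn : n = A + B)
    (hmr : m + 2 ≤ r) (x y : labelledSkein r n m) :
    bracketForm r (x : Skein (n + m)) y =
      skeinCoords (hBA := hBA) hm hmr x ⬝ᵥ star (skeinCoords hm hmr y) := by
  rw [bracketForm_eq_sum hr (show Even (n + m) from ⟨A, by omega⟩)]
  symm
  refine Fintype.sum_of_injective (tabPath hm hmr) (tabPath_injective hm hmr) _ _ ?_ fun t => rfl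
  intro h hh
  rw [toPaths_labelledSkein hmr x.2, zero_mul]
  exact fun e => hh (tabPath_surjective hm hn hmr h e)

open scoped ComplexOrder in
theorem ker_skeinCoords (hr : 3 ≤ r) (hm : A = B + m) (hn : n = A + B) (hmr : m + 2 ≤ r) :
    LinearMap.ker (skeinCoords (n := n) (hBA := hBA) hm hmr) = radical r n m := by
  ext x
  constructor
  · intro hx y
    rw [bracketForm_eq_skeinCoords (hBA := hBA) hr hm hn hmr, LinearMap.mem_ker.1 hx,
      zero_dotProduct]
  · intro hx
    have := hx x
    rw [bracketForm_eq_skeinCoords (hBA := hBA) hr hm hn hmr] at this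
    exact LinearMap.mem_ker.2 (dotProduct_self_star_eq_zero.1 this)

theorem toPaths_jonesWenzl (hr : 2 ≤ r) : ∀ k ≤ m, ∀ x : Skein (n + m),
    (∀ l, l + 1 < k → pathOp r (n + m) (n + l) (toPaths r (n + m) x) = 0) →
      toPaths r (n + m) (jonesWenzl r (n + m) n k x) = toPaths r (n + m) x
  | 0, _, _, _ => rfl
  | 1, _, _, _ => rfl
  | k + 2, hk, x, hx => by
    have ih := toPaths_jonesWenzl hr (k + 1) (by omega)
    have h1 := ih x fun l hl => hx l (by omega)
    have h2 : toPaths r (n + m)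
        (cupCap r (n + m) (n + k) (jonesWenzl r (n + m) n (k + 1) x)) = 0 := by
      rw [toPaths_cupCap hr (by omega), h1, hx k (by omega)]
    have h3 := ih _ fun l _ => by rw [h2, map_zero]
    rw [jonesWenzl_succ, LinearMap.sub_apply, LinearMap.smul_apply, map_sub, map_smul,
      Module.End.mul_apply, Module.End.mul_apply, h3, h2, smul_zero, sub_zero, h1]

theorem skeinCoords_surjective (hr : 3 ≤ r) (hm : A = B + m) (hn : n = A + B)
    (hmr : m + 2 ≤ r) : Function.Surjective (skeinCoords (n := n) (hBA := hBA) hm hmr) := by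
  intro w
  let v : Path r (n + m) → ℂ := Function.extend (tabPath hm hmr) w 0
  have hv : ∀ h : Path r (n + m), h.1 n ≠ m → v h = 0 := by
    intro h hne
    refine Function.extend_apply' _ _ _ ?_
    rintro ⟨t, rfl⟩
    exact hne (tabPath_end hm hmr t)
  obtain ⟨x, hx⟩ := toPaths_surjective hr (show Even (n + m) from ⟨A, by omega⟩) v
  refine ⟨⟨jonesWenzl r (n + m) n m x, x, rfl⟩, funext fun t => ?_⟩
  rw [skeinCoords_apply, toPaths_jonesWenzl (by omega) m le_rfl x, hx]
  · exact (tabPath_injective hm hmr).extend_apply _ _ _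
  · intro l hl
    rw [hx, pathOp_eq_zero hv (by omega) (by omega)]

/-- The state space in the basis of tableaux. -/
noncomputable def stateIso (hr : 3 ≤ r) (hm : A = B + m) (hn : n = A + B) (hmr : m + 2 ≤ r) :
    StateSpace r n m ≃ₗ[ℂ] (Tab r (twoRowDiagram A B hBA) n → ℂ) :=
  (Submodule.quotEquivOfEq _ _ (ker_skeinCoords hr hm hn hmr).symm).trans
    ((skeinCoords hm hmr).quotKerEquivOfSurjective (skeinCoords_surjective hr hm hn hmr))

theorem stateIso_mk (hr : 3 ≤ r) (hm : A = B + m) (hn : n = A + B) (hmr : m + 2 ≤ r)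
    (x : labelledSkein r n m) : stateIso (hBA := hBA) hr hm hn hmr (Submodule.Quotient.mk x) =
      skeinCoords hm hmr x := rfl

theorem stateForm_mk (x y : labelledSkein r n m) :
    stateForm r n m (Submodule.Quotient.mk x) (Submodule.Quotient.mk y) =
      bracketForm r (x : Skein (n + m)) y := rfl

theorem isUnitaryIso_stateIso (hr : 3 ≤ r) (hm : A = B + m) (hn : n = A + B) (hmr : m + 2 ≤ r) :
    IsUnitaryIso r n m (stateIso (hBA := hBA) hr hm hn hmr) := by
  intro v w
  induction v using Submodule.Quotient.induction_on with
  | H x =>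
    induction w using Submodule.Quotient.induction_on with
    | H y =>
      rw [stateForm_mk, stateIso_mk, stateIso_mk, bracketForm_eq_skeinCoords hr hm hn hmr]

end StateIso

/-! ### Operators induced on the state space -/

section Induced

variable {r n m : ℕ}

theorem IsInducedBy.unique {u u' : stateUnitary r n m} {T : Module.End ℂ (Skein (n + m))}
    (hu : IsInducedBy r n m u T) (hu' : IsInducedBy r n m u' T) : u = u' := by
  refine Subtype.ext (LinearEquiv.ext fun v => ?_)
  induction v using Submodule.Quotient.induction_on with
  | H x =>
    obtain ⟨y, hy, e⟩ := hu x
    obtain ⟨y', hy', e'⟩ := hu' x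
    rw [e, e', show y = y' from Subtype.ext (hy.trans hy'.symm)]

theorem IsInducedBy.one : IsInducedBy r n m 1 (1 : Module.End ℂ (Skein (n + m))) :=
  fun x => ⟨x, rfl, rfl⟩

theorem IsInducedBy.mul {u u' : stateUnitary r n m} {T T' : Module.End ℂ (Skein (n + m))}
    (hu : IsInducedBy r n m u T) (hu' : IsInducedBy r n m u' T') :
    IsInducedBy r n m (u * u') (T * T') := by
  intro x
  obtain ⟨y, hy, e⟩ := hu' x
  obtain ⟨z, hz, e'⟩ := hu y
  refine ⟨z, by rw [hz, hy]; rfl, ?_⟩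
  rw [Subgroup.coe_mul, LinearEquiv.mul_apply, e, e']

theorem IsInducedBy.pow {u : stateUnitary r n m} {T : Module.End ℂ (Skein (n + m))}
    (hu : IsInducedBy r n m u T) (k : ℕ) : IsInducedBy r n m (u ^ k) (T ^ k) := by
  induction k with
  | zero => exact IsInducedBy.one
  | succ k ih => exact ih.mul hu

theorem IsInducedBy.list_prod {ι : Type*} {u : ι → stateUnitary r n m}
    {T : ι → Module.End ℂ (Skein (n + m))} (hu : ∀ i, IsInducedBy r n m (u i) (T i)) :
    ∀ l : List ι, IsInducedBy r n m (l.map u).prod (l.map T).prod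
  | [] => IsInducedBy.one
  | i :: l => by
    rw [List.map_cons, List.map_cons, List.prod_cons, List.prod_cons]
    exact (hu i).mul (IsInducedBy.list_prod hu l)

theorem exists_isInducedBy {T T' : Module.End ℂ (Skein (n + m))} (h1 : T * T' = 1)
    (h2 : T' * T = 1) (hT : ∀ x ∈ labelledSkein r n m, T x ∈ labelledSkein r n m)
    (hT' : ∀ x ∈ labelledSkein r n m, T' x ∈ labelledSkein r n m)
    (hform : ∀ x y, bracketForm r (T x) (T y) = bracketForm r x y) :
    ∃ u : stateUnitary r n m, IsInducedBy r n m u T := by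
  have a1 : ∀ x, T (T' x) = x := fun x => LinearMap.congr_fun h1 x
  have a2 : ∀ x, T' (T x) = x := fun x => LinearMap.congr_fun h2 x
  have hrad : radical r n m ≤ (radical r n m).comap (LinearMap.restrict T hT) := by
    intro x hx y
    have := hx ⟨T' y, hT' _ y.2⟩
    rw [← hform, a1] at this
    exact this
  have hrad' : radical r n m ≤ (radical r n m).comap (LinearMap.restrict T' hT') := by
    intro x hx y
    have := hx ⟨T y, hT _ y.2⟩
    rw [← a1 (x : Skein (n + m)), hform] at this
    exact this
  let e : StateSpace r n m ≃ₗ[ℂ] StateSpace r n m := LinearEquiv.ofLinearMap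
    (Submodule.mapQ _ _ _ hrad) (Submodule.mapQ _ _ _ hrad')
    (by
      refine LinearMap.ext fun v => ?_
      induction v using Submodule.Quotient.induction_on with
      | H x => exact congrArg Submodule.Quotient.mk (Subtype.ext (a1 x)))
    (by
      refine LinearMap.ext fun v => ?_
      induction v using Submodule.Quotient.induction_on with
      | H x => exact congrArg Submodule.Quotient.mk (Subtype.ext (a2 x)))
  refine ⟨⟨e, fun v w => ?_⟩, fun x => ⟨LinearMap.restrict T hT x, rfl, rfl⟩⟩
  induction v using Submodule.Quotient.induction_on with
  | H x =>
    induction w using Submodule.Quotient.induction_on with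
    | H y => exact hform x y

theorem crossing_mem_labelledSkein {a : ℂ} {i : ℕ} (hi : i + 1 < n ∨ m ≤ 1)
    {x : Skein (n + m)} (hx : x ∈ labelledSkein r n m) :
    crossing r (n + m) a i x ∈ labelledSkein r n m := by
  obtain ⟨y, rfl⟩ := hx
  have : Commute (crossing r (n + m) a i) (jonesWenzl r (n + m) n m) := by
    refine commute_jonesWenzl r (n + m) n m fun l hl => ?_
    exact (Commute.crossing_right a (cupCap_commute r (n + m) (by omega)).symm).symm
  exact ⟨crossing r (n + m) a i y, (LinearMap.congr_fun this.eq y).symm⟩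

theorem exists_isInducedBy_crossing {a : ℂ} (ha : IsKauffmanParameter r a) (hu : conj a = a⁻¹)
    {i : ℕ} (hi : i + 1 < n ∨ m ≤ 1) :
    ∃ u : stateUnitary r n m, IsInducedBy r n m u (crossing r (n + m) a i) :=
  exists_isInducedBy (crossing_mul_inv ha _ _) (crossing_inv_mul ha _ _)
    (fun _ => crossing_mem_labelledSkein hi) (fun _ => crossing_mem_labelledSkein hi)
    (bracketForm_crossing ha hu _ _)

end Induced

/-! ### Representations of braid groups -/

theorem lift_braidRels {G : Type*} [Group G] {k : ℕ} {g : Fin k → G}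
    (hcomm : ∀ i j : Fin k, (i : ℕ) + 1 < j → g i * g j = g j * g i)
    (hbraid : ∀ i j : Fin k, (i : ℕ) + 1 = j → g i * g j * g i = g j * g i * g j) :
    ∀ w ∈ braidRels k, FreeGroup.lift g w = 1 := by
  rintro w (⟨i, j, hij, rfl⟩ | ⟨i, j, hij, rfl⟩)
  · simp only [map_mul, map_inv, FreeGroup.lift_apply_of]
    rw [hcomm i j hij]
    group
  · simp only [map_mul, map_inv, FreeGroup.lift_apply_of]
    rw [hbraid i j hij, mul_inv_cancel]

section BraidAction

variable {r n m : ℕ} {a : ℂ}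

theorem isBraidAction_unique {ρ ρ' : BraidGroup n →* stateUnitary r n m}
    (h : IsBraidAction r n m a ρ) (h' : IsBraidAction r n m a ρ') : ρ = ρ' :=
  PresentedGroup.ext fun i => (h i).unique (h' i)

theorem isInducedBy_commute {k : ℕ} {u : Fin k → stateUnitary r n m}
    (hu : ∀ i, IsInducedBy r n m (u i) (crossing r (n + m) a i)) (i j : Fin k)
    (hij : (i : ℕ) + 1 < j) : u i * u j = u j * u i := by
  refine ((hu i).mul (hu j)).unique ?_
  have := (hu j).mul (hu i)
  rwa [← (crossing_commute r (n + m) a hij).eq] at this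

theorem isInducedBy_braid (ha : IsKauffmanParameter r a) {k : ℕ} (hk : k ≤ n + m - 1)
    {u : Fin k → stateUnitary r n m}
    (hu : ∀ i, IsInducedBy r n m (u i) (crossing r (n + m) a i)) (i j : Fin k)
    (hij : (i : ℕ) + 1 = j) : u i * u j * u i = u j * u i * u j := by
  refine (((hu i).mul (hu j)).mul (hu i)).unique ?_
  have := ((hu j).mul (hu i)).mul (hu j)
  rw [← hij] at this ⊢
  rwa [← crossing_braid ha (n + m) i (by omega)] at this

theorem exists_isBraidAction (ha : IsKauffmanParameter r a) (hu : conj a = a⁻¹) :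
    ∃ ρ : BraidGroup n →* stateUnitary r n m, IsBraidAction r n m a ρ := by
  choose u hu using fun i : Fin (n - 1) => exists_isInducedBy_crossing (r := r) (n := n) (m := m)
    ha hu (i := i) (Or.inl (by omega))
  refine ⟨PresentedGroup.toGroup (f := u) (lift_braidRels (isInducedBy_commute hu)
    (isInducedBy_braid ha (by omega) hu)), fun i => ?_⟩
  rw [PresentedGroup.toGroup.of]
  exact hu i

end BraidAction

/-! ### Matrices of unitary operators -/

section UnitaryMatrix

variable {r n m : ℕ} {ι : Type} [Fintype ι] [DecidableEq ι]

theorem mem_unitaryGroup_of_dotProduct {M : Matrix ι ι ℂ}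
    (h : ∀ v w, M.mulVec v ⬝ᵥ star (M.mulVec w) = v ⬝ᵥ star w) : M ∈ Matrix.unitaryGroup ι ℂ := by
  rw [Matrix.mem_unitaryGroup_iff']
  ext i j
  have := h (Pi.single j 1) (Pi.single i 1)
  rw [Matrix.mulVec_single_one, Matrix.mulVec_single_one] at this
  rw [Matrix.mul_apply]
  have e : ∑ k, star M i k * M k j = M.col j ⬝ᵥ star (M.col i) := by
    rw [dotProduct]
    exact Finset.sum_congr rfl fun k _ => mul_comm _ _
  rw [e, this, Matrix.one_apply]
  by_cases hij : i = j
  · simp [hij]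
  · simp [hij]

/-- The matrix of a unitary operator on the state space with respect to a unitary isomorphism. -/
noncomputable def unitaryMatrix {S : StateSpace r n m ≃ₗ[ℂ] (ι → ℂ)} (hS : IsUnitaryIso r n m S) :
    stateUnitary r n m →* Matrix.unitaryGroup ι ℂ where
  toFun u := ⟨LinearMap.toMatrix' (S.toLinearMap ∘ₗ u.1.toLinearMap ∘ₗ S.symm.toLinearMap), by
    refine mem_unitaryGroup_of_dotProduct fun v w => ?_
    rw [LinearMap.toMatrix'_mulVec, LinearMap.toMatrix'_mulVec]
    simp only [LinearMap.comp_apply, LinearEquiv.coe_coe]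
    rw [← hS, u.2, hS, LinearEquiv.apply_symm_apply, LinearEquiv.apply_symm_apply]⟩
  map_one' := by
    refine Subtype.ext ?_
    have : S.toLinearMap ∘ₗ (1 : stateUnitary r n m).1.toLinearMap ∘ₗ S.symm.toLinearMap =
        LinearMap.id := by
      ext v
      simp
    simp only [this, LinearMap.toMatrix'_id]
    rfl
  map_mul' u u' := by
    refine Subtype.ext ?_
    rw [Matrix.UnitaryGroup.mul_val, ← LinearMap.toMatrix'_comp]
    ext v
    simp

theorem unitaryMatrix_mulVec {S : StateSpace r n m ≃ₗ[ℂ] (ι → ℂ)} (hS : IsUnitaryIso r n m S)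
    (u : stateUnitary r n m) (v : StateSpace r n m) :
    (unitaryMatrix hS u).1.mulVec (S v) = S (u.1 v) := by
  change (LinearMap.toMatrix' _).mulVec _ = _
  rw [LinearMap.toMatrix'_mulVec]
  simp

end UnitaryMatrix

/-! ### The equivalence -/

theorem norm_eq_one_of_mul_conj {c : ℂ} (h : c * conj c = 1) : ‖c‖ = 1 := by
  rw [Complex.mul_conj, Complex.normSq_eq_norm_sq] at h
  have h2 : ‖c‖ ^ 2 = 1 := by exact_mod_cast h
  exact (pow_eq_one_iff_of_nonneg (norm_nonneg c) two_ne_zero).1 h2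

/-- The character of the braid group sending all generators to `z`. -/
noncomputable def braidCharacter (n : ℕ) (z : Circle) : BraidGroup n →* Circle :=
  PresentedGroup.toGroup (f := fun _ => z) (lift_braidRels (fun _ _ _ => rfl) (fun _ _ _ => rfl))

theorem braidCharacter_of (n : ℕ) (z : Circle) (i : Fin (n - 1)) :
    braidCharacter n z (PresentedGroup.of i) = z :=
  PresentedGroup.toGroup.of _

theorem isJonesSector_unique {r n : ℕ} {q : ℂ} {μ : YoungDiagram}
    {ρ ρ' : BraidGroup n →* Matrix.unitaryGroup (Tab r μ n) ℂ}
    (h : IsJonesSector r q μ n ρ) (h' : IsJonesSector r q μ n ρ') : ρ = ρ' :=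
  PresentedGroup.ext fun i => Subtype.ext ((h i).trans (h' i).symm)

section Equivalence

variable {r n m A B : ℕ} {hBA : B ≤ A} {a q : ℂ}

theorem stateIso_crossing (hr : 3 ≤ r) (hm : A = B + m) (hn : n = A + B) (hmr : m + 2 ≤ r)
    {i j : Fin n} (hij : (i : ℕ) + 1 = j) {u : stateUnitary r n m}
    (hu : IsInducedBy r n m u (crossing r (n + m) a i)) (v : StateSpace r n m) :
    stateIso (hBA := hBA) hr hm hn hmr (u.1 v) =
      (a • (1 : Matrix (Tab r (twoRowDiagram A B hBA) n) (Tab r (twoRowDiagram A B hBA) n) ℂ) +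
        (a⁻¹ * loopValue r) • projMatrix r (twoRowDiagram A B hBA) n i j).mulVec
          (stateIso (hBA := hBA) hr hm hn hmr v) := by
  induction v using Submodule.Quotient.induction_on with
  | H x =>
    obtain ⟨y, hy, e⟩ := hu x
    rw [e, stateIso_mk, stateIso_mk, Matrix.add_mulVec, Matrix.smul_mulVec, Matrix.smul_mulVec,
      Matrix.one_mulVec]
    ext t
    rw [skeinCoords_apply, hy, crossing_eq, LinearMap.add_apply, LinearMap.smul_apply,
      LinearMap.smul_apply, Module.End.one_apply, map_add, map_smul, map_smul,
      toPaths_cupCap (by omega) (by omega), Pi.add_apply, Pi.smul_apply, Pi.smul_apply,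
      pathOp_apply_tabPath hr hm hn hmr hij, Pi.add_apply, Pi.smul_apply, Pi.smul_apply, mul_smul]
    rfl

/-- The braid group action on the state space of a punctured disk is a Jones sector. -/
theorem braid_equivalence (hr : 3 ≤ r) (hm : A = B + m) (hn : n = A + B) (hmr : m + 2 ≤ r)
    (ha : IsKauffmanParameter r a) (hu : conj a = a⁻¹) (hq : q = a ^ 4) :
    (∃! ρJ : BraidGroup n →* Matrix.unitaryGroup (Tab r (twoRowDiagram A B hBA) n) ℂ,
      IsJonesSector r q (twoRowDiagram A B hBA) n ρJ) ∧
    (∃! ρr : BraidGroup n →* stateUnitary r n m, IsBraidAction r n m a ρr) ∧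
    ∃ S : StateSpace r n m ≃ₗ[ℂ] (Tab r (twoRowDiagram A B hBA) n → ℂ), IsUnitaryIso r n m S ∧
      ∃ χ : BraidGroup n →* Circle,
        ∀ (ρJ : BraidGroup n →* Matrix.unitaryGroup (Tab r (twoRowDiagram A B hBA) n) ℂ)
          (ρr : BraidGroup n →* stateUnitary r n m),
          IsJonesSector r q (twoRowDiagram A B hBA) n ρJ → IsBraidAction r n m a ρr →
          ∀ (b : BraidGroup n) (v : StateSpace r n m),
            S ((ρr b).1 v) = (χ b : ℂ) • Matrix.mulVec (ρJ b).1 (S v) := by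
  have a0 := ha.1
  have hnorm : ‖a‖ = 1 := norm_eq_one_of_mul_conj (by rw [hu, mul_inv_cancel₀ a0])
  let z : Circle := ⟨a⁻¹ ^ 3, by simp [Submonoid.unitSphere, hnorm]⟩
  have hz : (z : ℂ) = a⁻¹ ^ 3 := rfl
  let χ := braidCharacter n z
  have hS := isUnitaryIso_stateIso (hBA := hBA) hr hm hn hmr
  obtain ⟨ρ, hρ⟩ := exists_isBraidAction (n := n) (m := m) ha hu
  let Θ := unitaryMatrix hS
  have hscal : ∀ b, ((χ b)⁻¹ : ℂ) • (Θ (ρ b)).1 ∈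
      Matrix.unitaryGroup (Tab r (twoRowDiagram A B hBA) n) ℂ := by
    intro b
    rw [Matrix.mem_unitaryGroup_iff, star_smul, smul_mul_smul_comm,
      Matrix.mem_unitaryGroup_iff.1 (Θ (ρ b)).2, ← Circle.coe_inv, Complex.star_def,
      ← Circle.coe_inv_eq_conj, ← Circle.coe_mul, mul_inv_cancel, Circle.coe_one, one_smul]
  let ρ₀ : BraidGroup n →* Matrix.unitaryGroup (Tab r (twoRowDiagram A B hBA) n) ℂ :=
    MonoidHom.mk' (fun b => ⟨((χ b)⁻¹ : ℂ) • (Θ (ρ b)).1, hscal b⟩) fun b b' => by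
      refine Subtype.ext ?_
      change ((χ (b * b'))⁻¹ : ℂ) • (Θ (ρ (b * b'))).1 =
        (((χ b)⁻¹ : ℂ) • (Θ (ρ b)).1) * (((χ b')⁻¹ : ℂ) • (Θ (ρ b')).1)
      rw [map_mul, map_mul, map_mul, Matrix.UnitaryGroup.mul_val, smul_mul_smul_comm,
        Circle.coe_mul, mul_inv]
  have hρ₀ : IsJonesSector r q (twoRowDiagram A B hBA) n ρ₀ := by
    intro i
    change ((χ (PresentedGroup.of i))⁻¹ : ℂ) • (Θ (ρ (PresentedGroup.of i))).1 = _
    have e : (Θ (ρ (PresentedGroup.of i))).1 =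
        a • (1 : Matrix (Tab r (twoRowDiagram A B hBA) n) (Tab r (twoRowDiagram A B hBA) n) ℂ) +
          (a⁻¹ * loopValue r) • projMatrix r (twoRowDiagram A B hBA) n ⟨i, by omega⟩
            ⟨i + 1, by omega⟩ := by
      refine Matrix.ext_of_mulVec_single fun t => ?_
      obtain ⟨v, hv⟩ := (stateIso (hBA := hBA) hr hm hn hmr).surjective (Pi.single t 1)
      rw [← hv, unitaryMatrix_mulVec hS]
      exact stateIso_crossing hr hm hn hmr (i := ⟨i, by omega⟩) (j := ⟨i + 1, by omega⟩) rfl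
        (hρ i) v
    have hχ : (χ (PresentedGroup.of i) : ℂ) = a⁻¹ ^ 3 := by
      rw [show χ (PresentedGroup.of i) = z from braidCharacter_of n z i, hz]
    have hδ : loopValue r = -(a ^ 2 + a⁻¹ ^ 2) := by linear_combination ha.2
    rw [e, hχ, hδ, hq, smul_add, smul_smul, smul_smul, sub_eq_add_neg, ← neg_smul]
    congr 2
    · field_simp
    · field_simp
      ring
  refine ⟨⟨ρ₀, hρ₀, fun ρ' h' => isJonesSector_unique h' hρ₀⟩,
    ⟨ρ, hρ, fun ρ' h' => isBraidAction_unique h' hρ⟩, _, hS, χ, ?_⟩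
  intro ρJ ρr hJ hR b v
  rw [isJonesSector_unique hJ hρ₀, isBraidAction_unique hR hρ]
  change _ = _ • Matrix.mulVec (((χ b)⁻¹ : ℂ) • (Θ (ρ b)).1) _
  rw [Matrix.smul_mulVec, smul_smul, mul_inv_cancel₀ (Circle.coe_ne_zero _), one_smul,
    unitaryMatrix_mulVec hS]

end Equivalence

/-! ### The action of the mapping class group of the punctured sphere -/

section Sphere

variable {r n : ℕ} {a : ℂ}

theorem mem_phases_of_isInducedBy (hr : 3 ≤ r) (hn : Odd n) {u : stateUnitary r n 1} {c : ℂ}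
    (hu : IsInducedBy r n 1 u (c • (1 : Module.End ℂ (Skein (n + 1))))) :
    u ∈ phases r n 1 := by
  have hc : ∀ v, u.1 v = c • v := by
    intro v
    induction v using Submodule.Quotient.induction_on with
    | H x =>
      obtain ⟨y, hy, e⟩ := hu x
      rw [e, show y = c • x from Subtype.ext hy]
      rfl
  let f := stdMatching (n + 1) hn.add_one
  let x : labelledSkein r n 1 := ⟨Pi.single f 1, Pi.single f 1, rfl⟩
  have hx : bracketForm r (x : Skein (n + 1)) x ≠ 0 := by
    rw [show (x : Skein (n + 1)) = Pi.single f 1 from rfl, bracketForm_single]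
    exact pow_ne_zero _ (loopValue_ne_zero hr)
  have hform := u.2 (Submodule.Quotient.mk x) (Submodule.Quotient.mk x)
  rw [hc, ← Submodule.Quotient.mk_smul, stateForm_mk, stateForm_mk, Submodule.coe_smul,
    bracketForm_smul_left, bracketForm_smul_right, ← mul_assoc] at hform
  have hnorm : ‖c‖ = 1 :=
    norm_eq_one_of_mul_conj (mul_right_cancel₀ hx (hform.trans (one_mul _).symm))
  exact ⟨⟨c, by simp [Submonoid.unitSphere, hnorm]⟩, hc⟩

theorem isSphereAction_unique {ρ ρ' : SphereMCG (n + 1) →* ProjStateUnitary r n 1}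
    (h : IsSphereAction r n a ρ) (h' : IsSphereAction r n a ρ') : ρ = ρ' := by
  refine PresentedGroup.ext fun i => ?_
  obtain ⟨u, hu, e⟩ := h i
  obtain ⟨u', hu', e'⟩ := h' i
  rw [e, e', hu.unique hu']

theorem exists_isSphereAction (hr : 3 ≤ r) (hn : Odd n) (ha : IsKauffmanParameter r a)
    (hu : conj a = a⁻¹) :
    ∃ ρ : SphereMCG (n + 1) →* ProjStateUnitary r n 1, IsSphereAction r n a ρ := by
  choose u hu using fun i : Fin n => exists_isInducedBy_crossing (r := r) (n := n) (m := 1)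
    ha hu (i := i) (Or.inr le_rfl)
  let T : ℕ → Module.End ℂ (Skein (n + 1)) := fun i => crossing r (n + 1) a i
  have hmk : FreeGroup.lift (fun i => (QuotientGroup.mk (u i) : ProjStateUnitary r n 1)) =
      (QuotientGroup.mk' (phases r n 1)).comp (FreeGroup.lift u) := by
    ext i
    simp
  have hof : (FreeGroup.lift u ∘ fun i => FreeGroup.of i) = u := funext fun i =>
    FreeGroup.lift_apply_of
  have hasc : IsInducedBy r n 1 (FreeGroup.lift u (coxeterWord n)) (ascending T n) := by
    have := IsInducedBy.list_prod (T := fun i : Fin n => T i) hu (List.finRange n)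
    rw [← List.ofFn_eq_map, ← List.ofFn_eq_map, prod_ofFn_eq_ascending] at this
    rw [coxeterWord, map_list_prod, List.map_ofFn, hof]
    exact this
  have hdesc : IsInducedBy r n 1 (FreeGroup.lift u (coxeterWordRev n)) (descending T n) := by
    have := IsInducedBy.list_prod (T := fun i : Fin n => T i) hu (List.finRange n).reverse
    rw [List.map_reverse, List.map_reverse, ← List.ofFn_eq_map, ← List.ofFn_eq_map,
      prod_reverse_ofFn_eq_descending] at this
    rw [coxeterWordRev, map_list_prod, List.map_reverse, List.map_ofFn, hof]
    exact this
  have hrels : ∀ w ∈ sphereRels n,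
      FreeGroup.lift (fun i => (QuotientGroup.mk (u i) : ProjStateUnitary r n 1)) w = 1 := by
    rintro w (hw | rfl | rfl)
    · rw [hmk, MonoidHom.comp_apply, lift_braidRels (isInducedBy_commute hu)
        (isInducedBy_braid ha (by omega) hu) w hw, map_one]
    · rw [hmk, MonoidHom.comp_apply, QuotientGroup.mk'_apply, QuotientGroup.eq_one_iff, map_mul]
      obtain ⟨c, hc⟩ := exists_ascending_mul_descending_crossing hr ha hn
      exact mem_phases_of_isInducedBy hr hn (hc ▸ hasc.mul hdesc)
    · rw [hmk, MonoidHom.comp_apply, QuotientGroup.mk'_apply, QuotientGroup.eq_one_iff, map_pow]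
      obtain ⟨c, hc⟩ := exists_ascending_pow_crossing hr ha hn
      exact mem_phases_of_isInducedBy hr hn (hc ▸ hasc.pow (n + 1))
  exact ⟨PresentedGroup.toGroup (rels := sphereRels n) hrels, fun i =>
    ⟨u i, hu i, PresentedGroup.toGroup.of (rels := sphereRels n) hrels⟩⟩

theorem isSphereAction_braidToSphere {ρ : SphereMCG (n + 1) →* ProjStateUnitary r n 1}
    (hρ : IsSphereAction r n a ρ) {ρ' : BraidGroup n →* stateUnitary r n 1}
    (hρ' : IsBraidAction r n 1 a ρ') (b : BraidGroup n) :
    ρ (braidToSphere n b) = (QuotientGroup.mk (ρ' b) : ProjStateUnitary r n 1) := by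
  have : ρ.comp (braidToSphere n) = (QuotientGroup.mk' (phases r n 1)).comp ρ' := by
    refine PresentedGroup.ext fun i => ?_
    obtain ⟨u, hu, e⟩ := hρ ⟨i, by omega⟩
    rw [MonoidHom.comp_apply, MonoidHom.comp_apply, braidToSphere, PresentedGroup.toGroup.of,
      inclGen, e, hu.unique (hρ' i)]
    rfl
  exact DFunLike.congr_fun this b

end Sphere

theorem kauffman_parameters {r : ℕ} {a q : ℂ}
    (haq : (a = (kauffmanA r)⁻¹ ∧ q = Complex.exp (2 * Real.pi * Complex.I / r)) ∨
      (a = kauffmanA r ∧ q = kauffmanA r ^ 4)) :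
    IsKauffmanParameter r a ∧ conj a = a⁻¹ ∧ q = a ^ 4 := by
  rcases haq with ⟨rfl, rfl⟩ | ⟨rfl, rfl⟩
  · refine ⟨(isKauffmanParameter_kauffmanA r).inv, ?_, ?_⟩
    · rw [map_inv₀, conj_kauffmanA]
    · rw [inv_pow, show kauffmanA r ^ 4 = (kauffmanA r ^ 2) ^ 2 by ring, kauffmanA_sq, neg_sq,
        ← Complex.exp_nat_mul, ← Complex.exp_neg]
      congr 1
      push_cast
      ring
  · exact ⟨isKauffmanParameter_kauffmanA r, conj_kauffmanA r, rfl⟩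

end CSJones

open CSJones in
theorem theorem3p2 (r : ℕ) (hr : 3 ≤ r) (a q : ℂ)
    (haq : (a = (kauffmanA r)⁻¹ ∧ q = Complex.exp (2 * Real.pi * Complex.I / r)) ∨
      (a = kauffmanA r ∧ q = kauffmanA r ^ 4)) :
    (∀ (n m : ℕ) (_ : m ≤ r - 2) (hmn : m ≤ n), m ≠ 1 → Even (m + n) →
      let μ : YoungDiagram := twoRowDiagram ((m + n) / 2) ((n - m) / 2) (by omega)
      (∃! ρJ : BraidGroup n →* Matrix.unitaryGroup (Tab r μ n) ℂ, IsJonesSector r q μ n ρJ) ∧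
      (∃! ρr : BraidGroup n →* stateUnitary r n m, IsBraidAction r n m a ρr) ∧
      ∀ (ρJ : BraidGroup n →* Matrix.unitaryGroup (Tab r μ n) ℂ)
        (ρr : BraidGroup n →* stateUnitary r n m),
        IsJonesSector r q μ n ρJ → IsBraidAction r n m a ρr →
        ∃ S : StateSpace r n m ≃ₗ[ℂ] (Tab r μ n → ℂ), IsUnitaryIso r n m S ∧
          ∃ χ : BraidGroup n →* Circle, ∀ (b : BraidGroup n) (v : StateSpace r n m),
            S ((ρr b).1 v) = (χ b : ℂ) • Matrix.mulVec (ρJ b).1 (S v)) ∧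
    (∀ n : ℕ, Odd n →
      let μ : YoungDiagram := twoRowDiagram ((n + 1) / 2) ((n - 1) / 2) (by omega)
      (∃! ρJ : BraidGroup n →* Matrix.unitaryGroup (Tab r μ n) ℂ, IsJonesSector r q μ n ρJ) ∧
      (∃! ρr : SphereMCG (n + 1) →* ProjStateUnitary r n 1, IsSphereAction r n a ρr) ∧
      ∀ (ρJ : BraidGroup n →* Matrix.unitaryGroup (Tab r μ n) ℂ)
        (ρr : SphereMCG (n + 1) →* ProjStateUnitary r n 1),
        IsJonesSector r q μ n ρJ → IsSphereAction r n a ρr →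
        ∃ S : StateSpace r n 1 ≃ₗ[ℂ] (Tab r μ n → ℂ), IsUnitaryIso r n 1 S ∧
          ∀ (b : BraidGroup n) (u : stateUnitary r n 1),
            (QuotientGroup.mk u : ProjStateUnitary r n 1) = ρr (braidToSphere n b) →
            ∃ z : Circle, ∀ v : StateSpace r n 1,
              S (u.1 v) = (z : ℂ) • Matrix.mulVec (ρJ b).1 (S v)) := by
  obtain ⟨ha, hu, hq⟩ := kauffman_parameters haq
  constructor
  · intro n m hm hmn _ heven μ
    have h2 := Nat.even_iff.1 heven
    obtain ⟨hJ, hR, S, hS, χ, hχ⟩ := braid_equivalence (n := n) (m := m)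
      (A := (m + n) / 2) (B := (n - m) / 2) (hBA := by omega) hr (by omega) (by omega) (by omega)
      ha hu hq
    exact ⟨hJ, hR, fun ρJ ρr h1 h2 => ⟨S, hS, χ, hχ ρJ ρr h1 h2⟩⟩
  · intro n hn μ
    have h2 := Nat.odd_iff.1 hn
    obtain ⟨hJ, ⟨ρ, hρ, -⟩, S, hS, χ, hχ⟩ := braid_equivalence (n := n) (m := 1)
      (A := (n + 1) / 2) (B := (n - 1) / 2) (hBA := by omega) hr (by omega) (by omega) (by omega)
      ha hu hq
    obtain ⟨ρs, hρs⟩ := exists_isSphereAction hr hn ha hu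
    refine ⟨hJ, ⟨ρs, hρs, fun ρ' h' => isSphereAction_unique h' hρs⟩, ?_⟩
    intro ρJ ρr h1 h2
    refine ⟨S, hS, fun b u hub => ?_⟩
    rw [isSphereAction_braidToSphere h2 hρ, eq_comm, QuotientGroup.eq] at hub
    obtain ⟨z, hz⟩ := hub
    refine ⟨z * χ b, fun v => ?_⟩
    have e : u.1 v = (z : ℂ) • (ρ b).1 v := by
      have := congrArg (ρ b).1 (hz v)
      rw [map_smul, Subgroup.coe_mul, Subgroup.coe_inv, LinearEquiv.mul_apply,
        ← LinearEquiv.mul_apply, mul_inv_cancel] at this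
      exact this
    rw [e, map_smul, hχ ρJ ρ h1 hρ, smul_smul, Circle.coe_mul]
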